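/- A *body* is a bounded connected set $\mathcal B\subset\mathbb R^3$ with piecewise smooth boundary; it is moreover required to be a solid with connected interior, i.e. $\mathcal B$ is the closure of its interior and this interior is connected. Consider the billiard in $\mathbb R^3\setminus\mathcal B$: a particle moves freely outside $\mathcal B$ and is reflected elastically finitely many times at smooth boundary points. If a motion satisfies $x(t)=x+vt$ for all $t<t_1$ and $x(t)=x^++v^+t$ for all $t>t_2$, with some real numbers $t_1,t_2$, put $x^+_{\mathcal B}(x,v)=x^+$, $v^+_{\mathcal B}(x,v)=v^+$ and $\tilde x^+_{\mathcal B}(x,v)=x^+-\langle x^+,v^+\rangle v^+$. Let $v_0\in S^2$. * $\mathcal B$ *has zero resistance* in the direction $v_0$ if $v^+_{\mathcal B}(x,v_0)$ is defined and equal to $v_0$ for almost every $x\in\mathbb R^3$. * $\mathcal B$ *leaves no trace* in the direction $v_0$ if, in addition, the map $x\mapsto\tilde x^+_{\mathcal B}(x,v_0)$ of the plane $\{v_0\}^\perp$ to itself is defined almost everywhere and preserves the two-dimensional Lebesgue measure. * $\mathcal B$ is *invisible* in the direction $v_0$ if, in addition, $\tilde x^+_{\mathcal B}(x,v_0)=x$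 for almost every $x\in\{v_0\}^\perp$. In a vertical plane let $A=(-2,-\sqrt3)$, $B=(2,-\sqrt3)$, $C=(0,\sqrt3)$ and $A'=(-2,\sqrt3)$, $B'=(2,\sqrt3)$, $C'=(0,-\sqrt3)$, let $A''=(-1,0)$ be the intersection of the segments $AC$ and $A'C'$, and $B''=(1,0)$ that of $BC$ and $B'C'$. **Theorem 1.** Fix $v_0\in S^2$. There exist (a) a body that has zero resistance in the direction $v_0$ but leaves a trace (that is, does not leave no trace); (b) a body that leaves no trace in the direction $v_0$ but is not invisible in the direction $v_0$; (c) a body invisible in the direction $v_0$. More precisely, one can take the image of the following solids under a linear isometry of $\mathbb R^3$ that carries $(0,0,-1)$ to $v_0$. (a) The solid of revolution obtained by rotating the triangle $AA'A''$ about the vertical axis $CC'$, with this axis placed on the $x_3$-axis and the point $(0,0)$ of the plane at the origin. (b) The union of four congruent copies of a prism pair glued along vertical faces. The prism pair is obtained by translating the two triangles $AA'A''$ and $BB'B''$ along a segment of length $8$ orthogonal to their plane, and is placed so that it is the set of points with $-8\le x_2\le0$ and $(x_1+2,x_3)$ in one of the two triangles; seen from above it lies in $[-4,0]\times[-8,0]$.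 The four copies are its images under the rotations by $0,\frac{\pi}{2},\pi,\frac{3\pi}{2}$ about the $x_3$-axis. (c) For some $\varepsilon>0$, the following solid. Lift the solid of revolution of (a) along its axis so that its lowest points have $x_3=\varepsilon/2$, and let $D_\varepsilon$ be the union of the lifted solid and its mirror image in the plane $x_3=0$. Shift the part $D_\varepsilon\cap\{x_1x_2\ge0\}$ up by $2\varepsilon$, and take the union of the shifted part with $D_\varepsilon\cap\{x_1x_2\le0\}$. -/

import Mathlib

open MeasureTheory Set Filter Topology
open scoped ContDiff RealInnerProductSpace

/-- Three-dimensional Euclidean space. -/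
abbrev Space : Type := EuclideanSpace ℝ (Fin 3)

/-! ### Bodies -/

/-- `n` is the outward unit normal to `B` at the smooth boundary point `x`: near `x` the set `B`
is the sublevel set `{f ≤ 0}` of a smooth function `f` with `f x = 0`, whose gradient at `x` is a
positive multiple of the unit vector `n`. -/
def IsOutwardNormal (B : Set Space) (x n : Space) : Prop :=
  ‖n‖ = 1 ∧ ∃ (U : Set Space) (f : Space → ℝ) (c : ℝ),
    IsOpen U ∧ x ∈ U ∧ ContDiffOn ℝ ∞ f U ∧ f x = 0 ∧
    0 < c ∧ HasGradientAt f (c • n) x ∧ ∀ y ∈ U, (y ∈ B ↔ f y ≤ 0)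

/-- `S` is a smooth face of `B`: a compact embedded smooth surface patch, parametrized by a compact
convex planar domain, all of whose relatively interior points are smooth boundary points of `B`. -/
def IsSmoothFace (B S : Set Space) : Prop :=
  ∃ (K : Set (EuclideanSpace ℝ (Fin 2))) (φ : EuclideanSpace ℝ (Fin 2) → Space),
    IsCompact K ∧ Convex ℝ K ∧ (interior K).Nonempty ∧
    ContDiff ℝ ∞ φ ∧ InjOn φ K ∧ (∀ u ∈ K, Function.Injective (fderiv ℝ φ u)) ∧
    φ '' K = S ∧ ∀ u ∈ interior K, ∃ n, IsOutwardNormal B (φ u) n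

/-- The boundary of `B` is piecewise smooth: it is the union of finitely many smooth faces. -/
def HasPiecewiseSmoothBoundary (B : Set Space) : Prop :=
  ∃ F : Set (Set Space), F.Finite ∧ (∀ S ∈ F, IsSmoothFace B S) ∧ ⋃₀ F = frontier B

/-- A body: a bounded connected set with piecewise smooth boundary. It is a solid, that is, the
closure of its interior, and already the interior is connected; hence so is the body itself, and
degenerate sets such as points and plates, or solids touching in a curve, are not bodies. -/
structure IsBody (B : Set Space) : Prop where
  bounded : Bornology.IsBounded B
  closure_interior : closure (interior B) = B
  connected : IsConnected (interior B)
  piecewise_smooth : HasPiecewiseSmoothBoundary B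

/-! ### Billiard motions and the scattering map -/

/-- `X` is the motion of a billiard particle in the complement of `B`, with finitely many
reflections, at the times in `T`. At every other time the particle is outside `B` and its velocity
is locally constant; at a time in `T` it hits a smooth boundary point, with outward normal `n`,
transversally with a velocity `w`, and leaves it with the velocity `w - 2 ⟪w, n⟫ n`. -/
def IsBilliardMotion (B : Set Space) (X : ℝ → Space) : Prop :=
  ∃ T : Finset ℝ,
    (∀ t, t ∉ T → X t ∉ B ∧ ∃ w : Space, ∀ᶠ s in 𝓝 t, X s = X t + (s - t) • w) ∧
    (∀ t ∈ T, ∃ n w : Space, IsOutwardNormal B (X t) n ∧ ⟪w, n⟫ < 0 ∧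
      (∀ᶠ s in 𝓝[<] t, X s = X t + (s - t) • w) ∧
      (∀ᶠ s in 𝓝[>] t, X s = X t + (s - t) • (w - (2 * ⟪w, n⟫) • n)))

/-- The graph of the scattering map: the particle moving initially as `x + t v` moves finally as
`x' + t v'`, that is, `(x⁺, v⁺) (x, v)` is defined and equals `(x', v')`. -/
def Scatters (B : Set Space) (x v x' v' : Space) : Prop :=
  ∃ X : ℝ → Space, IsBilliardMotion B X ∧
    (∀ᶠ t in atBot, X t = x + t • v) ∧ (∀ᶠ t in atTop, X t = x' + t • v')

lemma IsOutwardNormal.mem {B : Set Space} {x n : Space} (h : IsOutwardNormal B x n) : x ∈ B := by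
  obtain ⟨-, U, f, c, -, hx, -, h0, -, -, hB⟩ := h
  exact (hB x hx).2 h0.le

/-- A smooth boundary point has only one outward unit normal. -/
lemma IsOutwardNormal.unique {B : Set Space} {x n m : Space} (hn : IsOutwardNormal B x n)
    (hm : IsOutwardNormal B x m) : n = m := by
  by_contra hne
  obtain ⟨n1, U, f, c, hU, hxU, -, f0, hc, hf, hfB⟩ := hn
  obtain ⟨m1, V, g, d, hV, hxV, -, g0, hd, hg, hgB⟩ := hm
  have hlt : ⟪n, m⟫ < 1 := by
    rcases (real_inner_le_norm n m).lt_or_eq with h | h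
    · simpa [n1, m1] using h
    · exact absurd ((inner_eq_one_iff_of_norm_eq_one (𝕜 := ℝ) n1 m1).1 (by simpa [n1, m1] using h)) hne
  set u : Space := m - n with hu
  have key : ∀ (k : Space → ℝ) (a : Space), k x = 0 → HasGradientAt k a x →
      HasDerivAt (fun t : ℝ => k (x + t • u)) ⟪a, u⟫ 0 := by
    intro k a _ hk
    have h1 : HasFDerivAt k (InnerProductSpace.toDual ℝ Space a) (x + (0 : ℝ) • u) := by
      simpa using hk.hasFDerivAt
    have h2 : HasDerivAt (fun t : ℝ => x + t • u) u 0 := by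
      simpa using ((hasDerivAt_id (0 : ℝ)).smul_const u).const_add x
    exact h1.comp_hasDerivAt (0 : ℝ) h2
  have hfd := key f _ f0 hf
  have hgd := key g _ g0 hg
  have e1 : ⟪c • n, u⟫ < 0 := by
    rw [hu, inner_smul_left, inner_sub_right, real_inner_self_eq_norm_sq, n1]
    simp only [conj_trivial]
    nlinarith
  have e2 : 0 < ⟪d • m, u⟫ := by
    rw [hu, inner_smul_left, inner_sub_right, real_inner_self_eq_norm_sq, m1, real_inner_comm]
    simp only [conj_trivial]
    nlinarith
  have tend : Tendsto (fun t : ℝ => x + t • u) (𝓝[>] 0) (𝓝 x) := by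
    have : Continuous (fun t : ℝ => x + t • u) := by fun_prop
    simpa using (this.tendsto (0 : ℝ)).mono_left nhdsWithin_le_nhds
  have hle : 𝓝[>] (0 : ℝ) ≤ 𝓝[≠] 0 := nhdsWithin_mono 0 (fun t (ht : 0 < t) => ht.ne')
  have hsf := (hasDerivAt_iff_tendsto_slope.1 hfd).mono_left hle
  have hsg := (hasDerivAt_iff_tendsto_slope.1 hgd).mono_left hle
  have hall := ((((hsf.eventually (gt_mem_nhds e1)).and (hsg.eventually (lt_mem_nhds e2))).and
    (tend.eventually (hU.mem_nhds hxU))).and (tend.eventually (hV.mem_nhds hxV))).and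
    self_mem_nhdsWithin
  obtain ⟨t, ⟨⟨⟨a1, a2⟩, a3⟩, a4⟩, a5⟩ := hall.exists
  have a5' : (0 : ℝ) < t := a5
  simp only [slope_def_field, zero_smul, add_zero, f0, g0, sub_zero] at a1 a2
  have b1 : f (x + t • u) ≤ 0 := by
    by_contra h
    exact absurd a1 (not_lt.2 (div_nonneg (not_le.1 h).le a5'.le))
  have b2 : g (x + t • u) ≤ 0 := (hgB _ a4).1 ((hfB _ a3).2 b1)
  exact absurd a2 (not_lt.2 (div_nonpos_of_nonpos_of_nonneg b2 a5'.le))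

/-- A billiard motion is determined by its initial part. -/
lemma IsBilliardMotion.unique {B : Set Space} {X Y : ℝ → Space} (hX : IsBilliardMotion B X)
    (hY : IsBilliardMotion B Y) (h : ∀ᶠ t in atBot, X t = Y t) : X = Y := by
  have loc : ∀ {Z : ℝ → Space}, IsBilliardMotion B Z → ∀ t, ∃ w w' : Space,
      (∀ᶠ s in 𝓝[<] t, Z s = Z t + (s - t) • w) ∧ (∀ᶠ s in 𝓝[>] t, Z s = Z t + (s - t) • w') ∧
      ((Z t ∉ B ∧ w' = w) ∨
        ∃ n, IsOutwardNormal B (Z t) n ∧ w' = w - (2 * ⟪w, n⟫) • n) := by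
    rintro Z ⟨T, h1, h2⟩ t
    by_cases ht : t ∈ T
    · obtain ⟨n, w, hn, -, hl, hr⟩ := h2 t ht
      exact ⟨w, _, hl, hr, Or.inr ⟨n, hn, rfl⟩⟩
    · obtain ⟨hB, w, hw⟩ := h1 t ht
      exact ⟨w, w, hw.filter_mono nhdsWithin_le_nhds, hw.filter_mono nhdsWithin_le_nhds,
        Or.inl ⟨hB, rfl⟩⟩
  have step : ∀ t, (∀ s < t, X s = Y s) → X t = Y t ∧ ∀ᶠ s in 𝓝[>] t, X s = Y s := by
    intro t ht
    obtain ⟨w, w', hl, hr, hw⟩ := loc hX t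
    obtain ⟨z, z', kl, kr, hz⟩ := loc hY t
    have hev : ∀ᶠ s in 𝓝[<] t, X t + (s - t) • w = Y t + (s - t) • z := by
      filter_upwards [hl, kl, self_mem_nhdsWithin] with s h1 h2 h3
      rw [← h1, ← h2, ht s h3]
    have lim : ∀ a b : Space, Tendsto (fun s : ℝ => a + (s - t) • b) (𝓝[<] t) (𝓝 a) := by
      intro a b
      have : Continuous (fun s : ℝ => a + (s - t) • b) := by fun_prop
      simpa using (this.tendsto t).mono_left nhdsWithin_le_nhds
    have e : X t = Y t :=
      tendsto_nhds_unique ((lim (X t) w).congr' hev) (lim (Y t) z)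
    obtain ⟨s, hs, hst⟩ := (hev.and self_mem_nhdsWithin).exists
    have ewz : w = z := by
      rw [e] at hs
      exact smul_right_injective Space (sub_ne_zero.2 (ne_of_lt hst)) (add_left_cancel hs)
    have ew' : w' = z' := by
      rcases hw with ⟨p, rfl⟩ | ⟨n, hn, rfl⟩ <;> rcases hz with ⟨q, rfl⟩ | ⟨m, hm, rfl⟩
      · exact ewz
      · exact absurd (e ▸ hm.mem) p
      · exact absurd (e ▸ hn.mem) q
      · rw [ewz, hn.unique (e ▸ hm)]
    refine ⟨e, ?_⟩
    filter_upwards [hr, kr] with s h1 h2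
    rw [h1, h2, e, ew']
  by_contra hne
  obtain ⟨a, ha⟩ := Function.ne_iff.1 hne
  obtain ⟨b, hb⟩ := eventually_atBot.1 h
  set D : Set ℝ := {s | X s ≠ Y s}
  have hbd : BddBelow D := ⟨b, fun s hs => le_of_not_ge fun hle => hs (hb s hle)⟩
  obtain ⟨e, hev⟩ := step (sInf D) fun s hs => by
    by_contra hc
    exact absurd (csInf_le hbd hc) (not_le.2 hs)
  obtain ⟨u, hu, hsub⟩ := mem_nhdsGT_iff_exists_Ioo_subset.1 hev
  obtain ⟨s, hsD, hsu⟩ := exists_lt_of_csInf_lt ⟨a, ha⟩ hu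
  rcases (csInf_le hbd hsD).eq_or_lt with h1 | h1
  · exact hsD (h1 ▸ e)
  · exact hsD (hsub ⟨h1, hsu⟩)

/-- The scattering map is single-valued. -/
lemma Scatters.unique {B : Set Space} {x v x₁ v₁ x₂ v₂ : Space} (h₁ : Scatters B x v x₁ v₁)
    (h₂ : Scatters B x v x₂ v₂) : x₁ = x₂ ∧ v₁ = v₂ := by
  obtain ⟨X, hX, iX, fX⟩ := h₁
  obtain ⟨Y, hY, iY, fY⟩ := h₂
  obtain rfl := hX.unique hY (by filter_upwards [iX, iY] with t a b; rw [a, b])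
  obtain ⟨N, hN⟩ := eventually_atTop.1 (fX.and fY)
  have e : ∀ t ≥ N, x₁ + t • v₁ = x₂ + t • v₂ := fun t ht => (hN t ht).1.symm.trans (hN t ht).2
  have hv : v₁ = v₂ := by
    have h3 := congrArg₂ (· - ·) (e (N + 1) (by linarith)) (e N le_rfl)
    simpa [add_smul] using h3
  have h4 := e N le_rfl
  rw [hv] at h4
  exact ⟨add_right_cancel h4, hv⟩

/-- The plane through the origin orthogonal to `v`. -/
noncomputable abbrev perp (v : Space) : Submodule ℝ Space := (ℝ ∙ v)ᗮ

/-- Two-dimensional Lebesgue measure on the plane orthogonal to `v`. -/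
noncomputable def planeMeasure (v : Space) : Measure (perp v) :=
  @volume (perp v) measureSpaceOfInnerProductSpace

/-- Zero resistance in the direction `v`: almost every particle of the flow with initial velocity
`v` has final velocity `v`. -/
def ZeroResistance (B : Set Space) (v : Space) : Prop :=
  ∀ᵐ x : Space, ∃ x', Scatters B x v x' v

/-- Leaving no trace in the direction `v`: in addition, the map `x ↦ x̃⁺ (x, v)`, where
`x̃⁺ = x⁺ - ⟪x⁺, v⁺⟫ v⁺` and `v⁺ = v`, is defined almost everywhere in the plane orthogonal to `v`
and preserves the two-dimensional Lebesgue measure. -/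
def LeavesNoTrace (B : Set Space) (v : Space) : Prop :=
  ZeroResistance B v ∧ ∃ τ : perp v → perp v,
    MeasurePreserving τ (planeMeasure v) (planeMeasure v) ∧
    ∀ᵐ x : perp v ∂(planeMeasure v), ∃ x', Scatters B x v x' v ∧ x' - ⟪x', v⟫ • v = (τ x : Space)

/-- Invisibility in the direction `v`: in addition, `x̃⁺ (x, v) = x` for almost every `x` in the
plane orthogonal to `v`. -/
def Invisible (B : Set Space) (v : Space) : Prop :=
  LeavesNoTrace B v ∧
    ∀ᵐ x : perp v ∂(planeMeasure v), ∃ x', Scatters B x v x' v ∧ x' - ⟪x', v⟫ • v = (x : Space)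

/-! ### The three shapes

The triangles `ABC` with `A = (-2, -√3)`, `B = (2, -√3)`, `C = (0, √3)` and `A'B'C'` with
`A' = (-2, √3)`, `B' = (2, √3)`, `C' = (0, -√3)` are equilateral, `C` is the midpoint of `A'B'` and
`C'` that of `AB`. The sides `AC`, `A'C'` meet in `A'' = (-1, 0)`, and `BC`, `B'C'` meet in
`B'' = (1, 0)`. The direction of the flow is that of the vector `(0, -1)`. -/

/-- The triangle `BB'B''` with vertices `(2, -√3)`, `(2, √3)`, `(1, 0)`. Its mirror image under
`(r, z) ↦ (-r, z)` is the triangle `AA'A''`. -/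
def triangle : Set (ℝ × ℝ) := {q | |q.2| ≤ √3 * (q.1 - 1) ∧ q.1 ≤ 2}

/-- The solid generated by rotating the triangle about the vertical axis `CC'`. -/
def rotatedTriangle : Set Space := {p | (√(p 0 ^ 2 + p 1 ^ 2), p 2) ∈ triangle}

/-- The pair of triangles, placed in the planes `p 1 = const` with vertical axis `p 0 = -2`, and
translated along a segment of length `8`. Seen from above it fills two strips of the rectangle
`[-4, 0] × [-8, 0]`. -/
def pairPrism : Set Space := {p | -8 ≤ p 1 ∧ p 1 ≤ 0 ∧ (|p 0 + 2|, p 2) ∈ triangle}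

/-- The rotation by a right angle about the vertical coordinate axis. -/
def quarterTurn (p : Space) : Space := !₂[-p 1, p 0, p 2]

/-- Four congruent copies of the pair of prisms, glued along vertical faces; seen from above they lie
in the four rectangles `[-4, 0] × [-8, 0]`, `[0, 8] × [-4, 0]`, `[0, 4] × [0, 8]`,
`[-8, 0] × [0, 4]`. -/
def gluedPrisms : Set Space := ⋃ k : Fin 4, quarterTurn^[(k : ℕ)] '' pairPrism

/-- The rotated triangle lifted to the half-space above height `ε / 2`, together with its mirror
image in the horizontal coordinate plane; the distance between the two is `ε`. -/
def doubled (ε : ℝ) : Set Space :=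
  {p | (√(p 0 ^ 2 + p 1 ^ 2), |p 2| - (√3 + ε / 2)) ∈ triangle}

/-- The doubled solid, whose part over the quadrants `p 0 * p 1 ≥ 0` is shifted up by `2 ε`. -/
def shiftedDoubled (ε : ℝ) : Set Space :=
  {p | p ∈ doubled ε ∧ p 0 * p 1 ≤ 0} ∪
    (fun p => p + !₂[0, 0, 2 * ε]) '' {p | p ∈ doubled ε ∧ 0 ≤ p 0 * p 1}

/-- `B` is the shape `M` placed so that the downward vertical direction becomes `v`. -/
def IsPlacement (v : Space) (M B : Set Space) : Prop :=
  ∃ e : Space ≃ₗᵢ[ℝ] Space, e !₂[0, 0, -1] = v ∧ e '' M = B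

/-!
All three solids rest on one mechanism in a vertical plane. A particle falling at a distance
`r ∈ (1, 2)` from the vertical axis hits the upper side of one of the triangles `BB'B''`, `AA'A''`,
which deflects it by `60°` towards the axis; it crosses the axis, hits the lower side of the other
triangle at the distance `3 - r`, and falls on vertically (`Arrives.cross`, `reflect_velocity`). The
other particles fall through the gap or pass outside. So the flow is restored, and only the signed
distance from the axis has changed, from `r` to `r - 3`. For the solids in space it remains to see
which map of the plane orthogonal to the flow this induces.

* Rotation about the axis gives the map sending a point at the distance `r` to the opposite
  direction, at the distance `3 - r`. The annulus with radii `1` and `3 / 2` is the preimage of the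
  larger annulus with radii `3 / 2` and `2` (`not_measurePreserving_of_annulus`), so a trace is left.
* Translation of the triangles gives, over each of the four prism pairs, the exchange of two
  rectangles by a translation of length `3`. The four rectangles seen from above do not overlap, so
  the whole map is the composition of four such exchanges, which preserve area
  (`measurePreserving_swapBy`) but move every point over the prisms.
* For `ε = 2 / √3` the doubled and partly shifted solid is a stack of four rotated triangles at the
  heights of an arithmetic progression, each cut down to two opposite quadrants, with the quadrants
  alternating (`shiftedDoubled_eq_stack`). Over each pair of opposite quadrants there are two
  triangles, one above the other, and the mechanism works twice: `r ↦ r - 3`, followed by the same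
  map on the other side of the axis, is the identity.

Membership in these sets is given by inequalities that are affine or quadratic near each boundary
point, so the normals are gradients of the functions `quad`. That the sets are bodies is
reduced in `isBody_of_faces` to a dense connected open subset and a finite list of faces covering
the other points. Everything is done for the flow in the direction `down` and carried over by an
isometry.
-/

/-! ### Smooth boundary points, faces and bodies -/

/-- The quadratic functions that cut out all the solids below: half-spaces, cylinders and cones
around the vertical axis are sublevel sets of such functions. -/
noncomputable def quad (A B a b c k : ℝ) (p : Space) : ℝ :=
  A * (p 0 ^ 2 + p 1 ^ 2) + B * p 2 ^ 2 + a * p 0 + b * p 1 + c * p 2 + k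

lemma contDiff_quad (A B a b c k : ℝ) : ContDiff ℝ ∞ (quad A B a b c k) := by
  unfold quad
  fun_prop

lemma hasGradientAt_quad (A B a b c k : ℝ) (x : Space) :
    HasGradientAt (quad A B a b c k)
      !₂[2 * A * x 0 + a, 2 * A * x 1 + b, 2 * B * x 2 + c] x := by
  rw [hasGradientAt_iff_hasFDerivAt]
  have hp : ∀ i : Fin 3, HasFDerivAt (fun p : Space => p i)
      (EuclideanSpace.proj i : Space →L[ℝ] ℝ) x := fun i =>
    (EuclideanSpace.proj i : Space →L[ℝ] ℝ).hasFDerivAt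
  have h := ((((((((hp 0).pow 2).add ((hp 1).pow 2)).const_mul A).add
    (((hp 2).pow 2).const_mul B)).add ((hp 0).const_mul a)).add ((hp 1).const_mul b)).add
    ((hp 2).const_mul c)).add_const k
  refine h.congr_fderiv ?_
  ext v
  simp [PiLp.inner_apply, Fin.sum_univ_three]
  ring

lemma isOutwardNormal_of_quad {S : Set Space} {x n : Space} {A B a b c k l : ℝ} (hn : ‖n‖ = 1)
    (hl : 0 < l) (hg : l • n = !₂[2 * A * x 0 + a, 2 * A * x 1 + b, 2 * B * x 2 + c])
    (h0 : quad A B a b c k x = 0) (hS : ∀ᶠ y in 𝓝 x, (y ∈ S ↔ quad A B a b c k y ≤ 0)) :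
    IsOutwardNormal S x n := by
  obtain ⟨U, hU, hUo, hxU⟩ := eventually_nhds_iff.1 hS
  exact ⟨hn, U, quad A B a b c k, l, hUo, hxU, (contDiff_quad ..).contDiffOn, h0, hl,
    hg ▸ hasGradientAt_quad .., hU⟩

lemma exists_isOutwardNormal_of_quad {S : Set Space} {x : Space} (A B a b c k : ℝ)
    (hg : 2 * A * x 0 + a ≠ 0 ∨ 2 * A * x 1 + b ≠ 0 ∨ 2 * B * x 2 + c ≠ 0)
    (h0 : quad A B a b c k x = 0) (hS : ∀ᶠ y in 𝓝 x, (y ∈ S ↔ quad A B a b c k y ≤ 0)) :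
    ∃ n, IsOutwardNormal S x n := by
  set g : Space := !₂[2 * A * x 0 + a, 2 * A * x 1 + b, 2 * B * x 2 + c] with hgdef
  have hg0 : g ≠ 0 := by
    intro h
    have h' : ∀ i, g i = 0 := fun i => by rw [h]; rfl
    have h1 := h' 0
    have h2 := h' 1
    have h3 := h' 2
    simp only [hgdef] at h1 h2 h3
    simp at h1 h2 h3
    tauto
  have hgn : 0 < ‖g‖ := norm_pos_iff.2 hg0
  refine ⟨‖g‖⁻¹ • g, isOutwardNormal_of_quad ?_ hgn ?_ h0 hS⟩
  · rw [norm_smul, norm_inv, norm_norm, inv_mul_cancel₀ hgn.ne']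
  · rw [smul_smul, mul_inv_cancel₀ hgn.ne', one_smul]

lemma IsOutwardNormal.mem_frontier {B : Set Space} {x n : Space} (h : IsOutwardNormal B x n) :
    x ∈ frontier B := by
  rw [frontier_eq_closure_inter_closure]
  refine ⟨subset_closure h.mem, ?_⟩
  obtain ⟨n1, U, f, c, hU, hxU, -, f0, hc, hf, hfB⟩ := h
  have h1 : HasDerivAt (fun t : ℝ => f (x + t • n)) ⟪c • n, n⟫ 0 := by
    have h1 : HasFDerivAt f (InnerProductSpace.toDual ℝ Space (c • n)) (x + (0 : ℝ) • n) := by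
      simpa using hf.hasFDerivAt
    have h2 : HasDerivAt (fun t : ℝ => x + t • n) n 0 := by
      simpa using ((hasDerivAt_id (0 : ℝ)).smul_const n).const_add x
    exact h1.comp_hasDerivAt (0 : ℝ) h2
  have e1 : 0 < ⟪c • n, n⟫ := by
    rw [inner_smul_left, real_inner_self_eq_norm_sq, n1]
    simpa using hc
  have hsf := (hasDerivAt_iff_tendsto_slope.1 h1).mono_left
    (nhdsWithin_mono 0 (fun t (ht : 0 < t) => ht.ne') : 𝓝[>] (0 : ℝ) ≤ 𝓝[≠] 0)
  have tend : Tendsto (fun t : ℝ => x + t • n) (𝓝[>] 0) (𝓝 x) := by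
    have : Continuous (fun t : ℝ => x + t • n) := by fun_prop
    simpa using (this.tendsto (0 : ℝ)).mono_left nhdsWithin_le_nhds
  refine mem_closure_of_tendsto tend ?_
  filter_upwards [hsf.eventually (lt_mem_nhds e1), tend.eventually (hU.mem_nhds hxU),
    self_mem_nhdsWithin] with t a1 a2 a3
  have a3' : (0 : ℝ) < t := a3
  simp only [slope_def_field, zero_smul, add_zero, f0, sub_zero] at a1
  intro hB
  exact absurd a1 (not_lt.2 (div_nonpos_of_nonpos_of_nonneg ((hfB _ a2).1 hB) a3'.le))

lemma IsSmoothFace.subset_frontier {B S : Set Space} (h : IsSmoothFace B S) :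
    S ⊆ frontier B := by
  obtain ⟨K, φ, hK, hc, hne, hφ, -, -, rfl, hn⟩ := h
  have h1 : K ⊆ closure (interior K) := by
    rw [hc.closure_interior_eq_closure_of_nonempty_interior hne]
    exact subset_closure
  calc φ '' K ⊆ φ '' closure (interior K) := image_mono h1
    _ ⊆ closure (φ '' interior K) := image_closure_subset_closure_image hφ.continuous
    _ ⊆ frontier B := by
        refine closure_minimal ?_ isClosed_frontier
        rintro _ ⟨u, hu, rfl⟩
        obtain ⟨n, hn⟩ := hn u hu
        exact hn.mem_frontier

/-- The planar convex set given by a list of linear inequalities `a u₀ + b u₁ ≤ c`, encoded as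
triples `(a, b, c)`. -/
def polygon (L : List (ℝ × ℝ × ℝ)) : Set (EuclideanSpace ℝ (Fin 2)) :=
  {u | ∀ q ∈ L, q.1 * u 0 + q.2.1 * u 1 ≤ q.2.2}

lemma isClosed_polygon (L : List (ℝ × ℝ × ℝ)) : IsClosed (polygon L) := by
  have : polygon L = ⋂ q ∈ L, {u | q.1 * u 0 + q.2.1 * u 1 ≤ q.2.2} := by
    ext u; simp [polygon]
  rw [this]
  exact isClosed_biInter fun q _ => isClosed_le (by fun_prop) (by fun_prop)

lemma convex_polygon (L : List (ℝ × ℝ × ℝ)) : Convex ℝ (polygon L) := by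
  intro u hu w hw s t hs ht hst q hq
  have h1 := mul_le_mul_of_nonneg_left (hu q hq) hs
  have h2 := mul_le_mul_of_nonneg_left (hw q hq) ht
  have h3 : q.2.2 = s * q.2.2 + t * q.2.2 := by rw [← add_mul, hst, one_mul]
  simp only [PiLp.add_apply, PiLp.smul_apply, smul_eq_mul]
  rw [h3]
  linarith

lemma lt_of_mem_interior_polygon {L : List (ℝ × ℝ × ℝ)} (hL : ∀ q ∈ L, q.1 ≠ 0 ∨ q.2.1 ≠ 0)
    {u : EuclideanSpace ℝ (Fin 2)} (hu : u ∈ interior (polygon L)) :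
    ∀ q ∈ L, q.1 * u 0 + q.2.1 * u 1 < q.2.2 := by
  intro q hq
  have hcont : Continuous (fun t : ℝ => u + t • (!₂[q.1, q.2.1] : EuclideanSpace ℝ (Fin 2))) := by
    fun_prop
  have h0 : ∀ᶠ t in 𝓝[>] (0 : ℝ),
      u + t • (!₂[q.1, q.2.1] : EuclideanSpace ℝ (Fin 2)) ∈ polygon L := by
    have : Tendsto (fun t : ℝ => u + t • (!₂[q.1, q.2.1] : EuclideanSpace ℝ (Fin 2)))
        (𝓝[>] 0) (𝓝 u) := by simpa using (hcont.tendsto 0).mono_left nhdsWithin_le_nhds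
    exact this.eventually (mem_interior_iff_mem_nhds.1 hu)
  obtain ⟨t, ht, ht0⟩ := (h0.and self_mem_nhdsWithin).exists
  have h1 := ht q hq
  simp at h1
  have ht0' : (0 : ℝ) < t := ht0
  have h2 : 0 < q.1 ^ 2 + q.2.1 ^ 2 := by
    rcases hL q hq with h | h
    · positivity
    · positivity
  nlinarith [mul_pos ht0' h2]

lemma mem_interior_polygon {L : List (ℝ × ℝ × ℝ)} {u : EuclideanSpace ℝ (Fin 2)}
    (hu : ∀ q ∈ L, q.1 * u 0 + q.2.1 * u 1 < q.2.2) : u ∈ interior (polygon L) := by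
  rw [mem_interior_iff_mem_nhds]
  have h : ∀ q ∈ L, ∀ᶠ w in 𝓝 u, q.1 * w 0 + q.2.1 * w 1 < q.2.2 := fun q hq =>
    (isOpen_lt (f := fun w : EuclideanSpace ℝ (Fin 2) => q.1 * w 0 + q.2.1 * w 1)
      (by fun_prop) continuous_const).mem_nhds (hu q hq)
  have h' : ∀ᶠ w in 𝓝 u, ∀ q ∈ L, q.1 * w 0 + q.2.1 * w 1 < q.2.2 := by
    clear hu
    induction L with
    | nil => simp
    | cons q L ih =>
      have h1 := h q (by simp)
      have h2 := ih (fun q' hq' => h q' (by simp [hq']))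
      filter_upwards [h1, h2] with w a b
      exact List.forall_mem_cons.2 ⟨a, b⟩
  filter_upwards [h'] with w hw q hq using (hw q hq).le

/-- A polygonal parameter domain gives a smooth face. -/
lemma isSmoothFace_of_polygon {B : Set Space} (L : List (ℝ × ℝ × ℝ))
    (φ : EuclideanSpace ℝ (Fin 2) → Space)
    (hL : ∀ q ∈ L, q.1 ≠ 0 ∨ q.2.1 ≠ 0) (R : ℝ)
    (hR : ∀ u ∈ polygon L, |u 0| ≤ R ∧ |u 1| ≤ R)
    (u₀ : EuclideanSpace ℝ (Fin 2)) (hu₀ : ∀ q ∈ L, q.1 * u₀ 0 + q.2.1 * u₀ 1 < q.2.2)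
    (hφ : ContDiff ℝ ∞ φ) (hinj : InjOn φ (polygon L))
    (hd : ∀ u ∈ polygon L, Function.Injective (fderiv ℝ φ u))
    (hn : ∀ u : EuclideanSpace ℝ (Fin 2), (∀ q ∈ L, q.1 * u 0 + q.2.1 * u 1 < q.2.2) →
      ∃ n, IsOutwardNormal B (φ u) n) :
    IsSmoothFace B (φ '' polygon L) := by
  refine ⟨polygon L, φ, ?_, convex_polygon L, ⟨u₀, mem_interior_polygon hu₀⟩, hφ, hinj, hd, rfl,
    fun u hu => hn u (lt_of_mem_interior_polygon hL hu)⟩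
  refine Metric.isCompact_of_isClosed_isBounded (isClosed_polygon L) ?_
  rw [isBounded_iff_forall_norm_le]
  refine ⟨√(R ^ 2 + R ^ 2), fun u hu => ?_⟩
  obtain ⟨h1, h2⟩ := hR u hu
  rw [EuclideanSpace.norm_eq]
  refine Real.sqrt_le_sqrt ?_
  simp only [Fin.sum_univ_two, Real.norm_eq_abs]
  gcongr

/-- A flat face. -/
lemma isSmoothFace_flat {B : Set Space} (L : List (ℝ × ℝ × ℝ)) (p₀ a b : Space)
    (hab : ∀ s t : ℝ, s • a + t • b = 0 → s = 0 ∧ t = 0)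
    (hL : ∀ q ∈ L, q.1 ≠ 0 ∨ q.2.1 ≠ 0) (R : ℝ)
    (hR : ∀ u ∈ polygon L, |u 0| ≤ R ∧ |u 1| ≤ R)
    (u₀ : EuclideanSpace ℝ (Fin 2)) (hu₀ : ∀ q ∈ L, q.1 * u₀ 0 + q.2.1 * u₀ 1 < q.2.2)
    (hn : ∀ u : EuclideanSpace ℝ (Fin 2), (∀ q ∈ L, q.1 * u 0 + q.2.1 * u 1 < q.2.2) →
      ∃ n, IsOutwardNormal B (p₀ + u 0 • a + u 1 • b) n) :
    IsSmoothFace B ((fun u : EuclideanSpace ℝ (Fin 2) => p₀ + u 0 • a + u 1 • b) '' polygon L) := by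
  have hd : ∀ u : EuclideanSpace ℝ (Fin 2), HasFDerivAt
      (fun u : EuclideanSpace ℝ (Fin 2) => p₀ + u 0 • a + u 1 • b)
      ((EuclideanSpace.proj 0 : EuclideanSpace ℝ (Fin 2) →L[ℝ] ℝ).smulRight a +
        (EuclideanSpace.proj 1 : EuclideanSpace ℝ (Fin 2) →L[ℝ] ℝ).smulRight b) u := by
    intro u
    have h0 := (EuclideanSpace.proj 0 : EuclideanSpace ℝ (Fin 2) →L[ℝ] ℝ).hasFDerivAt (x := u)
    have h1 := (EuclideanSpace.proj 1 : EuclideanSpace ℝ (Fin 2) →L[ℝ] ℝ).hasFDerivAt (x := u)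
    exact ((h0.smul_const a).const_add p₀).add (h1.smul_const b)
  refine isSmoothFace_of_polygon L _ hL R hR u₀ hu₀ (by fun_prop) ?_ ?_ hn
  · intro u _ w _ h
    have h' : (u 0 - w 0) • a + (u 1 - w 1) • b = 0 := by
      simp only [sub_smul]
      have := sub_eq_zero.2 h
      rw [← this]; simp only; abel
    obtain ⟨h1, h2⟩ := hab _ _ h'
    ext i
    fin_cases i
    · exact sub_eq_zero.1 h1
    · exact sub_eq_zero.1 h2
  · intro u _
    rw [(hd u).fderiv]
    refine (injective_iff_map_eq_zero _).2 fun v hv => ?_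
    obtain ⟨h1, h2⟩ := hab (v 0) (v 1) (by simpa using hv)
    ext i
    fin_cases i
    · exact h1
    · exact h2

/-- A criterion for bodies: the solid is closed and bounded, it is the closure of an open connected
subset, and finitely many smooth faces cover all of its points that are not interior. -/
lemma isBody_of_faces {B C : Set Space} {ι : Type*} [Finite ι] (S : ι → Set Space)
    (hcl : IsClosed B) (hbd : Bornology.IsBounded B) (hCo : IsOpen C) (hC : IsConnected C)
    (hCB : C ⊆ B) (hBC : B ⊆ closure C) (hS : ∀ i, IsSmoothFace B (S i))
    (hcov : ∀ p ∈ B, (∃ i, p ∈ S i) ∨ B ∈ 𝓝 p) : IsBody B := by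
  have hCi : C ⊆ interior B := interior_maximal hCB hCo
  refine ⟨hbd, ?_, ?_, range S, finite_range S, by rintro _ ⟨i, rfl⟩; exact hS i, ?_⟩
  · exact (closure_minimal interior_subset hcl).antisymm (hBC.trans (closure_mono hCi))
  · exact hC.subset_closure hCi (interior_subset.trans hBC)
  · apply Subset.antisymm
    · rintro p ⟨_, ⟨i, rfl⟩, hp⟩
      exact (hS i).subset_frontier hp
    · intro p hp
      have hpB : p ∈ B := hcl.frontier_subset hp
      rcases hcov p hpB with ⟨i, hi⟩ | h
      · exact ⟨S i, ⟨i, rfl⟩, hi⟩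
      · exact absurd (mem_interior_iff_mem_nhds.2 h) hp.2

/-! ### Transport by linear isometries -/

lemma IsOutwardNormal.map {B : Set Space} {x n : Space} (h : IsOutwardNormal B x n)
    (e : Space ≃ₗᵢ[ℝ] Space) : IsOutwardNormal (e '' B) (e x) (e n) := by
  obtain ⟨n1, U, f, c, hU, hxU, hf, f0, hc, hg, hfB⟩ := h
  refine ⟨by simpa using n1, e.symm ⁻¹' U, f ∘ e.symm, c, hU.preimage e.symm.continuous,
    by simpa using hxU, ?_, by simpa using f0, hc, ?_, ?_⟩
  · exact hf.comp e.symm.contDiff.contDiffOn (fun y hy => hy)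
  · rw [hasGradientAt_iff_hasFDerivAt] at hg ⊢
    have h1 : HasFDerivAt f (InnerProductSpace.toDual ℝ Space (c • n)) (e.symm (e x)) := by
      simpa using hg
    have h2 := h1.comp (e x) (e.symm.toContinuousLinearEquiv.hasFDerivAt)
    refine h2.congr_fderiv ?_
    ext v
    simp only [ContinuousLinearMap.comp_apply, InnerProductSpace.toDual_apply_apply]
    rw [← e.inner_map_map]
    simp
  · intro y hy
    rw [Function.comp_apply, ← hfB _ hy]
    constructor
    · rintro ⟨z, hz, rfl⟩; simpa using hz
    · intro h; exact ⟨_, h, by simp⟩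

lemma IsSmoothFace.map {B S : Set Space} (h : IsSmoothFace B S) (e : Space ≃ₗᵢ[ℝ] Space) :
    IsSmoothFace (e '' B) (e '' S) := by
  obtain ⟨K, φ, hK, hc, hne, hφ, hinj, hd, rfl, hn⟩ := h
  refine ⟨K, e ∘ φ, hK, hc, hne, e.contDiff.comp hφ, e.injective.comp_injOn hinj, ?_,
    image_comp _ _ _, ?_⟩
  · intro u hu
    have h1 : HasFDerivAt φ (fderiv ℝ φ u) u :=
      ((hφ.differentiable (by simp)) u).hasFDerivAt
    have h2 := (e.toContinuousLinearEquiv.hasFDerivAt (x := φ u)).comp u h1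
    have h3 : fderiv ℝ (e ∘ φ) u = _ := h2.fderiv
    rw [h3]
    exact e.injective.comp (hd u hu)
  · intro u hu
    obtain ⟨n, hn⟩ := hn u hu
    exact ⟨e n, hn.map e⟩

lemma IsBody.map {B : Set Space} (h : IsBody B) (e : Space ≃ₗᵢ[ℝ] Space) : IsBody (e '' B) := by
  have hi : e '' interior B = interior (e '' B) := e.toHomeomorph.image_interior B
  refine ⟨?_, ?_, ?_, ?_⟩
  · exact e.lipschitz.isBounded_image h.bounded
  · rw [← hi]
    conv_rhs => rw [← h.closure_interior]
    exact (e.toHomeomorph.image_closure _).symm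
  · rw [← hi]
    exact h.connected.image _ e.continuous.continuousOn
  · obtain ⟨F, hF, hS, hU⟩ := h.piecewise_smooth
    refine ⟨(fun S => e '' S) '' F, hF.image _, ?_, ?_⟩
    · rintro _ ⟨S, hS', rfl⟩
      exact (hS S hS').map e
    · have : frontier (e '' B) = e '' frontier B := (e.toHomeomorph.image_frontier B).symm
      rw [this, ← hU, sUnion_image, image_sUnion]
      simp

lemma Scatters.map {B : Set Space} {x v x' v' : Space} (h : Scatters B x v x' v')
    (e : Space ≃ₗᵢ[ℝ] Space) : Scatters (e '' B) (e x) (e v) (e x') (e v') := by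
  obtain ⟨X, ⟨T, hT1, hT2⟩, h1, h2⟩ := h
  refine ⟨fun t => e (X t), ⟨T, fun t ht => ?_, fun t ht => ?_⟩, ?_, ?_⟩
  · obtain ⟨hB, w, hw⟩ := hT1 t ht
    refine ⟨fun ⟨y, hy, hyt⟩ => hB (e.injective hyt ▸ hy), e w, ?_⟩
    filter_upwards [hw] with s hs
    rw [hs]; simp
  · obtain ⟨n, w, hn, hwn, hl, hr⟩ := hT2 t ht
    refine ⟨e n, e w, hn.map e, by rwa [e.inner_map_map], ?_, ?_⟩
    · filter_upwards [hl] with s hs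
      rw [hs]; simp
    · filter_upwards [hr] with s hs
      rw [hs, e.inner_map_map]; simp
  · filter_upwards [h1] with t ht
    rw [ht]; simp
  · filter_upwards [h2] with t ht
    rw [ht]; simp

lemma ZeroResistance.map {B : Set Space} {v : Space} (h : ZeroResistance B v)
    (e : Space ≃ₗᵢ[ℝ] Space) : ZeroResistance (e '' B) (e v) := by
  have h1 := e.symm.measurePreserving.quasiMeasurePreserving.ae h
  filter_upwards [h1] with x hx
  obtain ⟨x', hx'⟩ := hx
  exact ⟨e x', by simpa using hx'.map e⟩

/-- The isometry between the planes orthogonal to `v` and to `e v` induced by `e`. -/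
noncomputable def perpMap (e : Space ≃ₗᵢ[ℝ] Space) (v : Space) : perp v ≃ₗᵢ[ℝ] perp (e v) where
  toFun x := ⟨e x, by
    have h := x.2
    rw [Submodule.mem_orthogonal_singleton_iff_inner_right] at h ⊢
    rwa [e.inner_map_map]⟩
  invFun y := ⟨e.symm y, by
    have h := y.2
    rw [Submodule.mem_orthogonal_singleton_iff_inner_right] at h ⊢
    rw [← e.inner_map_map]
    simpa using h⟩
  left_inv x := by simp
  right_inv y := by simp
  map_add' x y := by ext1; simp
  map_smul' c x := by ext1; simp
  norm_map' x := by
    change ‖e (x : Space)‖ = ‖(x : Space)‖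
    simp

@[simp] lemma coe_perpMap (e : Space ≃ₗᵢ[ℝ] Space) (v : Space) (x : perp v) :
    (perpMap e v x : Space) = e x := rfl

lemma coe_perpMap_symm (e : Space ≃ₗᵢ[ℝ] Space) (v : Space) (y : perp (e v)) :
    e ((perpMap e v).symm y : Space) = y := by
  rw [← coe_perpMap, LinearIsometryEquiv.apply_symm_apply]

lemma measurePreserving_perpMap (e : Space ≃ₗᵢ[ℝ] Space) (v : Space) :
    MeasurePreserving (perpMap e v) (planeMeasure v) (planeMeasure (e v)) :=
  (perpMap e v).measurePreserving

lemma measurePreserving_perpMap_symm (e : Space ≃ₗᵢ[ℝ] Space) (v : Space) :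
    MeasurePreserving (perpMap e v).symm (planeMeasure (e v)) (planeMeasure v) :=
  (perpMap e v).symm.measurePreserving

/-- The statement that `x̃⁺ (x, v)` is defined and equals `τ x` is carried over by isometries. -/
lemma ae_scatters_map {B : Set Space} {v : Space} {τ : perp v → perp v}
    (h : ∀ᵐ x : perp v ∂(planeMeasure v), ∃ x', Scatters B x v x' v ∧
      x' - ⟪x', v⟫ • v = (τ x : Space)) (e : Space ≃ₗᵢ[ℝ] Space) :
    ∀ᵐ y : perp (e v) ∂(planeMeasure (e v)), ∃ x', Scatters (e '' B) y (e v) x' (e v) ∧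
      x' - ⟪x', e v⟫ • e v = (perpMap e v (τ ((perpMap e v).symm y)) : Space) := by
  have h1 := (measurePreserving_perpMap_symm e v).quasiMeasurePreserving.ae h
  filter_upwards [h1] with y hy
  obtain ⟨x', hx', hτ⟩ := hy
  refine ⟨e x', by simpa [coe_perpMap_symm] using hx'.map e, ?_⟩
  rw [e.inner_map_map, coe_perpMap, ← hτ]
  simp

lemma LeavesNoTrace.map {B : Set Space} {v : Space} (h : LeavesNoTrace B v)
    (e : Space ≃ₗᵢ[ℝ] Space) : LeavesNoTrace (e '' B) (e v) := by
  obtain ⟨h1, τ, hτ, h2⟩ := h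
  exact ⟨h1.map e, _, (measurePreserving_perpMap e v).comp
    (hτ.comp (measurePreserving_perpMap_symm e v)), ae_scatters_map h2 e⟩

lemma Invisible.map {B : Set Space} {v : Space} (h : Invisible B v)
    (e : Space ≃ₗᵢ[ℝ] Space) : Invisible (e '' B) (e v) :=
  ⟨h.1.map e, by simpa using ae_scatters_map (τ := id) h.2 e⟩

lemma leavesNoTrace_image_iff {B : Set Space} {v : Space} (e : Space ≃ₗᵢ[ℝ] Space) :
    LeavesNoTrace (e '' B) (e v) ↔ LeavesNoTrace B v :=
  ⟨fun h => by simpa [image_image] using h.map e.symm, fun h => h.map e⟩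

lemma invisible_image_iff {B : Set Space} {v : Space} (e : Space ≃ₗᵢ[ℝ] Space) :
    Invisible (e '' B) (e v) ↔ Invisible B v :=
  ⟨fun h => by simpa [image_image] using h.map e.symm, fun h => h.map e⟩

lemma exists_linearIsometryEquiv_map_eq {u v : Space} (h : ‖u‖ = ‖v‖) :
    ∃ e : Space ≃ₗᵢ[ℝ] Space, e u = v :=
  ⟨_, Submodule.reflection_sub h⟩

/-! ### Billiard trajectories -/

/-- `X` is at time `t` outside `B` and moves uniformly. -/
def FreeAt (B : Set Space) (X : ℝ → Space) (t : ℝ) : Prop :=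
  X t ∉ B ∧ ∃ w : Space, ∀ᶠ s in 𝓝 t, X s = X t + (s - t) • w

/-- `X` is at time `t` reflected at a smooth boundary point of `B`. -/
def ReflectedAt (B : Set Space) (X : ℝ → Space) (t : ℝ) : Prop :=
  ∃ n w : Space, IsOutwardNormal B (X t) n ∧ ⟪w, n⟫ < 0 ∧
    (∀ᶠ s in 𝓝[<] t, X s = X t + (s - t) • w) ∧
    (∀ᶠ s in 𝓝[>] t, X s = X t + (s - t) • (w - (2 * ⟪w, n⟫) • n))

lemma FreeAt.congr {B : Set Space} {X Y : ℝ → Space} {t : ℝ} (h : FreeAt B X t)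
    (hXY : ∀ᶠ s in 𝓝 t, Y s = X s) : FreeAt B Y t := by
  obtain ⟨h1, w, hw⟩ := h
  have e := hXY.self_of_nhds
  refine ⟨e ▸ h1, w, ?_⟩
  filter_upwards [hw, hXY] with s h1 h2
  rw [h2, h1, e]

lemma ReflectedAt.congr {B : Set Space} {X Y : ℝ → Space} {t : ℝ} (h : ReflectedAt B X t)
    (hXY : ∀ᶠ s in 𝓝 t, Y s = X s) : ReflectedAt B Y t := by
  obtain ⟨n, w, hn, hwn, hl, hr⟩ := h
  have e := hXY.self_of_nhds
  refine ⟨n, w, e ▸ hn, hwn, ?_, ?_⟩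
  · filter_upwards [hl, hXY.filter_mono nhdsWithin_le_nhds] with s h1 h2
    rw [h2, h1, e]
  · filter_upwards [hr, hXY.filter_mono nhdsWithin_le_nhds] with s h1 h2
    rw [h2, h1, e]

/-- The particle moving initially as `x + t v` arrives, after finitely many reflections, at the
point `p` with the velocity `w`; no condition is imposed on `p` itself. -/
def Arrives (B : Set Space) (x v p w : Space) : Prop :=
  ∃ (X : ℝ → Space) (s : ℝ) (T : Finset ℝ), (∀ t ∈ T, t < s ∧ ReflectedAt B X t) ∧
    (∀ t < s, t ∉ T → FreeAt B X t) ∧ (∀ᶠ t in atBot, X t = x + t • v) ∧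
    ∀ᶠ t in 𝓝[<] s, X t = p + (t - s) • w

lemma freeAt_line {B : Set Space} (x v : Space) {t : ℝ} (s : ℝ) (h : x + (t - s) • v ∉ B) :
    FreeAt B (fun t => x + (t - s) • v) t := by
  refine ⟨h, v, Eventually.of_forall fun s' => ?_⟩
  simp only
  module

lemma arrives_of_line {B : Set Space} (x v : Space) (s : ℝ) (h : ∀ t < s, x + t • v ∉ B) :
    Arrives B x v (x + s • v) v := by
  refine ⟨fun t => x + (t - 0) • v, s, ∅, by simp, fun t ht _ => freeAt_line x v 0
    (by simpa using h t ht), Eventually.of_forall fun t => by simp, Eventually.of_forall fun t => ?_⟩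
  simp only
  module

lemma scatters_of_line {B : Set Space} (x v : Space) (h : ∀ t : ℝ, x + t • v ∉ B) :
    Scatters B x v x v := by
  refine ⟨fun t => x + (t - 0) • v, ⟨∅, fun t _ => freeAt_line x v 0
    (by simpa using h t), by simp⟩, Eventually.of_forall fun t => by simp,
    Eventually.of_forall fun t => by simp⟩

/-- An arriving motion is continued by a reflection. -/
lemma Arrives.exists_extension {B : Set Space} {x v p w n : Space} (h : Arrives B x v p w)
    (hn : IsOutwardNormal B p n) (hwn : ⟪w, n⟫ < 0) :
    ∃ (X : ℝ → Space) (s : ℝ) (T : Finset ℝ), (∀ t ∈ T, t ≤ s ∧ ReflectedAt B X t) ∧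
      (∀ t, t ∉ T → (s < t → p + (t - s) • (w - (2 * ⟪w, n⟫) • n) ∉ B) → FreeAt B X t) ∧
      (∀ᶠ t in atBot, X t = x + t • v) ∧
      ∀ t ≥ s, X t = p + (t - s) • (w - (2 * ⟪w, n⟫) • n) := by
  obtain ⟨X, s, T, hT, hfree, hbot, hs⟩ := h
  set w' := w - (2 * ⟪w, n⟫) • n with hw'
  set Y : ℝ → Space := fun t => if t < s then X t else p + (t - s) • w' with hY
  have hlt : ∀ t < s, ∀ᶠ r in 𝓝 t, Y r = X r := fun t ht => by
    filter_upwards [Iio_mem_nhds ht] with r hr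
    exact if_pos hr
  have hge : ∀ t ≥ s, Y t = p + (t - s) • w' := fun t ht => if_neg (not_lt.2 ht)
  have hYs : Y s = p := by rw [hge s le_rfl]; simp
  refine ⟨Y, s, insert s T, ?_, ?_, ?_, hge⟩
  · intro t ht
    rcases Finset.mem_insert.1 ht with rfl | ht
    · refine ⟨le_rfl, n, w, by rwa [hYs], hwn, ?_, ?_⟩
      · filter_upwards [hs, self_mem_nhdsWithin] with r h1 h2
        rw [hYs, ← h1]
        exact if_pos h2
      · filter_upwards [self_mem_nhdsWithin] with r h2
        rw [hYs]
        exact hge r (le_of_lt h2)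
    · exact ⟨(hT t ht).1.le, (hT t ht).2.congr (hlt t (hT t ht).1)⟩
  · intro t ht h
    rw [Finset.mem_insert, not_or] at ht
    rcases lt_or_gt_of_ne ht.1 with h1 | h1
    · exact (hfree t h1 ht.2).congr (hlt t h1)
    · refine (freeAt_line p w' s (h h1)).congr ?_
      filter_upwards [Ioi_mem_nhds h1] with r hr
      exact hge r (le_of_lt hr)
  · filter_upwards [hbot, Iio_mem_atBot s] with t h1 h2
    rw [← h1]
    exact if_pos h2

/-- A reflection followed by a free flight of duration `a`. -/
lemma Arrives.reflect {B : Set Space} {x v p w n : Space} (h : Arrives B x v p w)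
    (hn : IsOutwardNormal B p n) (hwn : ⟪w, n⟫ < 0) {w' : Space}
    (hw' : w' = w - (2 * ⟪w, n⟫) • n) {a : ℝ} (ha : 0 < a)
    (hfree : ∀ t : ℝ, 0 < t → t < a → p + t • w' ∉ B) :
    Arrives B x v (p + a • w') w' := by
  obtain ⟨X, s, T, hT, hX, hbot, hge⟩ := h.exists_extension hn hwn
  rw [← hw'] at hX hge
  refine ⟨X, s + a, T, fun t ht => ⟨by linarith [(hT t ht).1], (hT t ht).2⟩, fun t ht htT => ?_,
    hbot, ?_⟩
  · exact hX t htT fun h => hfree _ (by linarith) (by linarith)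
  · have : Ioi s ∈ 𝓝[<] (s + a) := mem_nhdsWithin_of_mem_nhds (Ioi_mem_nhds (by linarith))
    filter_upwards [this] with t ht
    rw [hge t (le_of_lt ht)]
    module

/-- A reflection followed by a free flight to infinity. -/
lemma Arrives.scatters {B : Set Space} {x v p w n : Space} (h : Arrives B x v p w)
    (hn : IsOutwardNormal B p n) (hwn : ⟪w, n⟫ < 0) {w' : Space}
    (hw' : w' = w - (2 * ⟪w, n⟫) • n) (hfree : ∀ t : ℝ, 0 < t → p + t • w' ∉ B) :
    ∃ s : ℝ, Scatters B x v (p + s • w') w' := by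
  obtain ⟨X, s, T, hT, hX, hbot, hge⟩ := h.exists_extension hn hwn
  rw [← hw'] at hX hge
  refine ⟨-s, X, ⟨T, fun t ht => hX t ht fun h => hfree _ (by linarith),
    fun t ht => (hT t ht).2⟩, hbot, ?_⟩
  filter_upwards [Ici_mem_atTop s] with t ht
  rw [hge t ht]
  module

/-- The direction of the flow. -/
noncomputable def down : Space := !₂[0, 0, -1]

/-- The point at height `z` and at signed distance `r` from the vertical axis through `c`, in the
horizontal direction `(a, b)`. -/
noncomputable def axial (c : Space) (a b r z : ℝ) : Space := !₂[c 0 + r * a, c 1 + r * b, c 2 + z]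

lemma axial_add_smul_down (c : Space) (a b r z t : ℝ) :
    axial c a b r z + t • down = axial c a b r (z - t) := by
  ext i
  fin_cases i <;> simp [axial, down]; ring

lemma inner_triple (a b c a' b' c' : ℝ) :
    ⟪(!₂[a, b, c] : Space), !₂[a', b', c']⟫ = a * a' + b * b' + c * c' := by
  simp [PiLp.inner_apply, Fin.sum_univ_three]
  ring

/-- The basic mechanism, in a vertical plane through the axis: a particle falling down at distance
`r ∈ (1, 2)` from the axis is reflected by the upper side of one triangle, crosses the axis and hits
the lower side of the other triangle at the signed distance `r - 3`. -/
lemma Arrives.cross {B : Set Space} {x v c : Space} {a b r : ℝ}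
    (h : Arrives B x v (axial c a b r (√3 * (r - 1))) down)
    (hn : IsOutwardNormal B (axial c a b r (√3 * (r - 1))) !₂[-(√3 / 2) * a, -(√3 / 2) * b, 1 / 2])
    (hfree : ∀ s, r - 3 < s → s < r →
      axial c a b s (√3 * (r - 1) - √3 / 3 * (r - s)) ∉ B) :
    Arrives B x v (axial c a b (r - 3) (√3 * (r - 2)))
      !₂[-(√3 / 2) * a, -(√3 / 2) * b, -(1 / 2)] := by
  have h3 : √3 * √3 = 3 := Real.mul_self_sqrt (by norm_num)
  have h3p : 0 < √3 := by positivity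
  have hi : ⟪down, (!₂[-(√3 / 2) * a, -(√3 / 2) * b, 1 / 2] : Space)⟫ = -(1 / 2) := by
    rw [down, inner_triple]; ring
  have hpos : ∀ t : ℝ, axial c a b r (√3 * (r - 1)) +
      t • (!₂[-(√3 / 2) * a, -(√3 / 2) * b, -(1 / 2)] : Space) =
      axial c a b (r - √3 / 2 * t) (√3 * (r - 1) - √3 / 3 * (r - (r - √3 / 2 * t))) := by
    intro t
    ext i
    fin_cases i
    · simp [axial]; ring
    · simp [axial]; ring
    · simp [axial]; linear_combination (t / 6) * h3
  have key := h.reflect hn (by rw [hi]; norm_num)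
    (w' := !₂[-(√3 / 2) * a, -(√3 / 2) * b, -(1 / 2)]) (a := 2 * √3) ?_ (by positivity) ?_
  · rw [hpos] at key
    convert key using 2
    · linear_combination h3
    · linear_combination (√3 / 3) * h3
  · rw [hi]
    ext i
    fin_cases i <;> simp [down]
    norm_num
  · intro t ht ht'
    rw [hpos]
    exact hfree _ (by nlinarith) (by nlinarith)

/-- The second reflection of the basic mechanism restores the vertical direction. -/
lemma reflect_velocity {a b : ℝ} (hab : a ^ 2 + b ^ 2 = 1) :
    ⟪(!₂[-(√3 / 2) * a, -(√3 / 2) * b, -(1 / 2)] : Space),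
      !₂[√3 / 2 * a, √3 / 2 * b, -(1 / 2)]⟫ = -(1 / 2) ∧
    down = !₂[-(√3 / 2) * a, -(√3 / 2) * b, -(1 / 2)] -
      (2 * ⟪(!₂[-(√3 / 2) * a, -(√3 / 2) * b, -(1 / 2)] : Space),
        !₂[√3 / 2 * a, √3 / 2 * b, -(1 / 2)]⟫) • !₂[√3 / 2 * a, √3 / 2 * b, -(1 / 2)] := by
  have h3 : √3 * √3 = 3 := Real.mul_self_sqrt (by norm_num)
  have hi : ⟪(!₂[-(√3 / 2) * a, -(√3 / 2) * b, -(1 / 2)] : Space),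
      !₂[√3 / 2 * a, √3 / 2 * b, -(1 / 2)]⟫ = -(1 / 2) := by
    rw [inner_triple]
    linear_combination (-3 / 4) * hab - (a ^ 2 + b ^ 2) / 4 * h3
  refine ⟨hi, ?_⟩
  rw [hi]
  ext i
  fin_cases i <;> simp [down]
  norm_num

/-- Membership in the triangle, for the path between the two reflections. -/
lemma crossing_notMem_triangle {r s : ℝ} (hs : r - 3 < s) (hs' : s < r) :
    (|s|, √3 * (r - 1) - √3 / 3 * (r - s)) ∉ triangle := by
  rintro ⟨h, -⟩
  have h3p : 0 < √3 := by positivity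
  simp only at h
  rcases le_total 0 s with h0 | h0
  · rw [abs_of_nonneg h0] at h
    have := (le_abs_self _).trans h
    nlinarith
  · rw [abs_of_nonpos h0] at h
    have := (neg_abs_le _).trans' (neg_le_neg h)
    nlinarith

/-! ### The plane of initial positions -/

instance (v : Space) : (planeMeasure v).IsAddHaarMeasure := by
  unfold planeMeasure
  infer_instance

lemma ae_linearMap_ne {E : Type*} [NormedAddCommGroup E] [NormedSpace ℝ E] [MeasurableSpace E]
    [BorelSpace E] [FiniteDimensional ℝ E] (μ : Measure E) [μ.IsAddHaarMeasure] {l : E →ₗ[ℝ] ℝ}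
    (hl : l ≠ 0) (c : ℝ) : ∀ᵐ x ∂μ, l x ≠ c :=
  (ae_comp_linearMap_mem_iff l μ volume (LinearMap.surjective hl)
    (measurableSet_singleton c).compl).2 (by simp [ae_iff])

lemma finrank_perp {v : Space} (hv : v ≠ 0) : Module.finrank ℝ (perp v) = 2 := by
  have : Fact (Module.finrank ℝ Space = 2 + 1) := ⟨by simp⟩
  exact Submodule.finrank_orthogonal_span_singleton hv

lemma IsBilliardMotion.time_shift {B : Set Space} {X : ℝ → Space} (h : IsBilliardMotion B X)
    (a : ℝ) : IsBilliardMotion B (fun t => X (t + a)) := by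
  obtain ⟨T, h1, h2⟩ := h
  have hc : ∀ t, Tendsto (fun s : ℝ => s + a) (𝓝 t) (𝓝 (t + a)) := fun t =>
    (continuous_id.add continuous_const).tendsto t
  refine ⟨T.image (· - a), fun t ht => ?_, fun t ht => ?_⟩
  · have ht' : t + a ∉ T := fun h => ht (Finset.mem_image.2 ⟨_, h, by ring⟩)
    obtain ⟨hB, w, hw⟩ := h1 _ ht'
    refine ⟨hB, w, ?_⟩
    filter_upwards [(hc t).eventually hw] with s hs
    rw [hs, add_sub_add_right_eq_sub]
  · obtain ⟨r, hr, rfl⟩ := Finset.mem_image.1 ht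
    obtain ⟨n, w, hn, hwn, hl, hr⟩ := h2 r hr
    have e : r - a + a = r := by ring
    have hc' := hc (r - a)
    rw [e] at hc'
    refine ⟨n, w, by simpa using hn, hwn, ?_, ?_⟩
    · have : Tendsto (fun s : ℝ => s + a) (𝓝[<] (r - a)) (𝓝[<] r) :=
        tendsto_nhdsWithin_iff.2 ⟨hc'.mono_left nhdsWithin_le_nhds, by
          filter_upwards [self_mem_nhdsWithin] with s hs
          exact lt_sub_iff_add_lt.1 (mem_Iio.1 hs)⟩
      filter_upwards [this.eventually hl] with s hs
      rw [hs, e, sub_sub_eq_add_sub]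
    · have : Tendsto (fun s : ℝ => s + a) (𝓝[>] (r - a)) (𝓝[>] r) :=
        tendsto_nhdsWithin_iff.2 ⟨hc'.mono_left nhdsWithin_le_nhds, by
          filter_upwards [self_mem_nhdsWithin] with s hs
          exact sub_lt_iff_lt_add.1 (mem_Ioi.1 hs)⟩
      filter_upwards [this.eventually hr] with s hs
      rw [hs, e, sub_sub_eq_add_sub]

lemma Scatters.time_shift {B : Set Space} {x v x' v' : Space} (h : Scatters B x v x' v') (a : ℝ) :
    Scatters B (x + a • v) v (x' + a • v') v' := by
  obtain ⟨X, hX, h1, h2⟩ := h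
  refine ⟨_, hX.time_shift a, ?_, ?_⟩
  · filter_upwards [(tendsto_atBot_add_const_right _ a tendsto_id).eventually h1] with t ht
    rw [id] at ht
    rw [ht]; module
  · filter_upwards [(tendsto_atTop_add_const_right _ a tendsto_id).eventually h2] with t ht
    rw [id] at ht
    rw [ht]; module

/-- Since the scattering depends on the trajectory only, it suffices to know it for almost all
initial positions in the plane orthogonal to the flow. -/
lemma zeroResistance_of_ae_perp {B : Set Space} {v : Space} (hv : ‖v‖ = 1)
    (h : ∀ᵐ x : perp v ∂(planeMeasure v), ∃ x', Scatters B x v x' v) : ZeroResistance B v := by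
  obtain ⟨N, hN, hNm, hN0⟩ := exists_measurable_superset_of_null (ae_iff.1 h)
  have hs : Function.Surjective ((perp v).orthogonalProjectionOnto : Space →ₗ[ℝ] perp v) :=
    fun y => ⟨y, by simp⟩
  have h1 := (ae_comp_linearMap_mem_iff _ (volume : Measure Space) (planeMeasure v) hs
    hNm.compl).2 (by simpa [ae_iff] using hN0)
  filter_upwards [h1] with x hx
  have hx' : ∃ x', Scatters B ((perp v).orthogonalProjectionOnto x) v x' v := by
    by_contra hc
    exact hx (hN hc)
  obtain ⟨x', hx'⟩ := hx'
  have e : ((perp v).orthogonalProjectionOnto x : Space) + ⟪v, x⟫ • v = x := by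
    have h2 := (ℝ ∙ v).starProjection_add_starProjection_orthogonal x
    rw [Submodule.starProjection_unit_singleton ℝ hv] at h2
    rw [Submodule.coe_orthogonalProjectionOnto_apply, add_comm]
    exact h2
  exact ⟨_, e ▸ hx'.time_shift ⟪v, x⟫⟩

open Classical in
/-- The map exchanging `R` and `R + d` by translations and fixing all other points. -/
noncomputable def swapBy {E : Type*} [AddCommGroup E] (R : Set E) (d : E) (x : E) : E :=
  if x ∈ R then x + d else if x - d ∈ R then x - d else x

lemma measurePreserving_swapBy {E : Type*} [AddCommGroup E] [MeasurableSpace E] [MeasurableAdd₂ E]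
    [MeasurableNeg E] (μ : Measure E) [μ.IsAddRightInvariant] {R : Set E} (hR : MeasurableSet R)
    {d : E} (hd : ∀ x ∈ R, x - d ∉ R) : MeasurePreserving (swapBy R d) μ μ := by
  have hadd : Measurable (fun x : E => x + d) := measurable_id.add_const d
  have hsub : Measurable (fun x : E => x - d) := by
    simpa [sub_eq_add_neg] using measurable_id.add_const (-d)
  have hR' : MeasurableSet {x | x - d ∈ R} := hsub hR
  have hm : Measurable (swapBy R d) :=
    Measurable.ite hR hadd (Measurable.ite hR' hsub measurable_id)
  refine ⟨hm, Measure.ext fun S hS => ?_⟩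
  rw [Measure.map_apply hm hS]
  set R' : Set E := {x | x - d ∈ R}
  have hdis : ∀ x, x ∈ R → x ∉ R' := hd
  have e1 : swapBy R d ⁻¹' S ∩ R = (fun x => x + d) ⁻¹' (S ∩ R') := by
    ext x
    by_cases hx : x ∈ R <;> simp [swapBy, R', hx]
  have e2 : (swapBy R d ⁻¹' S \ R) ∩ R' = (fun x => x + -d) ⁻¹' (S ∩ R) := by
    ext x
    by_cases hx : x - d ∈ R
    · have hx' : x ∉ R := fun h => hdis x h hx
      simp [swapBy, R', hx, hx', ← sub_eq_add_neg]
    · simp [R', hx, ← sub_eq_add_neg]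
  have e3 : (swapBy R d ⁻¹' S \ R) \ R' = (S \ R) \ R' := by
    ext x
    by_cases hx : x ∈ R
    · simp [hx]
    · by_cases hx' : x - d ∈ R <;> simp [swapBy, R', hx, hx']
  have e4 : (S \ R) ∩ R' = S ∩ R' := by
    ext x
    simp only [mem_inter_iff, Set.mem_sdiff]
    exact ⟨fun h => ⟨h.1.1, h.2⟩, fun h => ⟨⟨h.1, fun hx => hdis x hx h.2⟩, h.2⟩⟩
  rw [← measure_inter_add_sdiff (swapBy R d ⁻¹' S) hR,
    ← measure_inter_add_sdiff (swapBy R d ⁻¹' S \ R) hR', e1, e2, e3,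
    measure_preimage_add_right, measure_preimage_add_right,
    ← measure_inter_add_sdiff S hR, ← measure_inter_add_sdiff (S \ R) hR', e4]
  ring

/-- The reflection `r ↦ 3 - r` of the radii between `1` and `2` maps the annulus with radii `1` and
`3 / 2` onto the one with radii `3 / 2` and `2`, which has a larger area. -/
lemma not_measurePreserving_of_annulus {E : Type*} [NormedAddCommGroup E] [NormedSpace ℝ E]
    [MeasurableSpace E] [BorelSpace E] [FiniteDimensional ℝ E] (hE : Module.finrank ℝ E = 2)
    (μ : Measure E) [μ.IsAddHaarMeasure] {τ : E → E} (hτ : ∀ᵐ x ∂μ,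
      (1 < ‖x‖ → ‖x‖ < 2 → ‖τ x‖ = 3 - ‖x‖) ∧ (‖x‖ < 1 ∨ 2 < ‖x‖ → ‖τ x‖ = ‖x‖)) :
    ¬ MeasurePreserving τ μ μ := by
  intro h
  have : Nontrivial E := Module.nontrivial_of_finrank_pos (R := ℝ) (by omega)
  have hsph : ∀ r : ℝ, ∀ᵐ x ∂μ, ‖x‖ ≠ r := fun r => by
    have := Measure.addHaar_sphere μ (0 : E) r
    rw [ae_iff]
    convert this using 2
    ext x; simp
  have hA : MeasurableSet (Metric.ball (0 : E) (3 / 2) \ Metric.ball 0 1) :=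
    measurableSet_ball.diff measurableSet_ball
  have e : μ (Metric.ball (0 : E) (3 / 2) \ Metric.ball 0 1) =
      μ (Metric.ball (0 : E) 2 \ Metric.ball 0 (3 / 2)) := by
    rw [← h.measure_preimage hA.nullMeasurableSet]
    refine measure_congr (eventuallyEq_set.2 ?_)
    filter_upwards [hτ, hsph 1, hsph 2, hsph (3 / 2)] with x hx h1 h2 h3
    simp only [mem_preimage, Set.mem_sdiff, Metric.mem_ball, dist_zero_right, not_lt]
    rcases lt_or_gt_of_ne h1 with g1 | g1
    · rw [hx.2 (Or.inl g1)]
      constructor <;> rintro ⟨-, h⟩ <;> linarith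
    · rcases lt_or_gt_of_ne h2 with g2 | g2
      · rw [hx.1 g1 g2]
        rcases lt_or_gt_of_ne h3 with g3 | g3 <;> constructor <;> rintro ⟨h, h'⟩ <;>
          constructor <;> linarith
      · rw [hx.2 (Or.inr g2)]
        constructor <;> rintro ⟨h, -⟩ <;> linarith
  have d1 := measure_sdiff_add_inter (μ := μ) (Metric.ball (0 : E) (3 / 2))
    (measurableSet_ball (x := (0 : E)) (ε := 1))
  have d2 := measure_sdiff_add_inter (μ := μ) (Metric.ball (0 : E) 2)
    (measurableSet_ball (x := (0 : E)) (ε := 3 / 2))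
  rw [inter_eq_right.2 (Metric.ball_subset_ball (by norm_num))] at d1 d2
  have hfin : ∀ r : ℝ, μ (Metric.ball (0 : E) r) ≠ ⊤ := fun r => measure_ball_lt_top.ne
  have hr : ∀ r : ℝ, 0 ≤ r → (μ (Metric.ball (0 : E) r)).toReal =
      r ^ 2 * (μ (Metric.ball (0 : E) 1)).toReal := fun r hr => by
    rw [Measure.addHaar_ball μ 0 hr, hE, ENNReal.toReal_mul, ENNReal.toReal_ofReal (by positivity)]
  have hpos : 0 < (μ (Metric.ball (0 : E) 1)).toReal :=
    ENNReal.toReal_pos (Metric.measure_ball_pos μ 0 one_pos).ne' (hfin 1)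
  have hfin' : ∀ r s : ℝ, μ (Metric.ball (0 : E) r \ Metric.ball 0 s) ≠ ⊤ := fun r s =>
    ne_top_of_le_ne_top (hfin r) (measure_mono sdiff_subset)
  have d1' := congrArg ENNReal.toReal d1
  have d2' := congrArg ENNReal.toReal d2
  rw [ENNReal.toReal_add (hfin' _ _) (hfin _), hr (3 / 2) (by norm_num)] at d1'
  rw [ENNReal.toReal_add (hfin' _ _) (hfin _), hr (3 / 2) (by norm_num), hr 2 (by norm_num),
    ← e] at d2'
  linarith

/-! ### Solids generated by rotating triangles -/

/-- The distance from the vertical coordinate axis. -/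
noncomputable def rad (p : Space) : ℝ := √(p 0 ^ 2 + p 1 ^ 2)

@[fun_prop] lemma continuous_rad : Continuous rad := by
  unfold rad
  fun_prop

lemma rad_nonneg (p : Space) : 0 ≤ rad p := Real.sqrt_nonneg _

lemma rad_sq (p : Space) : rad p ^ 2 = p 0 ^ 2 + p 1 ^ 2 := Real.sq_sqrt (by positivity)

lemma sqrt_three_mul_self : √3 * √3 = 3 := Real.mul_self_sqrt (by norm_num)

lemma sqrt_three_pos : 0 < √3 := by positivity

/-- The two signs, as real numbers. -/
def sgn (b : Bool) : ℝ := if b then 1 else -1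

lemma sgn_cases (b : Bool) : sgn b = 1 ∨ sgn b = -1 := by cases b <;> simp [sgn]

lemma sgn_mul_self (b : Bool) : sgn b * sgn b = 1 := by cases b <;> simp [sgn]

lemma exists_sgn_mul_nonneg (x : ℝ) : ∃ b, 0 ≤ sgn b * x := by
  rcases le_total 0 x with h | h
  · exact ⟨true, by simpa [sgn] using h⟩
  · exact ⟨false, by simpa [sgn] using h⟩

lemma exists_sgn_mul_pos {x : ℝ} (hx : x ≠ 0) : ∃ b, 0 < sgn b * x := by
  rcases lt_or_gt_of_ne hx with h | h
  · exact ⟨false, by simpa [sgn] using h⟩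
  · exact ⟨true, by simpa [sgn] using h⟩

lemma sgn_mul_eq_abs {b : Bool} {x : ℝ} (h : 0 ≤ sgn b * x) : sgn b * x = |x| := by
  rw [← abs_of_nonneg h, abs_mul]
  rcases sgn_cases b with h | h <;> rw [h] <;> simp

/-- The interior of the triangle. -/
def openTriangle : Set (ℝ × ℝ) := {q | |q.2| < √3 * (q.1 - 1) ∧ q.1 < 2}

lemma triangle_one_le {q : ℝ × ℝ} (h : q ∈ triangle) : 1 ≤ q.1 := by
  have := (abs_nonneg _).trans h.1
  nlinarith [sqrt_three_pos]

lemma openTriangle_one_lt {q : ℝ × ℝ} (h : q ∈ openTriangle) : 1 < q.1 := by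
  have := (abs_nonneg _).trans_lt h.1
  nlinarith [sqrt_three_pos]

lemma openTriangle_subset_triangle : openTriangle ⊆ triangle := fun _ h => ⟨h.1.le, h.2.le⟩

lemma isClosed_triangle : IsClosed triangle := by
  have h1 : IsClosed {q : ℝ × ℝ | |q.2| ≤ √3 * (q.1 - 1)} :=
    isClosed_le (by fun_prop) (by fun_prop)
  have h2 : IsClosed {q : ℝ × ℝ | q.1 ≤ 2} := isClosed_le (by fun_prop) (by fun_prop)
  exact h1.inter h2

lemma isOpen_openTriangle : IsOpen openTriangle := by
  have h1 : IsOpen {q : ℝ × ℝ | |q.2| < √3 * (q.1 - 1)} :=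
    isOpen_lt (by fun_prop) (by fun_prop)
  have h2 : IsOpen {q : ℝ × ℝ | q.1 < 2} := isOpen_lt (by fun_prop) (by fun_prop)
  exact h1.inter h2

lemma triangle_abs_le {q : ℝ × ℝ} (h : q ∈ triangle) : |q.2| ≤ √3 := by
  have h1 := h.1
  have h2 := h.2
  nlinarith [sqrt_three_pos]

lemma convex_openTriangle : Convex ℝ openTriangle := by
  rintro p ⟨h1, h2⟩ q ⟨h3, h4⟩ s t hs ht hst
  have hs' : t = 1 - s := by linarith
  have key : ∀ a b c d : ℝ, a < b → c < d → s * a + t * c < s * b + t * d := by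
    intro a b c d hab hcd
    rcases hs.eq_or_lt with rfl | hs0
    · have : t = 1 := by linarith
      simpa [this] using hcd
    · nlinarith [mul_lt_mul_of_pos_left hab hs0, mul_le_mul_of_nonneg_left hcd.le ht]
  rw [abs_lt] at h1 h3
  refine ⟨abs_lt.2 ⟨?_, ?_⟩, ?_⟩
  · have := key _ _ _ _ h1.1 h3.1
    simp only [Prod.snd_add, Prod.fst_add, Prod.smul_snd, Prod.smul_fst, smul_eq_mul]
    refine lt_of_eq_of_lt ?_ this
    rw [hs']; ring
  · have := key _ _ _ _ h1.2 h3.2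
    simp only [Prod.snd_add, Prod.fst_add, Prod.smul_snd, Prod.smul_fst, smul_eq_mul]
    refine lt_of_lt_of_eq this ?_
    rw [hs']; ring
  · have := key _ _ _ _ h2 h4
    simp only [Prod.fst_add, Prod.smul_fst, smul_eq_mul]
    refine lt_of_lt_of_eq this ?_
    rw [hs']; ring

lemma triangle_subset_closure : triangle ⊆ closure openTriangle := by
  rintro ⟨r, z⟩ ⟨h1, h2⟩
  simp only at h1 h2
  have hc : Continuous (fun t : ℝ => ((1 - t) * r + t * (5 / 3), (1 - t) * z)) := by fun_prop
  have ht : Tendsto (fun t : ℝ => ((1 - t) * r + t * (5 / 3), (1 - t) * z)) (𝓝[>] 0)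
      (𝓝 (r, z)) := by simpa using (hc.tendsto 0).mono_left nhdsWithin_le_nhds
  refine mem_closure_of_tendsto ht ?_
  filter_upwards [self_mem_nhdsWithin,
    mem_nhdsWithin_of_mem_nhds (Iio_mem_nhds (zero_lt_one' ℝ))] with t ht0 ht1
  have ht0 : 0 < t := ht0
  have ht1 : t < 1 := ht1
  refine ⟨?_, ?_⟩
  · simp only
    rw [abs_mul, abs_of_pos (by linarith : 0 < 1 - t)]
    nlinarith [mul_le_mul_of_nonneg_left h1 (by linarith : 0 ≤ 1 - t), mul_pos ht0 sqrt_three_pos]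
  · simp only
    nlinarith

/-- Cylindrical coordinates in the four quadrants. -/
noncomputable def spin (σ₁ σ₂ r θ z : ℝ) : Space :=
  !₂[σ₁ * (r * Real.cos θ), σ₂ * (r * Real.sin θ), z]

lemma rad_spin (b₁ b₂ : Bool) {r θ z : ℝ} (hr : 0 ≤ r) :
    rad (spin (sgn b₁) (sgn b₂) r θ z) = r := by
  rw [rad, ← Real.sqrt_sq hr]
  congr 1
  simp only [spin, Fin.isValue, PiLp.toLp_apply, Matrix.cons_val_zero, Matrix.cons_val_one]
  rw [Real.sqrt_sq hr]
  linear_combination (r * Real.cos θ) ^ 2 * sgn_mul_self b₁ +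
    (r * Real.sin θ) ^ 2 * sgn_mul_self b₂ + r ^ 2 * Real.sin_sq_add_cos_sq θ

lemma exists_spin_eq {b₁ b₂ : Bool} {p : Space} (h1 : 0 ≤ sgn b₁ * p 0) (h2 : 0 ≤ sgn b₂ * p 1) :
    ∃ θ, 0 ≤ θ ∧ θ ≤ Real.pi / 2 ∧ p = spin (sgn b₁) (sgn b₂) (rad p) θ (p 2) := by
  set r := rad p with hr
  have hsq := rad_sq p
  rw [← hr] at hsq
  rcases (rad_nonneg p).eq_or_lt with h0 | h0
  · rw [← hr] at h0
    have hx : p 0 = 0 := by nlinarith [sq_nonneg (p 0), sq_nonneg (p 1)]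
    have hy : p 1 = 0 := by nlinarith [sq_nonneg (p 0), sq_nonneg (p 1)]
    refine ⟨0, le_rfl, by positivity, ?_⟩
    ext i
    fin_cases i <;> simp [spin, hx, hy, ← h0]
  · rw [← hr] at h0
    have hle : sgn b₁ * p 0 ≤ r := by
      rw [sgn_mul_eq_abs h1, hr, rad]
      exact Real.abs_le_sqrt (by nlinarith [sq_nonneg (p 1)])
    have hc0 : 0 ≤ sgn b₁ * p 0 / r := by positivity
    refine ⟨Real.arccos (sgn b₁ * p 0 / r), Real.arccos_nonneg _,
      Real.arccos_le_pi_div_two.2 hc0, ?_⟩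
    have hcos : Real.cos (Real.arccos (sgn b₁ * p 0 / r)) = sgn b₁ * p 0 / r :=
      Real.cos_arccos (by linarith) ((div_le_one h0).2 hle)
    have hsin : Real.sin (Real.arccos (sgn b₁ * p 0 / r)) = sgn b₂ * p 1 / r := by
      rw [Real.sin_arccos, ← Real.sqrt_sq (by positivity : 0 ≤ sgn b₂ * p 1 / r)]
      congr 1
      field_simp
      linear_combination hsq - p 0 ^ 2 * sgn_mul_self b₁ - p 1 ^ 2 * sgn_mul_self b₂
    ext i
    fin_cases i
    · simp only [spin, hcos]
      simp
      field_simp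
      linear_combination -p 0 * sgn_mul_self b₁
    · simp only [spin, hsin]
      simp
      field_simp
      linear_combination -p 1 * sgn_mul_self b₂
    · simp [spin]

lemma spin_sgn_pos {b₁ b₂ : Bool} {r θ z : ℝ} (hr : 0 < r) (h0 : 0 < θ) (h1 : θ < Real.pi / 2) :
    0 < sgn b₁ * spin (sgn b₁) (sgn b₂) r θ z 0 ∧ 0 < sgn b₂ * spin (sgn b₁) (sgn b₂) r θ z 1 := by
  have hcos := Real.cos_pos_of_mem_Ioo ⟨by linarith, h1⟩
  have hsin := Real.sin_pos_of_pos_of_lt_pi h0 (by linarith [Real.pi_pos])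
  constructor
  · simp only [spin, Fin.isValue, PiLp.toLp_apply, Matrix.cons_val_zero]
    rw [← mul_assoc, sgn_mul_self]
    positivity
  · simp only [spin, Fin.isValue, PiLp.toLp_apply, Matrix.cons_val_one, Matrix.cons_val_zero]
    rw [← mul_assoc, sgn_mul_self]
    positivity

/-- The part over a quadrant of a solid of revolution with convex profile is connected. -/
lemma isConnected_sector (b₁ b₂ : Bool) {W : Set (ℝ × ℝ)} (hW : Convex ℝ W) (hne : W.Nonempty)
    (hpos : ∀ q ∈ W, 0 < q.1) :
    IsConnected {p : Space | 0 < sgn b₁ * p 0 ∧ 0 < sgn b₂ * p 1 ∧ (rad p, p 2) ∈ W} := by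
  have h1 : IsConnected (W ×ˢ Ioo (0 : ℝ) (Real.pi / 2)) :=
    (hW.isConnected hne).prod (isConnected_Ioo (by positivity))
  have hc : Continuous (fun q : (ℝ × ℝ) × ℝ => spin (sgn b₁) (sgn b₂) q.1.1 q.2 q.1.2) := by
    unfold spin
    fun_prop
  have h2 := h1.image _ hc.continuousOn
  convert h2 using 1
  ext p
  constructor
  · rintro ⟨hx, hy, hp⟩
    obtain ⟨θ, h0, h1, e⟩ := exists_spin_eq hx.le hy.le
    refine ⟨((rad p, p 2), θ), ⟨hp, lt_of_le_of_ne h0 ?_, lt_of_le_of_ne h1 ?_⟩, e.symm⟩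
    · rintro rfl
      rw [e] at hy
      simp [spin] at hy
    · rintro rfl
      rw [e] at hx
      simp [spin] at hx
  · rintro ⟨⟨⟨r, z⟩, θ⟩, ⟨hW', h0, h1⟩, rfl⟩
    have hr : 0 < r := hpos _ hW'
    refine ⟨(spin_sgn_pos hr h0 h1).1, (spin_sgn_pos hr h0 h1).2, ?_⟩
    rw [rad_spin _ _ hr.le]
    simpa [spin] using hW'

/-- A solid of revolution with convex profile is connected. -/
lemma isConnected_revolution {W : Set (ℝ × ℝ)} (hW : Convex ℝ W) (hne : W.Nonempty)
    (hpos : ∀ q ∈ W, 0 < q.1) : IsConnected {p : Space | (rad p, p 2) ∈ W} := by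
  have h1 : IsConnected (W ×ˢ (univ : Set ℝ)) := (hW.isConnected hne).prod isConnected_univ
  have hc : Continuous (fun q : (ℝ × ℝ) × ℝ => spin 1 1 q.1.1 q.2 q.1.2) := by
    unfold spin
    fun_prop
  have h2 := h1.image _ hc.continuousOn
  convert h2 using 1
  ext p
  constructor
  · intro hp
    have hn : ‖(⟨p 0, p 1⟩ : ℂ)‖ = rad p := by
      rw [Complex.norm_eq_sqrt_sq_add_sq, rad]
    refine ⟨((rad p, p 2), Complex.arg ⟨p 0, p 1⟩), ⟨hp, mem_univ _⟩, ?_⟩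
    have e0 := Complex.norm_mul_cos_arg ⟨p 0, p 1⟩
    have e1 := Complex.norm_mul_sin_arg ⟨p 0, p 1⟩
    rw [hn] at e0 e1
    ext i
    fin_cases i
    · simpa [spin] using e0
    · simpa [spin] using e1
    · simp [spin]
  · rintro ⟨⟨⟨r, z⟩, θ⟩, ⟨hW', -⟩, rfl⟩
    have e : rad (spin 1 1 r θ z) = r := rad_spin true true (hpos _ hW').le
    change (rad (spin 1 1 r θ z), spin 1 1 r θ z 2) ∈ W
    rw [e]
    simpa [spin] using hW'

/-- Points of a closed sector of a solid of revolution are limits of points of the open sector. -/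
lemma mem_closure_sector {b₁ b₂ : Bool} {c : ℝ} {p : Space} (h1 : 0 ≤ sgn b₁ * p 0)
    (h2 : 0 ≤ sgn b₂ * p 1) (hp : (rad p, p 2 - c) ∈ triangle) :
    p ∈ closure {p : Space | 0 < sgn b₁ * p 0 ∧ 0 < sgn b₂ * p 1 ∧
      (rad p, p 2 - c) ∈ openTriangle} := by
  obtain ⟨θ, h0, h1, e⟩ := exists_spin_eq h1 h2
  have hc : Continuous (fun q : (ℝ × ℝ) × ℝ => spin (sgn b₁) (sgn b₂) q.1.1 q.2 (q.1.2 + c)) := by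
    unfold spin
    fun_prop
  have hcl : ((rad p, p 2 - c), θ) ∈ closure (openTriangle ×ˢ Ioo (0 : ℝ) (Real.pi / 2)) := by
    rw [closure_prod_eq, closure_Ioo (by positivity)]
    exact ⟨triangle_subset_closure hp, h0, h1⟩
  have h3 := image_closure_subset_closure_image hc (mem_image_of_mem _ hcl)
  have e' : spin (sgn b₁) (sgn b₂) (rad p) θ (p 2 - c + c) = p := by
    rw [sub_add_cancel]
    exact e.symm
  simp only [e'] at h3
  refine closure_mono ?_ h3
  rintro _ ⟨⟨⟨r, z⟩, θ⟩, ⟨hW', h0, h1⟩, rfl⟩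
  have hr : 0 < r := one_pos.trans (openTriangle_one_lt hW')
  refine ⟨(spin_sgn_pos hr h0 h1).1, (spin_sgn_pos hr h0 h1).2, ?_⟩
  rw [rad_spin _ _ hr.le]
  simpa [spin] using hW'

/-- Over an open quadrant and near the heights `|z - c| ≤ √3`, the set `B` is the solid generated by
rotating the triangle with its centre lifted to the height `c`. -/
def IsSectorSolid (B : Set Space) (b₁ b₂ : Bool) (c : ℝ) : Prop :=
  ∃ δ > 0, ∀ p : Space, 0 < sgn b₁ * p 0 → 0 < sgn b₂ * p 1 → |p 2 - c| < √3 + δ →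
    (p ∈ B ↔ (rad p, p 2 - c) ∈ triangle)

lemma IsSectorSolid.eventually {B : Set Space} {b₁ b₂ : Bool} {c : ℝ}
    (h : IsSectorSolid B b₁ b₂ c) {p : Space} (h1 : 0 < sgn b₁ * p 0) (h2 : 0 < sgn b₂ * p 1)
    (h3 : |p 2 - c| ≤ √3) : ∀ᶠ y in 𝓝 p, (y ∈ B ↔ (rad y, y 2 - c) ∈ triangle) := by
  obtain ⟨δ, hδ, h⟩ := h
  have o1 : IsOpen {y : Space | 0 < sgn b₁ * y 0} := isOpen_lt (by fun_prop) (by fun_prop)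
  have o2 : IsOpen {y : Space | 0 < sgn b₂ * y 1} := isOpen_lt (by fun_prop) (by fun_prop)
  have o3 : IsOpen {y : Space | |y 2 - c| < √3 + δ} := isOpen_lt (by fun_prop) (by fun_prop)
  filter_upwards [o1.mem_nhds h1, o2.mem_nhds h2, o3.mem_nhds (by simp only [mem_ofPred]; linarith)]
    with y g1 g2 g3 using h y g1 g2 g3

/-- The outward normal on the conical parts of the boundary. -/
lemma IsSectorSolid.isOutwardNormal_cone {B : Set Space} {b₁ b₂ : Bool} {c : ℝ}
    (h : IsSectorSolid B b₁ b₂ c) (b₃ : Bool) {p : Space} (h1 : 0 < sgn b₁ * p 0)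
    (h2 : 0 < sgn b₂ * p 1) (hr : 1 < rad p) (hr' : rad p < 2)
    (hz : sgn b₃ * (p 2 - c) = √3 * (rad p - 1)) :
    IsOutwardNormal B p !₂[-(√3 / 2) * (p 0 / rad p), -(√3 / 2) * (p 1 / rad p), sgn b₃ / 2] := by
  have h3 := sqrt_three_mul_self
  have h3p := sqrt_three_pos
  have hs := sgn_mul_self b₃
  have hsq := rad_sq p
  have hzp : 0 < sgn b₃ * (p 2 - c) := by rw [hz]; exact mul_pos h3p (by linarith)
  have hz' : p 2 - c = sgn b₃ * (√3 * (rad p - 1)) := by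
    rw [← hz]; linear_combination -(p 2 - c) * hs
  have hr0 : rad p ≠ 0 := by positivity
  -- the cone is `(1 + b₃ (z - c) / √3) ^ 2 = x ^ 2 + y ^ 2`
  have hq : ∀ y : Space, quad (-1) (1 / 3) 0 0 (-(2 / 3) * c + 2 * √3 / 3 * sgn b₃)
      (1 + c ^ 2 / 3 - 2 * √3 / 3 * sgn b₃ * c) y =
      (1 + √3 / 3 * (sgn b₃ * (y 2 - c))) ^ 2 - rad y ^ 2 := by
    intro y
    rw [rad_sq, quad]
    linear_combination (-(y 2 - c) ^ 2 / 3) * hs -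
      (sgn b₃ * (y 2 - c)) ^ 2 / 9 * h3
  refine isOutwardNormal_of_quad (A := -1) (B := 1 / 3) (a := 0) (b := 0)
    (c := -(2 / 3) * c + 2 * √3 / 3 * sgn b₃) (k := 1 + c ^ 2 / 3 - 2 * √3 / 3 * sgn b₃ * c)
    (l := 4 * √3 / 3 * rad p) ?_ (by positivity) ?_ ?_ ?_
  · rw [EuclideanSpace.norm_eq, Real.sqrt_eq_one]
    simp only [Fin.sum_univ_three, Real.norm_eq_abs, sq_abs]
    simp
    field_simp
    linear_combination rad p ^ 2 * hs - (p 0 ^ 2 + p 1 ^ 2) * (-h3) - 3 * hsq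
  · ext i
    fin_cases i
    · simp
      field_simp
      linear_combination (4 * p 0) * h3
    · simp
      field_simp
      linear_combination (4 * p 1) * h3
    · simp
      linear_combination (-2 / 3) * hz'
  · rw [hq, hz]
    linear_combination ((rad p - 1) * (2 / 3 + (rad p - 1) / 9 * (√3 * √3 + 3))) * h3
  · have o1 : IsOpen {y : Space | rad y < 2} := isOpen_lt (by fun_prop) (by fun_prop)
    have o2 : IsOpen {y : Space | 0 < sgn b₃ * (y 2 - c)} :=
      isOpen_lt (by fun_prop) (by fun_prop)
    have hle : |p 2 - c| ≤ √3 := by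
      rw [← sgn_mul_eq_abs hzp.le, hz]
      nlinarith
    filter_upwards [h.eventually h1 h2 hle, o1.mem_nhds hr', o2.mem_nhds hzp] with y g1 g2 g3
    have g3 : 0 < sgn b₃ * (y 2 - c) := g3
    have g2 : rad y < 2 := g2
    rw [g1, hq, sub_nonpos, pow_le_pow_iff_left₀ (by positivity) (rad_nonneg y) two_ne_zero]
    change (|y 2 - c| ≤ √3 * (rad y - 1) ∧ rad y ≤ 2) ↔ _
    rw [← sgn_mul_eq_abs g3.le]
    constructor
    · rintro ⟨g, -⟩
      nlinarith
    · intro g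
      exact ⟨by nlinarith, g2.le⟩

/-- The cylindrical part of the boundary is smooth. -/
lemma IsSectorSolid.exists_isOutwardNormal_cylinder {B : Set Space} {b₁ b₂ : Bool} {c : ℝ}
    (h : IsSectorSolid B b₁ b₂ c) {p : Space} (h1 : 0 < sgn b₁ * p 0)
    (h2 : 0 < sgn b₂ * p 1) (hr : rad p = 2) (hz : |p 2 - c| < √3) :
    ∃ n, IsOutwardNormal B p n := by
  have hsq := rad_sq p
  have hq : ∀ y : Space, quad 1 0 0 0 0 (-4) y = rad y ^ 2 - 2 ^ 2 := by
    intro y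
    rw [rad_sq, quad]
    ring
  refine exists_isOutwardNormal_of_quad 1 0 0 0 0 (-4) (Or.inl ?_) (by rw [hq, hr]; norm_num) ?_
  · intro h0
    have : p 0 = 0 := by linarith
    rw [this] at h1
    simp at h1
  · have o1 : IsOpen {y : Space | |y 2 - c| < √3 * (rad y - 1)} :=
      isOpen_lt (by fun_prop) (by fun_prop)
    filter_upwards [h.eventually h1 h2 hz.le,
      o1.mem_nhds (by simp only [mem_ofPred, hr]; linarith)] with y g1 g2
    rw [g1, hq, sub_nonpos, pow_le_pow_iff_left₀ (rad_nonneg y) (by norm_num) two_ne_zero]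
    exact ⟨fun g => g.2, fun g => ⟨le_of_lt g2, g⟩⟩

/-- A patch of a conical or cylindrical surface over a closed quadrant, with the parameters `u 0`
along a generating line and `u 1` the angle. -/
noncomputable def roundPatch (σ₁ σ₂ α β γ δ : ℝ) (u : EuclideanSpace ℝ (Fin 2)) : Space :=
  spin σ₁ σ₂ (α + β * u 0) (u 1) (γ + δ * u 0)

/-- The parameter domain `[m, 1] × [0, π / 2]`. -/
noncomputable def angleRectangle (m : ℝ) : List (ℝ × ℝ × ℝ) :=
  [(1, 0, 1), (-1, 0, -m), (0, 1, Real.pi / 2), (0, -1, 0)]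

lemma mem_angleRectangle {m : ℝ} {u : EuclideanSpace ℝ (Fin 2)} :
    u ∈ polygon (angleRectangle m) ↔
      (u 0 ≤ 1 ∧ m ≤ u 0) ∧ u 1 ≤ Real.pi / 2 ∧ 0 ≤ u 1 := by
  simp [polygon, angleRectangle, and_assoc]

lemma isSmoothFace_roundPatch {B : Set Space} (b₁ b₂ : Bool) {α β γ δ m : ℝ} (hm : m < 1)
    (hδ : δ ≠ 0) (hpos : ∀ s, m ≤ s → s ≤ 1 → 0 < α + β * s)
    (hn : ∀ s θ : ℝ, m < s → s < 1 → 0 < θ → θ < Real.pi / 2 →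
      ∃ n, IsOutwardNormal B (spin (sgn b₁) (sgn b₂) (α + β * s) θ (γ + δ * s)) n) :
    IsSmoothFace B (roundPatch (sgn b₁) (sgn b₂) α β γ δ '' polygon (angleRectangle m)) := by
  have hπ := Real.pi_pos
  have hs1 := sgn_mul_self b₁
  have hs2 := sgn_mul_self b₂
  have hφ : ContDiff ℝ ∞ (roundPatch (sgn b₁) (sgn b₂) α β γ δ) := by
    rw [contDiff_euclidean]
    intro i
    fin_cases i
    · change ContDiff ℝ ∞ (fun u : EuclideanSpace ℝ (Fin 2) =>
        sgn b₁ * ((α + β * u 0) * Real.cos (u 1)))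
      fun_prop
    · change ContDiff ℝ ∞ (fun u : EuclideanSpace ℝ (Fin 2) =>
        sgn b₂ * ((α + β * u 0) * Real.sin (u 1)))
      fun_prop
    · change ContDiff ℝ ∞ (fun u : EuclideanSpace ℝ (Fin 2) => γ + δ * u 0)
      fun_prop
  refine isSmoothFace_of_polygon _ _ ?_ (|m| + 1 + Real.pi) ?_ !₂[(m + 1) / 2, Real.pi / 4] ?_ hφ
    ?_ ?_ ?_
  · simp [angleRectangle]
  · intro u hu
    obtain ⟨⟨h1, h2⟩, h3, h4⟩ := mem_angleRectangle.1 hu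
    constructor
    · rw [abs_le]
      constructor <;> linarith [neg_abs_le m, abs_nonneg m]
    · rw [abs_le]
      constructor <;> linarith [abs_nonneg m]
  · simp only [angleRectangle, List.forall_mem_cons, List.not_mem_nil, IsEmpty.forall_iff,
      implies_true, and_true, Matrix.cons_val_zero, Matrix.cons_val_one, one_mul, zero_mul,
      add_zero, zero_add, neg_mul]
    refine ⟨?_, ?_, ?_, ?_⟩ <;> linarith
  · intro u hu w hw h
    obtain ⟨⟨h1, h2⟩, h3, h4⟩ := mem_angleRectangle.1 hu
    obtain ⟨⟨k1, k2⟩, k3, k4⟩ := mem_angleRectangle.1 hw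
    have e2 : γ + δ * u 0 = γ + δ * w 0 := congrArg (fun p : Space => p 2) h
    have e0 : sgn b₁ * ((α + β * u 0) * Real.cos (u 1)) =
      sgn b₁ * ((α + β * w 0) * Real.cos (w 1)) := congrArg (fun p : Space => p 0) h
    have e : u 0 = w 0 := mul_left_cancel₀ hδ (add_left_cancel e2)
    have hp := hpos _ k2 k1
    have hs0 : sgn b₁ ≠ 0 := left_ne_zero_of_mul_eq_one hs1
    rw [e] at e0
    have e' : u 1 = w 1 := Real.injOn_cos ⟨h4, by linarith⟩ ⟨k4, by linarith⟩
      (mul_left_cancel₀ hp.ne' (mul_left_cancel₀ hs0 e0))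
    ext i
    fin_cases i
    · exact e
    · exact e'
  · intro u hu
    obtain ⟨⟨h1, h2⟩, h3, h4⟩ := mem_angleRectangle.1 hu
    refine (injective_iff_map_eq_zero _).2 fun v hv => ?_
    -- differentiate the components along the line in the direction `v`
    have hline : HasDerivAt (fun t : ℝ => u + t • v) v 0 := by
      simpa using ((hasDerivAt_id (0 : ℝ)).smul_const v).const_add u
    have hd : HasDerivAt (fun t : ℝ => roundPatch (sgn b₁) (sgn b₂) α β γ δ (u + t • v)) 0 0 := by
      have hF : HasFDerivAt (roundPatch (sgn b₁) (sgn b₂) α β γ δ)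
          (fderiv ℝ (roundPatch (sgn b₁) (sgn b₂) α β γ δ) u) (u + (0 : ℝ) • v) := by
        simpa using ((hφ.differentiable (by simp)) u).hasFDerivAt
      have := hF.comp_hasDerivAt (0 : ℝ) hline
      rwa [hv] at this
    have hd' : ∀ i, HasDerivAt
        (fun t : ℝ => roundPatch (sgn b₁) (sgn b₂) α β γ δ (u + t • v) i) 0 0 := fun i =>
      ((EuclideanSpace.proj i : Space →L[ℝ] ℝ).hasFDerivAt.comp_hasDerivAt (0 : ℝ) hd).congr_deriv
        (map_zero _)
    have c0 : HasDerivAt (fun t : ℝ => u 0 + t * v 0) (v 0) 0 := by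
      simpa using ((hasDerivAt_id (0 : ℝ)).mul_const (v 0)).const_add (u 0)
    have c1 : HasDerivAt (fun t : ℝ => u 1 + t * v 1) (v 1) 0 := by
      simpa using ((hasDerivAt_id (0 : ℝ)).mul_const (v 1)).const_add (u 1)
    have d2 : HasDerivAt (fun t : ℝ => γ + δ * (u 0 + t * v 0)) (δ * v 0) 0 :=
      (c0.const_mul δ).const_add γ
    have e2 : δ * v 0 = 0 := d2.unique (hd' 2)
    have e0 : v 0 = 0 := (mul_eq_zero.1 e2).resolve_left hδ
    have cr : HasDerivAt (fun t : ℝ => α + β * (u 0 + t * v 0)) (β * v 0) 0 :=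
      (c0.const_mul β).const_add α
    have f0 := ((cr.mul c1.cos).const_mul (sgn b₁)).unique (hd' 0)
    have f1 := ((cr.mul c1.sin).const_mul (sgn b₂)).unique (hd' 1)
    simp only [e0, mul_zero, zero_mul, add_zero, zero_add] at f0 f1
    have hp := hpos _ h2 h1
    have e1 : (α + β * u 0) * v 1 = 0 := by
      linear_combination (-sgn b₁ * Real.sin (u 1)) * f0 + (sgn b₂ * Real.cos (u 1)) * f1 -
        (α + β * u 0) * v 1 * (Real.sin (u 1)) ^ 2 * hs1 -
        (α + β * u 0) * v 1 * (Real.cos (u 1)) ^ 2 * hs2 -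
        (α + β * u 0) * v 1 * Real.sin_sq_add_cos_sq (u 1)
    have e1' : v 1 = 0 := (mul_eq_zero.1 e1).resolve_left hp.ne'
    ext i
    fin_cases i
    · exact e0
    · exact e1'
  · intro u hu
    have h1 := hu (1, 0, 1) (by simp [angleRectangle])
    have h2 := hu (-1, 0, -m) (by simp [angleRectangle])
    have h3 := hu (0, 1, Real.pi / 2) (by simp [angleRectangle])
    have h4 := hu (0, -1, 0) (by simp [angleRectangle])
    simp only [one_mul, zero_mul, add_zero, zero_add, neg_mul] at h1 h2 h3 h4
    exact hn _ _ (by linarith) h1 (by linarith) h3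

/-- The curved faces of a rotated triangle over a quadrant: the upper and the lower cone, and the
cylinder. -/
noncomputable def roundFace (b₁ b₂ : Bool) (c : ℝ) : Fin 3 → Set Space :=
  ![roundPatch (sgn b₁) (sgn b₂) 1 1 c √3 '' polygon (angleRectangle 0),
    roundPatch (sgn b₁) (sgn b₂) 1 1 c (-√3) '' polygon (angleRectangle 0),
    roundPatch (sgn b₁) (sgn b₂) 2 0 c √3 '' polygon (angleRectangle (-1))]

lemma IsSectorSolid.isSmoothFace_roundFace {B : Set Space} {b₁ b₂ : Bool} {c : ℝ}
    (h : IsSectorSolid B b₁ b₂ c) (i : Fin 3) : IsSmoothFace B (roundFace b₁ b₂ c i) := by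
  have h3 := sqrt_three_pos
  fin_cases i
  · refine isSmoothFace_roundPatch b₁ b₂ one_pos h3.ne' (fun s h _ => by linarith) ?_
    intro s θ hs hs' h0 h1
    obtain ⟨g1, g2⟩ := spin_sgn_pos (b₁ := b₁) (b₂ := b₂) (z := c + √3 * s)
      (by linarith : 0 < 1 + 1 * s) h0 h1
    have hr := rad_spin b₁ b₂ (θ := θ) (z := c + √3 * s) (by linarith : 0 ≤ 1 + 1 * s)
    refine ⟨_, h.isOutwardNormal_cone true g1 g2 (by rw [hr]; linarith) (by rw [hr]; linarith) ?_⟩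
    rw [hr]
    simp [spin, sgn]
  · refine isSmoothFace_roundPatch b₁ b₂ one_pos (neg_ne_zero.2 h3.ne') (fun s h _ => by linarith) ?_
    intro s θ hs hs' h0 h1
    obtain ⟨g1, g2⟩ := spin_sgn_pos (b₁ := b₁) (b₂ := b₂) (z := c + -√3 * s)
      (by linarith : 0 < 1 + 1 * s) h0 h1
    have hr := rad_spin b₁ b₂ (θ := θ) (z := c + -√3 * s) (by linarith : 0 ≤ 1 + 1 * s)
    refine ⟨_, h.isOutwardNormal_cone false g1 g2 (by rw [hr]; linarith) (by rw [hr]; linarith) ?_⟩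
    rw [hr]
    simp [spin, sgn]
  · refine isSmoothFace_roundPatch b₁ b₂ (by norm_num) h3.ne' (fun s h _ => by linarith) ?_
    intro s θ hs hs' h0 h1
    obtain ⟨g1, g2⟩ := spin_sgn_pos (b₁ := b₁) (b₂ := b₂) (z := c + √3 * s)
      (by linarith : 0 < 2 + 0 * s) h0 h1
    have hr := rad_spin b₁ b₂ (θ := θ) (z := c + √3 * s) (by linarith : 0 ≤ 2 + 0 * s)
    refine h.exists_isOutwardNormal_cylinder g1 g2 (by rw [hr]; ring) ?_
    have : |s| < 1 := abs_lt.2 ⟨hs, hs'⟩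
    have e : spin (sgn b₁) (sgn b₂) (2 + 0 * s) θ (c + √3 * s) 2 - c = √3 * s := by simp [spin]
    rw [e, abs_mul, abs_of_pos h3]
    nlinarith

/-- The curved faces cover the boundary of the rotated triangle. -/
lemma exists_mem_roundFace {b₁ b₂ : Bool} {c : ℝ} {p : Space} (h1 : 0 ≤ sgn b₁ * p 0)
    (h2 : 0 ≤ sgn b₂ * p 1) (hp : (rad p, p 2 - c) ∈ triangle)
    (hp' : (rad p, p 2 - c) ∉ openTriangle) : ∃ i, p ∈ roundFace b₁ b₂ c i := by
  have h3 := sqrt_three_pos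
  obtain ⟨θ, hθ, hθ', e⟩ := exists_spin_eq h1 h2
  have hr1 : 1 ≤ rad p := triangle_one_le hp
  have hz := triangle_abs_le hp
  obtain ⟨t1, t2⟩ := hp
  simp only at t1 t2 hr1 hz
  rw [abs_le] at hz
  by_cases hr : rad p < 2
  · have hcone : |p 2 - c| = √3 * (rad p - 1) := by
      by_contra hne
      exact hp' ⟨lt_of_le_of_ne t1 hne, hr⟩
    rcases abs_choice (p 2 - c) with ha | ha
    · refine ⟨0, !₂[rad p - 1, θ], mem_angleRectangle.2 ?_, ?_⟩
      · simp only [Matrix.cons_val_zero, Matrix.cons_val_one]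
        exact ⟨⟨by linarith, by linarith⟩, hθ', hθ⟩
      · conv_rhs => rw [e]
        rw [ha] at hcone
        simp only [roundPatch, Matrix.cons_val_zero, Matrix.cons_val_one]
        congr 1
        · ring
        · linarith
    · refine ⟨1, !₂[rad p - 1, θ], mem_angleRectangle.2 ?_, ?_⟩
      · simp only [Matrix.cons_val_zero, Matrix.cons_val_one]
        exact ⟨⟨by linarith, by linarith⟩, hθ', hθ⟩
      · conv_rhs => rw [e]
        rw [ha] at hcone
        simp only [roundPatch, Matrix.cons_val_zero, Matrix.cons_val_one]
        congr 1
        · ring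
        · linarith
  · have hr2 : rad p = 2 := le_antisymm t2 (not_lt.1 hr)
    refine ⟨2, !₂[(p 2 - c) / √3, θ], mem_angleRectangle.2 ?_, ?_⟩
    · simp only [Matrix.cons_val_zero, Matrix.cons_val_one]
      refine ⟨⟨?_, ?_⟩, hθ', hθ⟩
      · rw [div_le_one h3]; exact hz.2
      · rw [le_div_iff₀ h3]; linarith
    · conv_rhs => rw [e]
      simp only [roundPatch, Matrix.cons_val_zero, Matrix.cons_val_one]
      congr 1
      · rw [hr2]; ring
      · field_simp; ring

/-! ### Trajectories near a rotated triangle -/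

lemma rad_axial {a b c : ℝ} (hab : a ^ 2 + b ^ 2 = 1) (s z : ℝ) :
    rad (axial !₂[0, 0, c] a b s z) = |s| := by
  rw [rad, ← Real.sqrt_sq_eq_abs]
  congr 1
  simp [axial]
  linear_combination s ^ 2 * hab

lemma IsSectorSolid.isOutwardNormal_axial {B : Set Space} {a b c : ℝ} (hab : a ^ 2 + b ^ 2 = 1)
    (hab0 : a * b ≠ 0)
    (hS : ∀ b₁ b₂, 0 < sgn b₁ * sgn b₂ * (a * b) → IsSectorSolid B b₁ b₂ c) (b₃ : Bool) {s z : ℝ}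
    (h1 : 1 < |s|) (h2 : |s| < 2) (hz : sgn b₃ * z = √3 * (|s| - 1)) :
    IsOutwardNormal B (axial !₂[0, 0, c] a b s z)
      !₂[-(√3 / 2) * (s / |s| * a), -(√3 / 2) * (s / |s| * b), sgn b₃ / 2] := by
  have hs : s ≠ 0 := by rintro rfl; norm_num at h1
  have ha : a ≠ 0 := left_ne_zero_of_mul hab0
  have hb : b ≠ 0 := right_ne_zero_of_mul hab0
  obtain ⟨b₁, hb₁⟩ := exists_sgn_mul_pos (mul_ne_zero hs ha)
  obtain ⟨b₂, hb₂⟩ := exists_sgn_mul_pos (mul_ne_zero hs hb)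
  have hpos : 0 < sgn b₁ * sgn b₂ * (a * b) := by
    have h := mul_pos hb₁ hb₂
    have e : sgn b₁ * (s * a) * (sgn b₂ * (s * b)) = s ^ 2 * (sgn b₁ * sgn b₂ * (a * b)) := by ring
    rw [e] at h
    exact pos_of_mul_pos_right h (sq_nonneg s)
  have hr := rad_axial (c := c) hab s z
  have h := (hS b₁ b₂ hpos).isOutwardNormal_cone b₃ (p := axial !₂[0, 0, c] a b s z)
    (by simpa [axial] using hb₁) (by simpa [axial] using hb₂) (by rwa [hr]) (by rwa [hr])
    (by rw [hr, ← hz]; simp [axial])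
  rw [hr] at h
  convert h using 5
  · simp [axial]; ring
  · simp [axial]; ring

/-- A rotated triangle centred at the height `c`, as seen from a particle moving in the vertical
plane through the direction `(a, b)`. -/
structure CrossSection (B : Set Space) (a b c : ℝ) : Prop where
  norm : a ^ 2 + b ^ 2 = 1
  ne_zero : a * b ≠ 0
  solid : ∀ b₁ b₂, 0 < sgn b₁ * sgn b₂ * (a * b) → IsSectorSolid B b₁ b₂ c
  mem_iff : ∀ s z, |z| ≤ √3 → (axial !₂[0, 0, c] a b s z ∈ B ↔ (|s|, z) ∈ triangle)

lemma CrossSection.arrives {B : Set Space} {a b c r : ℝ} (h : CrossSection B a b c) (hr : 1 < r)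
    (hr' : r < 2) {x v : Space} (hx : Arrives B x v (axial !₂[0, 0, c] a b r (√3 * (r - 1))) down) :
    Arrives B x v (axial !₂[0, 0, c] a b (r - 3) (√3 * (r - 2)))
      !₂[-(√3 / 2) * a, -(√3 / 2) * b, -(1 / 2)] ∧
    IsOutwardNormal B (axial !₂[0, 0, c] a b (r - 3) (√3 * (r - 2)))
      !₂[√3 / 2 * a, √3 / 2 * b, -(1 / 2)] := by
  have h3 := sqrt_three_pos
  have a1 : |r| = r := abs_of_pos (by linarith)
  have a2 : |r - 3| = 3 - r := by rw [abs_of_neg (by linarith)]; ring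
  constructor
  · refine Arrives.cross hx ?_ ?_
    · have := IsSectorSolid.isOutwardNormal_axial h.norm h.ne_zero h.solid true (s := r)
        (z := √3 * (r - 1)) (by rwa [a1]) (by rwa [a1]) (by simp [sgn, a1])
      rw [a1, div_self (by linarith), one_mul, one_mul] at this
      simpa [sgn] using this
    · intro s hs hs'
      rw [h.mem_iff]
      · exact crossing_notMem_triangle hs hs'
      · rw [abs_le]
        constructor <;> nlinarith
  · have := IsSectorSolid.isOutwardNormal_axial h.norm h.ne_zero h.solid false (s := r - 3)
      (z := √3 * (r - 2)) (by rw [a2]; linarith) (by rw [a2]; linarith) (by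
        simp only [sgn, a2, Bool.false_eq_true, if_false]; ring)
    have e : (r - 3) / |r - 3| = -1 := by
      rw [a2, div_eq_iff (by linarith)]; ring
    rw [e] at this
    have hv : (!₂[√3 / 2 * a, √3 / 2 * b, -(1 / 2)] : Space) =
        !₂[-(√3 / 2) * (-1 * a), -(√3 / 2) * (-1 * b), sgn false / 2] := by
      ext i
      fin_cases i <;> simp [sgn]
      norm_num
    rwa [hv]

lemma CrossSection.arrives_below {B : Set Space} {a b c r : ℝ} (h : CrossSection B a b c)
    (hr : 1 < r) (hr' : r < 2) {x v : Space}
    (hx : Arrives B x v (axial !₂[0, 0, c] a b r (√3 * (r - 1))) down) {z : ℝ}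
    (hz : z < √3 * (r - 2)) (hfree : ∀ y, z < y → y < √3 * (r - 2) →
      axial !₂[0, 0, c] a b (r - 3) y ∉ B) :
    Arrives B x v (axial !₂[0, 0, c] a b (r - 3) z) down := by
  obtain ⟨h1, h2⟩ := h.arrives hr hr' hx
  obtain ⟨e1, e2⟩ := reflect_velocity h.norm
  have := h1.reflect h2 (by rw [e1]; norm_num) e2 (a := √3 * (r - 2) - z) (by linarith) ?_
  · rw [axial_add_smul_down] at this
    convert this using 2
    ring
  · intro t ht ht'
    rw [axial_add_smul_down]
    exact hfree _ (by linarith) (by linarith)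

lemma CrossSection.scatters {B : Set Space} {a b c r : ℝ} (h : CrossSection B a b c)
    (hr : 1 < r) (hr' : r < 2) {x v : Space}
    (hx : Arrives B x v (axial !₂[0, 0, c] a b r (√3 * (r - 1))) down)
    (hfree : ∀ y < √3 * (r - 2), axial !₂[0, 0, c] a b (r - 3) y ∉ B) :
    ∃ z, Scatters B x v (axial !₂[0, 0, c] a b (r - 3) z) down := by
  obtain ⟨h1, h2⟩ := h.arrives hr hr' hx
  obtain ⟨e1, e2⟩ := reflect_velocity h.norm
  obtain ⟨s, hs⟩ := h1.scatters h2 (by rw [e1]; norm_num) e2 (fun t ht => by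
    rw [axial_add_smul_down]
    exact hfree _ (by linarith))
  rw [axial_add_smul_down] at hs
  exact ⟨_, hs⟩

/-- A point of the horizontal plane in polar form. -/
lemma exists_eq_axial {x : Space} (hx : x 2 = 0) (hr : rad x ≠ 0) :
    ∃ a b : ℝ, a ^ 2 + b ^ 2 = 1 ∧ x 0 = rad x * a ∧ x 1 = rad x * b ∧
      x = axial !₂[0, 0, 0] a b (rad x) 0 := by
  have hsq := rad_sq x
  refine ⟨x 0 / rad x, x 1 / rad x, ?_, by field_simp, by field_simp, ?_⟩
  · field_simp
    linarith
  · ext i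
    fin_cases i
    · simp [axial]; field_simp
    · simp [axial]; field_simp
    · simpa [axial] using hx

lemma mem_perp_down {x : Space} : x ∈ perp down ↔ x 2 = 0 := by
  rw [Submodule.mem_orthogonal_singleton_iff_inner_right]
  simp [down, PiLp.inner_apply, Fin.sum_univ_three]

lemma norm_down : ‖down‖ = 1 := by
  rw [EuclideanSpace.norm_eq, Real.sqrt_eq_one]
  simp [down, Fin.sum_univ_three]

lemma sub_inner_smul_down (x : Space) : x - ⟪x, down⟫ • down = !₂[x 0, x 1, 0] := by
  ext i
  fin_cases i <;> simp [down, PiLp.inner_apply, Fin.sum_univ_three]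

lemma norm_eq_rad {x : Space} (hx : x 2 = 0) : ‖x‖ = rad x := by
  rw [EuclideanSpace.norm_eq, rad]
  congr 1
  simp [Fin.sum_univ_three, hx]

lemma ae_perp_down_coord_ne (i : Fin 3) (hi : i ≠ 2) (c : ℝ) :
    ∀ᵐ x : perp down ∂(planeMeasure down), (x : Space) i ≠ c := by
  refine ae_linearMap_ne (planeMeasure down)
    (l := ((EuclideanSpace.proj i : Space →L[ℝ] ℝ) : Space →ₗ[ℝ] ℝ) ∘ₗ (perp down).subtype) ?_ c
  intro h
  have h1 := LinearMap.congr_fun h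
    ⟨EuclideanSpace.single i (1 : ℝ), mem_perp_down.2 (by simp [hi.symm])⟩
  simp at h1

lemma ae_perp_down_rad_ne (c : ℝ) :
    ∀ᵐ x : perp down ∂(planeMeasure down), rad (x : Space) ≠ c := by
  have : Nontrivial (perp down) := Module.nontrivial_of_finrank_pos (R := ℝ) (by
    rw [finrank_perp (norm_ne_zero_iff.1 (by rw [norm_down]; norm_num))]; norm_num)
  have h := Measure.addHaar_sphere (planeMeasure down) (0 : perp down) c
  rw [ae_iff]
  convert h using 2
  ext x
  simp [← norm_eq_rad (mem_perp_down.1 x.2)]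

lemma notMem_triangle_of_lt {s z : ℝ} (h : √3 * (s - 1) < |z|) : (s, z) ∉ triangle :=
  fun hs => absurd hs.1 (not_le.2 h)

/-! ### The solid of revolution -/

lemma mem_rotatedTriangle {p : Space} : p ∈ rotatedTriangle ↔ (rad p, p 2) ∈ triangle := Iff.rfl

lemma isSectorSolid_rotatedTriangle (b₁ b₂ : Bool) : IsSectorSolid rotatedTriangle b₁ b₂ 0 :=
  ⟨1, one_pos, fun p _ _ _ => by rw [sub_zero, mem_rotatedTriangle]⟩

lemma isBounded_of_rad_le {B : Set Space} {R : ℝ} (h : ∀ p ∈ B, rad p ≤ R ∧ |p 2| ≤ R) :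
    Bornology.IsBounded B := by
  rw [isBounded_iff_forall_norm_le]
  refine ⟨√(R ^ 2 + R ^ 2), fun p hp => ?_⟩
  obtain ⟨h1, h2⟩ := h p hp
  rw [EuclideanSpace.norm_eq]
  refine Real.sqrt_le_sqrt ?_
  simp only [Fin.sum_univ_three, Real.norm_eq_abs, sq_abs]
  rw [← rad_sq, ← sq_abs (p 2)]
  have := rad_nonneg p
  gcongr

lemma isBody_rotatedTriangle : IsBody rotatedTriangle := by
  have hc : Continuous (fun p : Space => (rad p, p 2)) := by fun_prop
  refine isBody_of_faces (C := {p : Space | (rad p, p 2) ∈ openTriangle})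
    (fun i : (Bool × Bool) × Fin 3 => roundFace i.1.1 i.1.2 0 i.2) (isClosed_triangle.preimage hc)
    (isBounded_of_rad_le (R := 2) fun p hp => ⟨hp.2, ?_⟩) (isOpen_openTriangle.preimage hc)
    (isConnected_revolution convex_openTriangle ⟨(3 / 2, 0), ?_⟩
      fun q hq => one_pos.trans (openTriangle_one_lt hq))
    (fun p hp => openTriangle_subset_triangle hp) ?_
    (fun i => (isSectorSolid_rotatedTriangle _ _).isSmoothFace_roundFace _) ?_
  · refine (triangle_abs_le hp).trans ?_
    rw [Real.sqrt_le_left (by norm_num)]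
    norm_num
  · constructor <;> norm_num
  · intro p hp
    obtain ⟨b₁, h1⟩ := exists_sgn_mul_nonneg (p 0)
    obtain ⟨b₂, h2⟩ := exists_sgn_mul_nonneg (p 1)
    refine closure_mono ?_ (mem_closure_sector (c := 0) h1 h2 (by simpa using mem_rotatedTriangle.1 hp))
    rintro q ⟨-, -, hq⟩
    simpa using hq
  · intro p hp
    by_cases hp' : (rad p, p 2) ∈ openTriangle
    · right
      exact mem_of_superset ((isOpen_openTriangle.preimage hc).mem_nhds hp')
        fun q hq => openTriangle_subset_triangle hq
    · left
      obtain ⟨b₁, h1⟩ := exists_sgn_mul_nonneg (p 0)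
      obtain ⟨b₂, h2⟩ := exists_sgn_mul_nonneg (p 1)
      obtain ⟨i, hi⟩ := exists_mem_roundFace (c := 0) h1 h2
        (by simpa using mem_rotatedTriangle.1 hp) (by simpa using hp')
      exact ⟨((b₁, b₂), i), hi⟩

/-- Particles falling through the hole or passing outside are not affected. -/
lemma scatters_rotatedTriangle_of_missing {x : Space} (h : rad x < 1 ∨ 2 < rad x) :
    Scatters rotatedTriangle x down x down := by
  refine scatters_of_line _ _ fun t ht => ?_
  have e : rad (x + t • down) = rad x := by simp [rad, down]
  rw [mem_rotatedTriangle, e] at ht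
  have h1 : 1 ≤ rad x := triangle_one_le ht
  have h2 : rad x ≤ 2 := ht.2
  rcases h with h | h <;> linarith

/-- All other particles are transferred from the distance `r` to the distance `3 - r` from the
axis. -/
lemma scatters_rotatedTriangle {x : Space} (hx : x 2 = 0) (h0 : x 0 ≠ 0) (h1 : x 1 ≠ 0)
    (hr : 1 < rad x) (hr' : rad x < 2) :
    ∃ x', Scatters rotatedTriangle x down x' down ∧ ‖x' - ⟪x', down⟫ • down‖ = 3 - rad x := by
  obtain ⟨a, b, hab, ha, hb, e⟩ := exists_eq_axial hx (by linarith)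
  set r := rad x
  have h3 := sqrt_three_pos
  have hcs : CrossSection rotatedTriangle a b 0 := by
    refine ⟨hab, ?_, fun _ _ _ => isSectorSolid_rotatedTriangle _ _, fun s z _ => ?_⟩
    · refine mul_ne_zero ?_ ?_
      · rintro rfl; simp at ha; exact h0 ha
      · rintro rfl; simp at hb; exact h1 hb
    · rw [mem_rotatedTriangle, rad_axial hab]
      simp [axial]
  have hmem : ∀ s z, axial !₂[0, 0, 0] a b s z ∈ rotatedTriangle ↔ (|s|, z) ∈ triangle := by
    intro s z
    rw [mem_rotatedTriangle, rad_axial hab]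
    simp [axial]
  have harr : Arrives rotatedTriangle x down (axial !₂[0, 0, 0] a b r (√3 * (r - 1))) down := by
    have := arrives_of_line (B := rotatedTriangle) x down (-(√3 * (r - 1))) (fun t ht => by
      rw [e, axial_add_smul_down, hmem]
      apply notMem_triangle_of_lt
      rw [abs_of_pos (by linarith : 0 < r)]
      exact lt_of_lt_of_le (by linarith) (le_abs_self _))
    nth_rewrite 2 [e] at this
    rw [axial_add_smul_down] at this
    simpa using this
  obtain ⟨z, hz⟩ := hcs.scatters hr hr' harr (fun y hy => by
    rw [hmem]
    apply notMem_triangle_of_lt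
    rw [abs_of_neg (by linarith : r - 3 < 0)]
    exact lt_of_lt_of_le (by nlinarith) (neg_le_abs _))
  refine ⟨_, hz, ?_⟩
  rw [sub_inner_smul_down, norm_eq_rad (by simp), rad]
  have e' : (3 - r) = √((3 - r) ^ 2) := (Real.sqrt_sq (by linarith)).symm
  rw [e']
  congr 1
  simp [axial]
  linear_combination (r - 3) ^ 2 * hab

lemma zeroResistance_rotatedTriangle : ZeroResistance rotatedTriangle down := by
  refine zeroResistance_of_ae_perp norm_down ?_
  filter_upwards [ae_perp_down_coord_ne 0 (by decide) 0, ae_perp_down_coord_ne 1 (by decide) 0,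
    ae_perp_down_rad_ne 1, ae_perp_down_rad_ne 2] with x h0 h1 hr1 hr2
  rcases lt_or_gt_of_ne hr1 with g1 | g1
  · exact ⟨_, scatters_rotatedTriangle_of_missing (Or.inl g1)⟩
  rcases lt_or_gt_of_ne hr2 with g2 | g2
  · obtain ⟨x', hx', -⟩ := scatters_rotatedTriangle (mem_perp_down.1 x.2) h0 h1 g1 g2
    exact ⟨x', hx'⟩
  · exact ⟨_, scatters_rotatedTriangle_of_missing (Or.inr g2)⟩

lemma not_leavesNoTrace_rotatedTriangle : ¬ LeavesNoTrace rotatedTriangle down := by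
  rintro ⟨-, τ, hτ, h⟩
  refine not_measurePreserving_of_annulus
    (finrank_perp (norm_ne_zero_iff.1 (by rw [norm_down]; norm_num))) (planeMeasure down) ?_ hτ
  filter_upwards [h, ae_perp_down_coord_ne 0 (by decide) 0, ae_perp_down_coord_ne 1 (by decide) 0]
    with x ⟨y, hy, hyτ⟩ h0 h1
  have hx := mem_perp_down.1 x.2
  have e : ‖x‖ = rad (x : Space) := norm_eq_rad hx
  have e' : ‖τ x‖ = ‖y - ⟪y, down⟫ • down‖ := by rw [hyτ]; rfl
  rw [e, e']
  constructor
  · intro g1 g2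
    obtain ⟨x', hx', hn⟩ := scatters_rotatedTriangle hx h0 h1 g1 g2
    rw [(hy.unique hx').1, hn]
  · intro g
    rw [(hy.unique (scatters_rotatedTriangle_of_missing g)).1, sub_inner_smul_down,
      norm_eq_rad (by simp)]
    simp [rad]

/-! ### The stack of rotated triangles: its shape -/

/-- The heights of the centres of the four rotated triangles, for `ε = 2 / √3`. With this choice
they are equally spaced. -/
noncomputable def height (j : Fin 4) : ℝ := √3 * (4 / 3 * ((j : ℕ) - 1))

/-- The quadrants occupied by the `j`-th rotated triangle: those where `p 0 * p 1` has this sign. -/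
def parity : Fin 4 → Bool := ![false, true, false, true]

/-- The solid `shiftedDoubled ε` for `ε = 2 / √3`: four half tori at equally spaced heights,
alternately over the quadrants `p 0 * p 1 ≤ 0` and `p 0 * p 1 ≥ 0`. -/
def stack : Set Space :=
  {p | ∃ j, 0 ≤ sgn (parity j) * (p 0 * p 1) ∧ (rad p, p 2 - height j) ∈ triangle}

lemma mem_stack {p : Space} : p ∈ stack ↔
    ∃ j, 0 ≤ sgn (parity j) * (p 0 * p 1) ∧ (rad p, p 2 - height j) ∈ triangle := Iff.rfl

lemma triangle_neg {r z : ℝ} : (r, -z) ∈ triangle ↔ (r, z) ∈ triangle := by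
  simp [triangle]

lemma mem_triangle_scaled {r w : ℝ} : (r, √3 * w) ∈ triangle ↔ |w| ≤ r - 1 ∧ r ≤ 2 := by
  have h3 := sqrt_three_pos
  change |√3 * w| ≤ √3 * (r - 1) ∧ r ≤ 2 ↔ _
  rw [abs_mul, abs_of_pos h3, mul_le_mul_iff_right₀ h3]

lemma mem_openTriangle_scaled {r w : ℝ} : (r, √3 * w) ∈ openTriangle ↔ |w| < r - 1 ∧ r < 2 := by
  have h3 := sqrt_three_pos
  change |√3 * w| < √3 * (r - 1) ∧ r < 2 ↔ _
  rw [abs_mul, abs_of_pos h3, mul_lt_mul_iff_right₀ h3]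

lemma mem_doubled {p : Space} : p ∈ doubled (2 / √3) ↔
    (rad p, p 2 - √3 * (4 / 3)) ∈ triangle ∨ (rad p, p 2 + √3 * (4 / 3)) ∈ triangle := by
  have h3 := sqrt_three_pos
  have e : √3 + 2 / √3 / 2 = √3 * (4 / 3) := by
    field_simp
    linear_combination -sqrt_three_mul_self
  change (rad p, |p 2| - (√3 + 2 / √3 / 2)) ∈ triangle ↔ _
  rw [e]
  have hp : ∀ q : ℝ, (rad p, q) ∈ triangle → -√3 ≤ q ∧ q ≤ √3 := fun q h =>
    abs_le.1 (triangle_abs_le h)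
  rcases le_total 0 (p 2) with h | h
  · rw [abs_of_nonneg h]
    refine ⟨Or.inl, fun h' => h'.resolve_right fun h'' => ?_⟩
    have := hp _ h''
    linarith
  · rw [abs_of_nonpos h, ← triangle_neg, neg_sub, sub_neg_eq_add, add_comm]
    refine ⟨Or.inr, fun h' => h'.resolve_left fun h'' => ?_⟩
    have := hp _ h''
    linarith

lemma shiftedDoubled_eq_stack : shiftedDoubled (2 / √3) = stack := by
  have h3 := sqrt_three_pos
  have e : 2 * (2 / √3) = √3 * (4 / 3) := by
    field_simp
    linear_combination (-4) * sqrt_three_mul_self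
  ext p
  have himg : p ∈ (fun p : Space => p + !₂[0, 0, 2 * (2 / √3)]) ''
      {p | p ∈ doubled (2 / √3) ∧ 0 ≤ p 0 * p 1} ↔
      ((rad p, p 2 - √3 * (8 / 3)) ∈ triangle ∨ (rad p, p 2) ∈ triangle) ∧ 0 ≤ p 0 * p 1 := by
    rw [e]
    constructor
    · rintro ⟨q, ⟨hq, hq'⟩, rfl⟩
      have er : rad (q + !₂[0, 0, √3 * (4 / 3)]) = rad q := by simp [rad]
      have e1 : q 2 + √3 * (4 / 3) - √3 * (8 / 3) = q 2 - √3 * (4 / 3) := by ring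
      have e2 : (q + !₂[0, 0, √3 * (4 / 3)]) 2 = q 2 + √3 * (4 / 3) := by simp
      refine ⟨?_, by simpa using hq'⟩
      simp only [er, e2, e1]
      exact mem_doubled.1 hq
    · rintro ⟨h, h'⟩
      refine ⟨p - !₂[0, 0, √3 * (4 / 3)], ⟨?_, by simpa using h'⟩, by simp⟩
      have er : rad (p - !₂[0, 0, √3 * (4 / 3)]) = rad p := by simp [rad]
      rw [mem_doubled, er]
      convert h using 3
      · simp; ring
      · simp
  have h0 : height 0 = -(√3 * (4 / 3)) := by simp [height]
  have h1 : height 1 = 0 := by simp [height]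
  have h2 : height 2 = √3 * (4 / 3) := by simp [height]; norm_num
  have h3' : height 3 = √3 * (8 / 3) := by simp [height]; norm_num
  rw [shiftedDoubled, mem_union, himg, mem_ofPred, mem_doubled, mem_stack]
  simp only [Fin.exists_fin_succ, IsEmpty.exists_iff]
  change _ ↔ (0 ≤ sgn false * _ ∧ (_, _ - height 0) ∈ _) ∨ (0 ≤ sgn true * _ ∧ (_, _ - height 1) ∈ _) ∨
    (0 ≤ sgn false * _ ∧ (_, _ - height 2) ∈ _) ∨ (0 ≤ sgn true * _ ∧ (_, _ - height 3) ∈ _) ∨ False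
  rw [h0, h1, h2, h3', sub_neg_eq_add, sub_zero]
  simp only [sgn, if_true, Bool.false_eq_true, if_false, one_mul, neg_mul, Left.nonneg_neg_iff]
  tauto

lemma sgn_injective : Function.Injective sgn := by
  intro a b h
  cases a <;> cases b <;> simp [sgn] at h ⊢ <;> norm_num at h

/-- Rotated triangles over the same quadrants are far from each other. -/
lemma height_sub_of_parity_eq {i j : Fin 4} (h : parity i = parity j) (hij : i ≠ j) :
    height i - height j = √3 * (8 / 3) ∨ height i - height j = -(√3 * (8 / 3)) := by
  fin_cases i <;> fin_cases j <;> simp [parity] at h hij <;> simp [height] <;>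
    first | (left; ring1) | (right; ring1)

lemma eq_of_parity_eq {i j : Fin 4} (h : parity i = parity j) {z : ℝ}
    (hi : |z - height i| ≤ √3) (hj : |z - height j| < √3 + √3 / 3) : i = j := by
  have h3 := sqrt_three_pos
  by_contra hij
  rw [abs_le] at hi
  rw [abs_lt] at hj
  rcases height_sub_of_parity_eq h hij with h | h <;> linarith

lemma sgn_parity_eq {b₁ b₂ : Bool} {x y : ℝ} (hx : 0 < sgn b₁ * x) (hy : 0 < sgn b₂ * y) {b : Bool}
    (h : 0 ≤ sgn b * (x * y)) : sgn b = sgn b₁ * sgn b₂ := by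
  have hxy := mul_pos hx hy
  rcases sgn_cases b with e | e <;> rcases sgn_cases b₁ with e1 | e1 <;>
    rcases sgn_cases b₂ with e2 | e2 <;> rw [e, e1, e2] <;> rw [e] at h <;> rw [e1, e2] at hxy <;>
    norm_num <;> nlinarith

lemma isSectorSolid_stack {b₁ b₂ : Bool} {j : Fin 4}
    (hj : sgn b₁ * sgn b₂ = sgn (parity j)) : IsSectorSolid stack b₁ b₂ (height j) := by
  refine ⟨√3 / 3, by positivity, fun p h1 h2 hp => ⟨?_, fun h => ⟨j, ?_, h⟩⟩⟩
  · rintro ⟨i, hi, hiT⟩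
    have hij : parity i = parity j := sgn_injective ((sgn_parity_eq h1 h2 hi).trans hj)
    rwa [eq_of_parity_eq hij (triangle_abs_le hiT) hp] at hiT
  · rw [← hj]
    have := mul_pos h1 h2
    nlinarith

lemma exists_sgn_eq_mul (b c : Bool) : ∃ d, sgn d = sgn b * sgn c := by
  cases b <;> cases c <;> simp [sgn]

/-- Signs of the coordinates, compatible with a given sign of their product. -/
lemma exists_sgn_pair {b : Bool} {x y : ℝ} (h : 0 ≤ sgn b * (x * y)) :
    ∃ b₁ b₂, sgn b₁ * sgn b₂ = sgn b ∧ 0 ≤ sgn b₁ * x ∧ 0 ≤ sgn b₂ * y := by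
  by_cases hx : x = 0
  · obtain ⟨b₂, h2⟩ := exists_sgn_mul_nonneg y
    obtain ⟨b₁, h1⟩ := exists_sgn_eq_mul b b₂
    exact ⟨b₁, b₂, by rw [h1, mul_assoc, sgn_mul_self, mul_one], by simp [hx], h2⟩
  · obtain ⟨b₁, h1⟩ := exists_sgn_mul_pos hx
    obtain ⟨b₂, h2⟩ := exists_sgn_eq_mul b b₁
    refine ⟨b₁, b₂, by rw [h2, mul_left_comm, sgn_mul_self, mul_one], h1.le, ?_⟩
    have e : sgn b * (x * y) = (sgn b₁ * x) * (sgn b₂ * y) := by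
      rw [h2]
      linear_combination (-sgn b * x * y) * sgn_mul_self b₁
    rw [e] at h
    exact nonneg_of_mul_nonneg_right h h1

lemma isClosed_stack : IsClosed stack := by
  have : stack = ⋃ j, {p : Space | 0 ≤ sgn (parity j) * (p 0 * p 1)} ∩
      {p : Space | (rad p, p 2 - height j) ∈ triangle} := by
    ext p
    simp [mem_stack]
  rw [this]
  refine isClosed_iUnion_of_finite fun j => (isClosed_le (by fun_prop) (by fun_prop)).inter ?_
  exact isClosed_triangle.preimage (f := fun p : Space => (rad p, p 2 - height j)) (by fun_prop)

lemma isBounded_stack : Bornology.IsBounded stack := by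
  have h3 := sqrt_three_pos
  have h3' : √3 ≤ 2 := by rw [Real.sqrt_le_left (by norm_num)]; norm_num
  refine isBounded_of_rad_le (R := 8) ?_
  rintro p ⟨j, -, hj⟩
  have h1 := hj.2
  have h2 := abs_le.1 (triangle_abs_le hj)
  simp only at h1 h2
  have h4 : |height j| ≤ √3 * (8 / 3) := by
    rw [height, abs_mul, abs_of_pos h3]
    refine mul_le_mul_of_nonneg_left ?_ h3.le
    rw [abs_le]
    fin_cases j <;> constructor <;> norm_num
  have h5 := abs_le.1 h4
  refine ⟨by linarith, abs_le.2 ⟨by linarith, by linarith⟩⟩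

/-- The part of the interior over an open quadrant. -/
def sector (b₁ b₂ : Bool) (j : Fin 4) : Set Space :=
  {p | 0 < sgn b₁ * p 0 ∧ 0 < sgn b₂ * p 1 ∧ (rad p, p 2 - height j) ∈ openTriangle}

/-- The tori generated by the intersections of consecutive triangles lie completely in the stack;
they connect its parts. -/
def lens (j : Fin 3) : Set Space :=
  {p | (rad p, p 2 - height j.castSucc) ∈ openTriangle ∧
    (rad p, p 2 - height j.succ) ∈ openTriangle}

lemma convex_shift_openTriangle (c : ℝ) :
    Convex ℝ {q : ℝ × ℝ | (q.1, q.2 - c) ∈ openTriangle} := by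
  have h : {q : ℝ × ℝ | (q.1, q.2 - c) ∈ openTriangle} =
      (fun q => q + (0, -c)) ⁻¹' openTriangle := by
    ext q
    have e : q + (0, -c) = (q.1, q.2 - c) := by ext <;> simp [sub_eq_add_neg]
    rw [mem_preimage, e]
    rfl
  rw [h]
  exact convex_openTriangle.translate_preimage_left _

lemma height_succ (j : Fin 3) : height j.succ = height j.castSucc + √3 * (4 / 3) := by
  simp [height]
  ring

/-- A point over a given quadrant in the middle of a lens. -/
lemma exists_mem_lens (b₁ b₂ : Bool) (j : Fin 3) :
    ∃ p, p ∈ lens j ∧ p ∈ sector b₁ b₂ j.castSucc ∧ p ∈ sector b₁ b₂ j.succ := by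
  -- the horizontal coordinates are those of a right triangle `3 : 4 : 5` with hypotenuse `7 / 4`
  have hr : rad !₂[sgn b₁ * (21 / 20), sgn b₂ * (7 / 5), height j.castSucc + √3 * (2 / 3)] = 7 / 4 := by
    rw [rad, Real.sqrt_eq_iff_eq_sq (by positivity) (by norm_num)]
    simp
    linear_combination (21 / 20) ^ 2 * sgn_mul_self b₁ + (7 / 5) ^ 2 * sgn_mul_self b₂
  have m1 : ((7 / 4 : ℝ), (height j.castSucc + √3 * (2 / 3)) - height j.castSucc) ∈ openTriangle := by
    rw [add_sub_cancel_left, mem_openTriangle_scaled, abs_of_pos (by norm_num)]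
    norm_num
  have m2 : ((7 / 4 : ℝ), (height j.castSucc + √3 * (2 / 3)) - height j.succ) ∈ openTriangle := by
    have e : (height j.castSucc + √3 * (2 / 3)) - height j.succ = √3 * (-(2 / 3)) := by
      rw [height_succ]; ring
    rw [e, mem_openTriangle_scaled, abs_neg, abs_of_pos (by norm_num)]
    norm_num
  have s1 : 0 < sgn b₁ * (sgn b₁ * (21 / 20)) := by rw [← mul_assoc, sgn_mul_self]; norm_num
  have s2 : 0 < sgn b₂ * (sgn b₂ * (7 / 5)) := by rw [← mul_assoc, sgn_mul_self]; norm_num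
  refine ⟨!₂[sgn b₁ * (21 / 20), sgn b₂ * (7 / 5), height j.castSucc + √3 * (2 / 3)],
    ⟨?_, ?_⟩, ⟨by simpa using s1, by simpa using s2, ?_⟩, ⟨by simpa using s1, by simpa using s2, ?_⟩⟩
  all_goals
    rw [hr]
    first | simpa using m1 | simpa using m2

lemma isConnected_lens (j : Fin 3) : IsConnected (lens j) := by
  have h := (convex_shift_openTriangle (height j.castSucc)).inter
    (convex_shift_openTriangle (height j.succ))
  refine isConnected_revolution h ?_ fun q hq =>
    one_pos.trans (openTriangle_one_lt (q := (q.1, q.2 - height j.castSucc)) hq.1)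
  obtain ⟨p, hp, -⟩ := exists_mem_lens true true j
  exact ⟨(rad p, p 2), hp⟩

lemma isConnected_stackSector (b₁ b₂ : Bool) (j : Fin 4) : IsConnected (sector b₁ b₂ j) := by
  refine isConnected_sector b₁ b₂ (convex_shift_openTriangle (height j)) ⟨(3 / 2, height j), ?_⟩
    fun q hq => one_pos.trans (openTriangle_one_lt (q := (q.1, q.2 - height j)) hq)
  have : ((3 / 2 : ℝ), √3 * 0) ∈ openTriangle := by
    rw [mem_openTriangle_scaled]; norm_num
  simpa using this

/-- An open connected dense part of the stack. -/
def stackCore : Set Space :=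
  (⋃ j, lens j) ∪
    ⋃ i : {i : (Bool × Bool) × Fin 4 // sgn i.1.1 * sgn i.1.2 = sgn (parity i.2)},
      sector i.1.1.1 i.1.1.2 i.1.2

lemma lens_subset_stack (j : Fin 3) : lens j ⊆ stack := by
  rintro p ⟨h1, h2⟩
  have hpar : parity j.succ = !parity j.castSucc := by fin_cases j <;> rfl
  have hs : sgn (parity j.succ) = -sgn (parity j.castSucc) := by
    rw [hpar]; cases parity j.castSucc <;> simp [sgn]
  rcases le_total 0 (sgn (parity j.castSucc) * (p 0 * p 1)) with h | h
  · exact ⟨_, h, openTriangle_subset_triangle h1⟩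
  · exact ⟨_, by rw [hs]; linarith, openTriangle_subset_triangle h2⟩

lemma sector_subset_stack {b₁ b₂ : Bool} {j : Fin 4} (hj : sgn b₁ * sgn b₂ = sgn (parity j)) :
    sector b₁ b₂ j ⊆ stack := by
  rintro p ⟨h1, h2, hp⟩
  refine ⟨j, ?_, openTriangle_subset_triangle hp⟩
  rw [← hj]
  nlinarith [mul_pos h1 h2]

lemma isOpen_openTriangle_shift (c : ℝ) :
    IsOpen {p : Space | (rad p, p 2 - c) ∈ openTriangle} :=
  isOpen_openTriangle.preimage (f := fun p : Space => (rad p, p 2 - c)) (by fun_prop)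

lemma isOpen_sector (b₁ b₂ : Bool) (j : Fin 4) : IsOpen (sector b₁ b₂ j) := by
  have h1 : IsOpen {p : Space | 0 < sgn b₁ * p 0} := isOpen_lt (by fun_prop) (by fun_prop)
  have h2 : IsOpen {p : Space | 0 < sgn b₂ * p 1} := isOpen_lt (by fun_prop) (by fun_prop)
  exact h1.inter (h2.inter (isOpen_openTriangle_shift _))

lemma isOpen_lens (j : Fin 3) : IsOpen (lens j) :=
  (isOpen_openTriangle_shift _).inter (isOpen_openTriangle_shift _)

lemma isConnected_stackCore : IsConnected stackCore := by
  -- a chain through all lenses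
  have p1 : sgn true * sgn true = sgn (parity 1) := by simp [sgn, parity]
  have p2 : sgn true * sgn false = sgn (parity 2) := by simp [sgn, parity]
  obtain ⟨q0, q0l, -, q0s⟩ := exists_mem_lens true true 0
  obtain ⟨q1, q1l, q1s, -⟩ := exists_mem_lens true true 1
  obtain ⟨q2, q2l, -, q2s⟩ := exists_mem_lens true false 1
  obtain ⟨q3, q3l, q3s, -⟩ := exists_mem_lens true false 2
  set A : Set Space := (((lens 0 ∪ sector true true 1) ∪ lens 1) ∪ sector true false 2) ∪ lens 2
    with hA
  have cA : IsConnected A := by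
    refine IsConnected.union ⟨q3, Or.inr q3s, q3l⟩ ?_ (isConnected_lens 2)
    refine IsConnected.union ⟨q2, Or.inr q2l, q2s⟩ ?_ (isConnected_stackSector _ _ _)
    refine IsConnected.union ⟨q1, Or.inr q1s, q1l⟩ ?_ (isConnected_lens 1)
    exact IsConnected.union ⟨q0, q0l, q0s⟩ (isConnected_lens 0) (isConnected_stackSector _ _ _)
  have hlens : ∀ j, lens j ⊆ A := by
    intro j
    fin_cases j
    · exact fun p hp => Or.inl (Or.inl (Or.inl (Or.inl hp)))
    · exact fun p hp => Or.inl (Or.inl (Or.inr hp))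
    · exact fun p hp => Or.inr hp
  have hsec : ∀ b₁ b₂ j, sgn b₁ * sgn b₂ = sgn (parity j) → sector b₁ b₂ j ⊆ stackCore := by
    intro b₁ b₂ j h p hp
    exact Or.inr (mem_iUnion.2 ⟨⟨((b₁, b₂), j), h⟩, hp⟩)
  have hlens' : ∀ j, lens j ⊆ stackCore := fun j p hp => Or.inl (mem_iUnion.2 ⟨j, hp⟩)
  have hAC : A ⊆ stackCore := by
    refine union_subset (union_subset (union_subset (union_subset (hlens' _) (hsec _ _ _ p1))
      (hlens' _)) (hsec _ _ _ p2)) (hlens' _)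
  have hmeet : ∀ b₁ b₂ j, (A ∩ sector b₁ b₂ j).Nonempty := by
    intro b₁ b₂ j
    induction j using Fin.lastCases with
    | last =>
      obtain ⟨p, hp, -, hp'⟩ := exists_mem_lens b₁ b₂ 2
      exact ⟨p, hlens _ hp, hp'⟩
    | cast j =>
      obtain ⟨p, hp, hp', -⟩ := exists_mem_lens b₁ b₂ j
      exact ⟨p, hlens _ hp, hp'⟩
  refine ⟨⟨q0, hAC (hlens 0 q0l)⟩, isPreconnected_of_forall q0 ?_⟩
  rintro p (hp | hp)
  · obtain ⟨j, hp⟩ := mem_iUnion.1 hp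
    exact ⟨A, hAC, hlens 0 q0l, hlens j hp, cA.isPreconnected⟩
  · obtain ⟨⟨⟨⟨b₁, b₂⟩, j⟩, hj⟩, hp⟩ := mem_iUnion.1 hp
    exact ⟨A ∪ sector b₁ b₂ j, union_subset hAC (hsec _ _ _ hj), Or.inl (hlens 0 q0l), Or.inr hp,
      (cA.union (hmeet b₁ b₂ j) (isConnected_stackSector b₁ b₂ j)).isPreconnected⟩

/-! ### The stack of rotated triangles: its boundary -/

/-- The part of the `j`-th triangle, in the coordinates `(r, (z - height j) / √3)`, that is not
covered by the neighbouring triangles. -/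
noncomputable def cutTriangle (j : Fin 4) : List (ℝ × ℝ × ℝ) :=
  [(-1, 1, -1), (-1, -1, -1), (1, 0, 2), (1, 1, 1 + if j = 3 then 2 else 4 / 3),
    (1, -1, 1 + if j = 0 then 2 else 4 / 3)]

/-- The flat face of the `j`-th rotated triangle in the half-plane `p 0 = 0 ≤ sgn b₂ * p 1`. -/
noncomputable def flatFace (b₂ : Bool) (j : Fin 4) : Set Space :=
  (fun u : EuclideanSpace ℝ (Fin 2) => !₂[0, 0, height j] + u 0 • !₂[0, sgn b₂, 0] +
    u 1 • !₂[0, 0, √3]) '' polygon (cutTriangle j)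

lemma flat_point (b₂ : Bool) (c s t : ℝ) :
    (!₂[0, 0, c] + s • !₂[0, sgn b₂, 0] + t • !₂[0, 0, √3] : Space) =
      !₂[0, s * sgn b₂, c + t * √3] := by
  ext i
  fin_cases i <;> simp

lemma height_sub (i j : Fin 4) (t : ℝ) :
    height j + t * √3 - height i = √3 * (t + 4 / 3 * ((j : ℕ) - (i : ℕ))) := by
  simp only [height]
  ring

/-- The relative interior of a flat face does not meet the triangles of the other parity. -/
lemma notMem_triangle_of_mem_cutTriangle {i j : Fin 4} (hij : parity i ≠ parity j) {r t : ℝ}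
    (h1 : t < r - 1) (h2 : -t < r - 1) (h3 : r < 2)
    (h4 : r + t < 1 + if j = 3 then 2 else 4 / 3) (h5 : r - t < 1 + if j = 0 then 2 else 4 / 3) :
    (r, height j + t * √3 - height i) ∉ triangle := by
  rw [height_sub, mem_triangle_scaled, abs_le]
  rintro ⟨⟨g1, g2⟩, -⟩
  fin_cases i <;> fin_cases j <;> simp [parity] at hij <;> simp at g1 g2 h4 h5 <;> linarith

lemma isSmoothFace_flatFace (b₂ : Bool) (j : Fin 4) : IsSmoothFace stack (flatFace b₂ j) := by
  have hs2 := sgn_mul_self b₂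
  have h3 := sqrt_three_pos
  refine isSmoothFace_flat (cutTriangle j) _ _ _ ?_ ?_ 2 ?_ !₂[5 / 4, 0] ?_ ?_
  · intro s t h
    have e1 := congrArg (fun p : Space => p 1) h
    have e2 := congrArg (fun p : Space => p 2) h
    simp at e1 e2
    refine ⟨e1.resolve_right (left_ne_zero_of_mul_eq_one hs2), e2⟩
  · simp [cutTriangle]
  · intro u hu
    have k1 := hu (-1, 1, -1) (by simp [cutTriangle])
    have k2 := hu (-1, -1, -1) (by simp [cutTriangle])
    have k3 := hu (1, 0, 2) (by simp [cutTriangle])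
    simp only [neg_mul, one_mul, zero_mul, add_zero] at k1 k2 k3
    constructor <;> rw [abs_le] <;> constructor <;> linarith
  · fin_cases j <;> simp [cutTriangle] <;> norm_num
  · intro u hu
    have k1 := hu (-1, 1, -1) (by simp [cutTriangle])
    have k2 := hu (-1, -1, -1) (by simp [cutTriangle])
    have k3 := hu (1, 0, 2) (by simp [cutTriangle])
    have k4 := hu (1, 1, 1 + if j = 3 then 2 else 4 / 3) (by simp [cutTriangle])
    have k5 := hu (1, -1, 1 + if j = 0 then 2 else 4 / 3) (by simp [cutTriangle])
    simp only [neg_mul, one_mul, zero_mul, add_zero] at k1 k2 k3 k4 k5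
    rw [flat_point]
    set p : Space := !₂[0, u 0 * sgn b₂, height j + u 1 * √3] with hp
    have hr : rad p = u 0 := by
      rw [rad, Real.sqrt_eq_iff_eq_sq (by positivity) (by linarith)]
      simp [hp]
      linear_combination u 0 ^ 2 * hs2
    have hp2 : p 2 = height j + u 1 * √3 := by simp [hp]
    have hy : 0 < sgn b₂ * p 1 := by
      have : sgn b₂ * p 1 = u 0 := by simp [hp]; linear_combination u 0 * hs2
      rw [this]; linarith
    -- the side on which the solid lies
    obtain ⟨b₁, hb₁⟩ : ∃ b₁, sgn b₁ * sgn b₂ = sgn (parity j) := by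
      obtain ⟨b₁, h⟩ := exists_sgn_eq_mul (parity j) b₂
      exact ⟨b₁, by rw [h, mul_assoc, hs2, mul_one]⟩
    have hs1 := sgn_mul_self b₁
    have hT : (rad p, p 2 - height j) ∈ openTriangle := by
      rw [hr, hp2, add_sub_cancel_left, mul_comm, mem_openTriangle_scaled, abs_lt]
      exact ⟨⟨by linarith, by linarith⟩, k3⟩
    have hN : ∀ᶠ y in 𝓝 p, ∀ i, parity i ≠ parity j → (rad y, y 2 - height i) ∉ triangle := by
      rw [eventually_all]
      intro i
      by_cases hij : parity i = parity j
      · exact Eventually.of_forall fun y h => absurd hij h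
      · have hc : Continuous fun y : Space => (rad y, y 2 - height i) := by fun_prop
        have : (rad p, p 2 - height i) ∉ triangle := by
          rw [hr, hp2]
          exact notMem_triangle_of_mem_cutTriangle hij (by linarith) (by linarith) k3 k4
            (by linarith)
        filter_upwards [(isClosed_triangle.isOpen_compl.preimage hc).mem_nhds this] with y hy _
        exact hy
    have o2 : IsOpen {y : Space | 0 < sgn b₂ * y 1} := isOpen_lt (by fun_prop) (by fun_prop)
    refine exists_isOutwardNormal_of_quad 0 0 (-sgn b₁) 0 0 0 (Or.inl ?_) ?_ ?_
    · simpa using left_ne_zero_of_mul_eq_one hs1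
    · simp [quad, hp]
    · filter_upwards [(isOpen_openTriangle_shift _).mem_nhds hT, hN, o2.mem_nhds hy] with y g1 g2 g3
      have hq : quad 0 0 (-sgn b₁) 0 0 0 y = -(sgn b₁ * y 0) := by simp [quad]
      have g3 : 0 < sgn b₂ * y 1 := g3
      rw [hq, Left.neg_nonpos_iff]
      constructor
      · rintro ⟨i, hi, hiT⟩
        have hpar : parity i = parity j := by
          by_contra hij
          exact g2 i hij hiT
        rw [hpar, ← hb₁] at hi
        have e : sgn b₁ * sgn b₂ * (y 0 * y 1) = (sgn b₁ * y 0) * (sgn b₂ * y 1) := by ring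
        rw [e] at hi
        exact nonneg_of_mul_nonneg_left hi g3
      · intro h
        refine ⟨j, ?_, openTriangle_subset_triangle g1⟩
        rw [← hb₁]
        have := mul_nonneg h g3.le
        nlinarith

/-- The reflection exchanging the horizontal coordinates. -/
noncomputable def swapAxes : Space ≃ₗᵢ[ℝ] Space :=
  LinearIsometryEquiv.piLpCongrLeft 2 ℝ ℝ (Equiv.swap 0 1)

lemma swapAxes_apply (p : Space) : swapAxes p = !₂[p 1, p 0, p 2] := by
  ext i
  simp only [swapAxes, LinearIsometryEquiv.piLpCongrLeft_apply]
  fin_cases i <;> simp [Equiv.piCongrLeft']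
  rfl

lemma swapAxes_mem_stack {p : Space} : swapAxes p ∈ stack ↔ p ∈ stack := by
  have hr : rad (swapAxes p) = rad p := by
    rw [swapAxes_apply, rad, rad]
    simp [add_comm]
  rw [mem_stack, mem_stack, hr, swapAxes_apply]
  simp [mul_comm]

lemma swapAxes_swapAxes (p : Space) : swapAxes (swapAxes p) = p := by
  rw [swapAxes_apply, swapAxes_apply]
  ext i
  fin_cases i <;> simp

lemma swapAxes_image_stack : swapAxes '' stack = stack := by
  ext p
  constructor
  · rintro ⟨q, hq, rfl⟩
    exact swapAxes_mem_stack.2 hq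
  · intro hp
    exact ⟨swapAxes p, swapAxes_mem_stack.2 hp, swapAxes_swapAxes p⟩

/-- Interior points over the plane `p 0 = 0` and the flat faces. -/
lemma mem_flatFace_or_mem_nhds {p : Space} {j : Fin 4} {b₂ : Bool} (h0 : p 0 = 0)
    (h2 : 0 ≤ sgn b₂ * p 1) (hp : (rad p, p 2 - height j) ∈ openTriangle) :
    p ∈ flatFace b₂ j ∨ stack ∈ 𝓝 p := by
  have h3 := sqrt_three_pos
  have hs2 := sgn_mul_self b₂
  set t := (p 2 - height j) / √3 with ht
  have htz : p 2 = height j + t * √3 := by rw [ht]; field_simp; ring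
  have hp' := hp
  rw [htz, add_sub_cancel_left, mul_comm, mem_openTriangle_scaled, abs_lt] at hp'
  obtain ⟨⟨k1, k2⟩, k3⟩ := hp'
  have hr : rad p = sgn b₂ * p 1 := by
    rw [rad, Real.sqrt_eq_iff_eq_sq (by positivity) h2, h0]
    linear_combination (-p 1 ^ 2) * hs2
  -- a point in the interior of two neighbouring triangles
  have hlens : ∀ i : Fin 3, p ∈ lens i → stack ∈ 𝓝 p := fun i hi =>
    mem_of_superset ((isOpen_lens i).mem_nhds hi) (lens_subset_stack i)
  have hopen : ∀ i : Fin 4, |t + 4 / 3 * ((j : ℕ) - (i : ℕ))| < rad p - 1 →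
      (rad p, p 2 - height i) ∈ openTriangle := fun i hi => by
    rw [htz, height_sub, mem_openTriangle_scaled]
    exact ⟨hi, k3⟩
  by_cases hup : rad p + t ≤ 1 + if j = 3 then 2 else 4 / 3
  · by_cases hdn : rad p - t ≤ 1 + if j = 0 then 2 else 4 / 3
    · left
      refine ⟨!₂[rad p, t], ?_, ?_⟩
      · simp only [polygon, cutTriangle, mem_ofPred, List.forall_mem_cons, List.not_mem_nil,
          IsEmpty.forall_iff, implies_true, and_true, Matrix.cons_val_zero, Matrix.cons_val_one]
        refine ⟨?_, ?_, ?_, ?_, ?_⟩ <;> linarith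
      · simp only [Matrix.cons_val_zero, Matrix.cons_val_one]
        rw [flat_point, hr, ← htz]
        ext i
        fin_cases i
        · simp [h0]
        · simp; linear_combination p 1 * hs2
        · simp
    · right
      have hj : j ≠ 0 := by
        rintro rfl
        simp at hdn
        linarith
      obtain ⟨i, rfl⟩ := Fin.exists_succ_eq.2 hj
      refine hlens i ⟨hopen _ ?_, hp⟩
      rw [if_neg hj] at hdn
      rw [abs_lt]
      simp
      constructor <;> linarith
  · right
    have hj : j ≠ Fin.last 3 := by
      rintro rfl
      simp [show (Fin.last 3) = (3 : Fin 4) from rfl] at hup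
      linarith
    obtain ⟨i, rfl⟩ := Fin.exists_castSucc_eq.2 hj
    refine hlens i ⟨hp, hopen _ ?_⟩
    rw [if_neg (show i.castSucc ≠ (3 : Fin 4) from hj)] at hup
    rw [abs_lt]
    simp
    constructor <;> linarith

/-- The faces of the stack, up to the symmetry `swapAxes`. -/
noncomputable def stackFace :
    ({i : (Bool × Bool) × Fin 4 // sgn i.1.1 * sgn i.1.2 = sgn (parity i.2)} × Fin 3) ⊕
      (Bool × Fin 4) → Set Space
  | .inl i => roundFace i.1.1.1.1 i.1.1.1.2 (height i.1.1.2) i.2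
  | .inr i => flatFace i.1 i.2

lemma isSmoothFace_stackFace (i) : IsSmoothFace stack (stackFace i) := by
  rcases i with ⟨⟨⟨⟨b₁, b₂⟩, j⟩, h⟩, k⟩ | ⟨b, j⟩
  · exact (isSectorSolid_stack h).isSmoothFace_roundFace k
  · exact isSmoothFace_flatFace b j

lemma stack_cover {p : Space} (hp : p ∈ stack) (h0 : p 0 = 0 ∨ p 1 ≠ 0) :
    (∃ i, p ∈ stackFace i) ∨ stack ∈ 𝓝 p := by
  obtain ⟨j, hj, hT⟩ := hp
  obtain ⟨b₁, b₂, hb, h1, h2⟩ := exists_sgn_pair hj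
  by_cases hT' : (rad p, p 2 - height j) ∈ openTriangle
  · by_cases hx : p 0 = 0
    · rcases mem_flatFace_or_mem_nhds hx h2 hT' with h | h
      · exact Or.inl ⟨.inr (b₂, j), h⟩
      · exact Or.inr h
    · right
      have hne : ∀ {b : Bool} {x : ℝ}, x ≠ 0 → 0 ≤ sgn b * x → 0 < sgn b * x := fun hx h =>
        lt_of_le_of_ne h (mul_ne_zero (left_ne_zero_of_mul_eq_one (sgn_mul_self _)) hx).symm
      exact mem_of_superset ((isOpen_sector b₁ b₂ j).mem_nhds
        ⟨hne hx h1, hne (h0.resolve_left hx) h2, hT'⟩) (sector_subset_stack hb)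
  · obtain ⟨i, hi⟩ := exists_mem_roundFace h1 h2 hT hT'
    exact Or.inl ⟨.inl (⟨((b₁, b₂), j), hb⟩, i), hi⟩

lemma isBody_stack : IsBody stack := by
  refine isBody_of_faces (C := stackCore) (fun i : Bool × _ =>
    if i.1 then swapAxes '' stackFace i.2 else stackFace i.2) isClosed_stack isBounded_stack ?_
    isConnected_stackCore ?_ ?_ ?_ ?_
  · exact (isOpen_iUnion isOpen_lens).union (isOpen_iUnion fun i => isOpen_sector _ _ _)
  · refine union_subset (iUnion_subset lens_subset_stack) (iUnion_subset ?_)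
    rintro ⟨i, hi⟩
    exact sector_subset_stack hi
  · rintro p ⟨j, hj, hT⟩
    obtain ⟨b₁, b₂, hb, h1, h2⟩ := exists_sgn_pair hj
    refine closure_mono ?_ (mem_closure_sector h1 h2 hT)
    intro q hq
    exact Or.inr (mem_iUnion.2 ⟨⟨((b₁, b₂), j), hb⟩, hq⟩)
  · rintro ⟨_ | _, i⟩
    · exact isSmoothFace_stackFace i
    · have := (isSmoothFace_stackFace i).map swapAxes
      rwa [swapAxes_image_stack] at this
  · intro p hp
    by_cases h : p 0 = 0 ∨ p 1 ≠ 0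
    · rcases stack_cover hp h with ⟨i, hi⟩ | h
      · exact Or.inl ⟨(false, i), hi⟩
      · exact Or.inr h
    · have h1 : p 1 = 0 := by tauto
      rcases stack_cover (swapAxes_mem_stack.2 hp) (Or.inl (by simp [swapAxes_apply, h1])) with
        ⟨i, hi⟩ | h
      · exact Or.inl ⟨(true, i), swapAxes p, hi, swapAxes_swapAxes p⟩
      · right
        have := swapAxes.continuous.continuousAt.preimage_mem_nhds h
        exact mem_of_superset this fun q hq => swapAxes_mem_stack.1 hq

/-! ### The stack of rotated triangles: its scattering -/

lemma axial_neg (c : Space) (a b s z : ℝ) : axial c (-a) (-b) s z = axial c a b (-s) z := by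
  simp [axial]

lemma CrossSection.neg {B : Set Space} {a b c : ℝ} (h : CrossSection B a b c) :
    CrossSection B (-a) (-b) c where
  norm := by simpa using h.norm
  ne_zero := by simpa using h.ne_zero
  solid := by simpa using h.solid
  mem_iff s z hz := by rw [axial_neg, h.mem_iff _ _ hz, abs_neg]

lemma axial_height (a b c s z : ℝ) : axial !₂[0, 0, c] a b s z = axial !₂[0, 0, 0] a b s (c + z) := by
  ext i
  fin_cases i <;> simp [axial]

/-- Two consecutive crossings transfer a particle to the opposite side and back, so that it finally
moves along its initial line. -/
lemma scatters_of_two_crossSections {B : Set Space} {a b c r : ℝ} (h : CrossSection B a b c)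
    (h' : CrossSection B a b (c + √3 * (8 / 3)))
    (hB : ∀ s z, axial !₂[0, 0, 0] a b s z ∈ B →
      (|s|, z - c) ∈ triangle ∨ (|s|, z - (c + √3 * (8 / 3))) ∈ triangle)
    (hr : 1 < r) (hr' : r < 2) :
    ∃ z, Scatters B (axial !₂[0, 0, 0] a b r 0) down (axial !₂[0, 0, 0] a b r z) down := by
  have h3 := sqrt_three_pos
  have a1 : |r| = r := abs_of_pos (by linarith)
  have a2 : |r - 3| = 3 - r := by rw [abs_of_neg (by linarith)]; ring
  have hnot : ∀ s z, √3 * (|s| - 1) < |z - c| → √3 * (|s| - 1) < |z - (c + √3 * (8 / 3))| →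
      axial !₂[0, 0, 0] a b s z ∉ B := fun s z h1 h2 hz => (hB s z hz).elim
    (notMem_triangle_of_lt h1) (notMem_triangle_of_lt h2)
  -- the fall onto the upper triangle
  have harr : Arrives B (axial !₂[0, 0, 0] a b r 0) down
      (axial !₂[0, 0, c + √3 * (8 / 3)] a b r (√3 * (r - 1))) down := by
    have := arrives_of_line (B := B) (axial !₂[0, 0, 0] a b r 0) down
      (-(c + √3 * (8 / 3) + √3 * (r - 1))) (fun t ht => by
        rw [axial_add_smul_down]
        apply hnot <;> rw [a1] <;> exact lt_of_lt_of_le (by linarith) (le_abs_self _))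
    rw [axial_add_smul_down] at this
    rw [axial_height a b (c + √3 * (8 / 3))]
    simpa using this
  -- the flight between the two levels
  have harr2 := h'.arrives_below hr hr' harr (z := √3 * (2 - r) - √3 * (8 / 3)) (by nlinarith)
    (fun y hy hy' => by
      rw [axial_height a b (c + √3 * (8 / 3))]
      apply hnot <;> rw [a2]
      · exact lt_of_lt_of_le (by linarith) (le_abs_self _)
      · exact lt_of_lt_of_le (by linarith) (neg_le_abs _))
  have e : axial !₂[0, 0, c + √3 * (8 / 3)] a b (r - 3) (√3 * (2 - r) - √3 * (8 / 3)) =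
      axial !₂[0, 0, c] (-a) (-b) (3 - r) (√3 * (3 - r - 1)) := by
    rw [axial_neg, axial_height a b (c + √3 * (8 / 3)), axial_height a b c]
    congr 1 <;> ring
  rw [e] at harr2
  obtain ⟨z, hz⟩ := h.neg.scatters (by linarith) (by linarith) harr2 (fun y hy => by
    rw [axial_neg, axial_height a b c]
    have e3 : |-(3 - r - 3)| = r := by
      rw [show -(3 - r - 3) = r by ring, a1]
    apply hnot <;> rw [e3] <;> exact lt_of_lt_of_le (by nlinarith) (neg_le_abs _))
  refine ⟨c + z, ?_⟩
  rw [axial_neg, axial_height a b c] at hz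
  convert hz using 2
  ring

lemma crossSection_stack {a b : ℝ} (hab : a ^ 2 + b ^ 2 = 1) {j : Fin 4}
    (hj : 0 < sgn (parity j) * (a * b)) : CrossSection stack a b (height j) where
  norm := hab
  ne_zero h0 := by rw [h0] at hj; simp at hj
  solid b₁ b₂ h := by
    refine isSectorSolid_stack ?_
    obtain ⟨d, hd⟩ := exists_sgn_eq_mul b₁ b₂
    rw [← hd] at h ⊢
    rcases sgn_cases d with e | e <;> rcases sgn_cases (parity j) with e' | e' <;> rw [e, e'] <;>
      rw [e] at h <;> rw [e'] at hj <;> linarith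
  mem_iff s z hz := by
    rw [mem_stack]
    simp only [rad_axial hab]
    have e0 : ∀ x, axial !₂[0, 0, x] a b s z 0 * axial !₂[0, 0, x] a b s z 1 = s ^ 2 * (a * b) := by
      intro x; simp [axial]; ring
    have e2 : axial !₂[0, 0, height j] a b s z 2 = height j + z := by simp [axial]
    rw [e0, e2]
    constructor
    · rintro ⟨i, hi, hiT⟩
      have hs : 0 < s ^ 2 := by
        have : 1 ≤ |s| := triangle_one_le hiT
        rw [← sq_abs]; positivity
      have hpar : parity i = parity j := by
        apply sgn_injective
        have hi' : 0 ≤ sgn (parity i) * (a * b) := by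
          have e : sgn (parity i) * (s ^ 2 * (a * b)) = s ^ 2 * (sgn (parity i) * (a * b)) := by
            ring
          rw [e] at hi
          exact nonneg_of_mul_nonneg_right hi hs
        rcases sgn_cases (parity i) with e | e <;> rcases sgn_cases (parity j) with e' | e' <;>
          rw [e, e'] <;> rw [e] at hi' <;> rw [e'] at hj <;> linarith
      have hij : i = j := eq_of_parity_eq hpar (triangle_abs_le hiT) (by
        rw [add_sub_cancel_left]
        linarith [sqrt_three_pos])
      rw [hij, add_sub_cancel_left] at hiT
      exact hiT
    · intro h
      refine ⟨j, ?_, by rwa [add_sub_cancel_left]⟩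
      have := mul_nonneg (sq_nonneg s) hj.le
      linarith

lemma scatters_stack {x : Space} (hx : x 2 = 0) (h0 : x 0 ≠ 0) (h1 : x 1 ≠ 0)
    (hr1 : rad x ≠ 1) (hr2 : rad x ≠ 2) :
    ∃ x', Scatters stack x down x' down ∧ x' - ⟪x', down⟫ • down = x := by
  have hxe : ∀ y : Space, y 0 = x 0 → y 1 = x 1 → y - ⟪y, down⟫ • down = x := by
    intro y e0 e1
    rw [sub_inner_smul_down, e0, e1]
    ext i
    fin_cases i <;> simp [hx]
  by_cases hmid : 1 < rad x ∧ rad x < 2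
  · obtain ⟨hr, hr'⟩ := hmid
    obtain ⟨a, b, hab, ha, hb, e⟩ := exists_eq_axial hx (by linarith)
    have ha0 : a ≠ 0 := by rintro rfl; simp at ha; exact h0 ha
    have hb0 : b ≠ 0 := by rintro rfl; simp at hb; exact h1 hb
    obtain ⟨d, hd⟩ := exists_sgn_mul_pos (mul_ne_zero ha0 hb0)
    obtain ⟨j, j', hj, hj', hjj, hcov⟩ : ∃ j j' : Fin 4, parity j = d ∧ parity j' = d ∧
        height j' = height j + √3 * (8 / 3) ∧ ∀ i, parity i = d → i = j ∨ i = j' := by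
      cases d
      · refine ⟨0, 2, rfl, rfl, ?_, by decide⟩
        simp [height]; ring
      · refine ⟨1, 3, rfl, rfl, ?_, by decide⟩
        simp [height]; ring
    have c1 := crossSection_stack hab (hj ▸ hd)
    have c2 := crossSection_stack hab (hj' ▸ hd)
    rw [hjj] at c2
    obtain ⟨z, hz⟩ := scatters_of_two_crossSections c1 c2 (fun s z hs => by
      obtain ⟨i, hi, hiT⟩ := hs
      rw [rad_axial hab] at hiT
      have hs : 0 < s ^ 2 := by
        have : 1 ≤ |s| := triangle_one_le hiT
        rw [← sq_abs]; positivity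
      have e0 : axial !₂[0, 0, 0] a b s z 0 * axial !₂[0, 0, 0] a b s z 1 = s ^ 2 * (a * b) := by
        simp [axial]; ring
      have e2 : axial !₂[0, 0, 0] a b s z 2 = z := by simp [axial]
      rw [e2] at hiT
      rw [e0] at hi
      have hpar : parity i = d := by
        by_contra hne
        have : sgn (parity i) = - sgn d := by
          revert hne
          cases parity i <;> cases d <;> simp [sgn]
        rw [this] at hi
        nlinarith [mul_pos hs hd]
      rcases hcov i hpar with rfl | rfl
      · exact Or.inl hiT
      · exact Or.inr (hjj ▸ hiT)) hr hr'
    rw [← e] at hz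
    refine ⟨_, hz, hxe _ ?_ ?_⟩
    · simp [axial, ha]
    · simp [axial, hb]
  · refine ⟨x, scatters_of_line _ _ fun t ht => ?_, hxe _ rfl rfl⟩
    obtain ⟨i, -, hiT⟩ := ht
    have e : rad (x + t • down) = rad x := by simp [rad, down]
    rw [e] at hiT
    exact hmid ⟨lt_of_le_of_ne (triangle_one_le hiT) hr1.symm, lt_of_le_of_ne hiT.2 hr2⟩

lemma invisible_stack : Invisible stack down := by
  have h : ∀ᵐ x : perp down ∂(planeMeasure down), ∃ x', Scatters stack x down x' down ∧
      x' - ⟪x', down⟫ • down = (x : Space) := by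
    filter_upwards [ae_perp_down_coord_ne 0 (by decide) 0, ae_perp_down_coord_ne 1 (by decide) 0,
      ae_perp_down_rad_ne 1, ae_perp_down_rad_ne 2] with x h0 h1 hr1 hr2
    exact scatters_stack (mem_perp_down.1 x.2) h0 h1 hr1 hr2
  refine ⟨⟨zeroResistance_of_ae_perp norm_down ?_, id, MeasurePreserving.id _, h⟩, h⟩
  filter_upwards [h] with x ⟨x', hx', _⟩ using ⟨x', hx'⟩

/-! ### The glued prisms: their shape -/

/-- The quarter turn as a linear isometry. -/
noncomputable def turn : Space ≃ₗᵢ[ℝ] Space where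
  toFun := quarterTurn
  invFun p := !₂[p 1, -p 0, p 2]
  left_inv p := by ext i; fin_cases i <;> simp [quarterTurn]
  right_inv p := by ext i; fin_cases i <;> simp [quarterTurn]
  map_add' p q := by
    ext i
    fin_cases i <;> simp [quarterTurn]
    ring
  map_smul' c p := by ext i; fin_cases i <;> simp [quarterTurn]
  norm_map' p := by
    change ‖quarterTurn p‖ = ‖p‖
    rw [EuclideanSpace.norm_eq, EuclideanSpace.norm_eq]
    congr 1
    simp [quarterTurn, Fin.sum_univ_three]
    ring

lemma turn_apply (p : Space) : turn p = !₂[-p 1, p 0, p 2] := rfl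

lemma quarterTurn_iterate (n : ℕ) : quarterTurn^[n] = ⇑(turn ^ n) := by
  induction n with
  | zero => rfl
  | succ n ih =>
    rw [Function.iterate_succ', ih, pow_succ']
    rfl

/-- The prism adjacent to the vertical axis, where `w` stands for `z / √3`. -/
def InnerPrism (x y w : ℝ) : Prop := -8 ≤ y ∧ y ≤ 0 ∧ x ≤ 0 ∧ |w| ≤ x + 1

/-- The prism far from the vertical axis, where `w` stands for `z / √3`. -/
def OuterPrism (x y w : ℝ) : Prop := -8 ≤ y ∧ y ≤ 0 ∧ -4 ≤ x ∧ |w| ≤ -3 - x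

lemma mem_triangle_iff {r z : ℝ} : (r, z) ∈ triangle ↔ |z / √3| ≤ r - 1 ∧ r ≤ 2 := by
  rw [← mem_triangle_scaled]
  congr! 2
  field_simp

lemma mem_pairPrism {p : Space} : p ∈ pairPrism ↔
    InnerPrism (p 0) (p 1) (p 2 / √3) ∨ OuterPrism (p 0) (p 1) (p 2 / √3) := by
  change (-8 ≤ p 1 ∧ p 1 ≤ 0 ∧ (|p 0 + 2|, p 2) ∈ triangle) ↔ _
  rw [mem_triangle_iff]
  have h0 := abs_nonneg (p 2 / √3)
  constructor
  · rintro ⟨h1, h2, h3, h4⟩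
    rcases le_total 0 (p 0 + 2) with h | h
    · rw [abs_of_nonneg h] at h3 h4
      exact Or.inl ⟨h1, h2, by linarith, by linarith⟩
    · rw [abs_of_nonpos h] at h3 h4
      exact Or.inr ⟨h1, h2, by linarith, by linarith⟩
  · rintro (⟨h1, h2, h3, h4⟩ | ⟨h1, h2, h3, h4⟩)
    · rw [abs_of_nonneg (by linarith : 0 ≤ p 0 + 2)]
      exact ⟨h1, h2, by linarith, by linarith⟩
    · rw [abs_of_nonpos (by linarith : p 0 + 2 ≤ 0)]
      exact ⟨h1, h2, by linarith, by linarith⟩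

lemma mem_gluedPrisms_iff_exists {p : Space} :
    p ∈ gluedPrisms ↔ ∃ k : Fin 4, ∃ q ∈ pairPrism, (turn ^ (k : ℕ)) q = p := by
  simp only [gluedPrisms, mem_iUnion, quarterTurn_iterate, mem_image]

lemma turn_pow_two_apply (p : Space) : (turn ^ 2) p = !₂[-p 0, -p 1, p 2] := by
  rw [pow_two, LinearIsometryEquiv.coe_mul, Function.comp_apply, turn_apply, turn_apply]
  simp

lemma turn_pow_three_apply (p : Space) : (turn ^ 3) p = !₂[p 1, -p 0, p 2] := by
  rw [pow_succ', LinearIsometryEquiv.coe_mul, Function.comp_apply, turn_pow_two_apply, turn_apply]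
  simp

lemma turn_pow_four : turn ^ 4 = 1 := by
  ext1 p
  rw [pow_succ', LinearIsometryEquiv.coe_mul, Function.comp_apply, turn_pow_three_apply, turn_apply]
  ext i
  fin_cases i <;> simp

lemma mem_gluedPrisms {p : Space} : p ∈ gluedPrisms ↔
    (InnerPrism (p 0) (p 1) (p 2 / √3) ∨ OuterPrism (p 0) (p 1) (p 2 / √3)) ∨
    (InnerPrism (p 1) (-p 0) (p 2 / √3) ∨ OuterPrism (p 1) (-p 0) (p 2 / √3)) ∨
    (InnerPrism (-p 0) (-p 1) (p 2 / √3) ∨ OuterPrism (-p 0) (-p 1) (p 2 / √3)) ∨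
    (InnerPrism (-p 1) (p 0) (p 2 / √3) ∨ OuterPrism (-p 1) (p 0) (p 2 / √3)) := by
  rw [mem_gluedPrisms_iff_exists]
  constructor
  · rintro ⟨k, q, hq, rfl⟩
    rw [mem_pairPrism] at hq
    fin_cases k
    · exact Or.inl hq
    · refine Or.inr (Or.inl ?_)
      simpa [turn_apply] using hq
    · refine Or.inr (Or.inr (Or.inl ?_))
      simpa [turn_pow_two_apply] using hq
    · refine Or.inr (Or.inr (Or.inr ?_))
      simpa [turn_pow_three_apply] using hq
  · rintro (h | h | h | h)
    · exact ⟨0, p, mem_pairPrism.2 h, rfl⟩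
    · refine ⟨1, !₂[p 1, -p 0, p 2], mem_pairPrism.2 h, ?_⟩
      change (turn ^ 1) _ = _
      rw [pow_one, turn_apply]
      ext i; fin_cases i <;> simp
    · refine ⟨2, !₂[-p 0, -p 1, p 2], mem_pairPrism.2 h, ?_⟩
      change (turn ^ 2) _ = _
      rw [turn_pow_two_apply]
      ext i; fin_cases i <;> simp
    · refine ⟨3, !₂[-p 1, p 0, p 2], mem_pairPrism.2 h, ?_⟩
      change (turn ^ 3) _ = _
      rw [turn_pow_three_apply]
      ext i; fin_cases i <;> simp

lemma turn_mem_gluedPrisms {p : Space} : turn p ∈ gluedPrisms ↔ p ∈ gluedPrisms := by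
  rw [mem_gluedPrisms, mem_gluedPrisms, turn_apply]
  simp only [Matrix.cons_val_zero, Matrix.cons_val_one, Matrix.cons_val, neg_neg]
  tauto

lemma turn_pow_mem_gluedPrisms (n : ℕ) {p : Space} :
    (turn ^ n) p ∈ gluedPrisms ↔ p ∈ gluedPrisms := by
  induction n with
  | zero => rfl
  | succ n ih =>
    rw [pow_succ', LinearIsometryEquiv.coe_mul, Function.comp_apply, turn_mem_gluedPrisms, ih]

lemma turn_pow_image_gluedPrisms (n : ℕ) : (turn ^ n) '' gluedPrisms = gluedPrisms := by
  ext p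
  constructor
  · rintro ⟨q, hq, rfl⟩
    exact (turn_pow_mem_gluedPrisms n).2 hq
  · intro hp
    obtain ⟨q, rfl⟩ := (turn ^ n).surjective p
    exact ⟨q, (turn_pow_mem_gluedPrisms n).1 hp, rfl⟩

lemma isClosed_pairPrism : IsClosed pairPrism := by
  have h1 : IsClosed {p : Space | -8 ≤ p 1} := isClosed_le (by fun_prop) (by fun_prop)
  have h2 : IsClosed {p : Space | p 1 ≤ 0} := isClosed_le (by fun_prop) (by fun_prop)
  exact h1.inter (h2.inter (isClosed_triangle.preimage
    (f := fun p : Space => (|p 0 + 2|, p 2)) (by fun_prop)))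

lemma isClosed_gluedPrisms : IsClosed gluedPrisms := by
  refine isClosed_iUnion_of_finite fun k => ?_
  rw [quarterTurn_iterate]
  exact (turn ^ (k : ℕ)).toHomeomorph.isClosedMap _ isClosed_pairPrism

lemma abs_div_sqrt_three (z : ℝ) : |z| = √3 * |z / √3| := by
  rw [abs_div, abs_of_pos sqrt_three_pos]
  field_simp

lemma isBounded_gluedPrisms : Bornology.IsBounded gluedPrisms := by
  have h3' : √3 ≤ 2 := by rw [Real.sqrt_le_left (by norm_num)]; norm_num
  have hP : Bornology.IsBounded pairPrism := by
    refine isBounded_of_rad_le (R := 12) fun p hp => ?_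
    rw [mem_pairPrism] at hp
    have hb : -8 ≤ p 1 ∧ p 1 ≤ 0 ∧ -4 ≤ p 0 ∧ p 0 ≤ 0 ∧ |p 2 / √3| ≤ 1 := by
      have h0 := abs_nonneg (p 2 / √3)
      rcases hp with ⟨h1, h2, h3, h4⟩ | ⟨h1, h2, h3, h4⟩ <;>
        refine ⟨h1, h2, ?_, ?_, ?_⟩ <;> linarith
    obtain ⟨h1, h2, h3, h4, h5⟩ := hb
    constructor
    · rw [rad, Real.sqrt_le_left (by norm_num)]
      nlinarith
    · rw [abs_div_sqrt_three]
      nlinarith [sqrt_three_pos]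
  refine Bornology.isBounded_iUnion.2 fun k => ?_
  rw [quarterTurn_iterate]
  exact (turn ^ (k : ℕ)).lipschitz.isBounded_image hP

/-- The interior of the inner prism, extended into the prism to which it is glued. -/
def innerCore : Set Space :=
  {p | -8 < p 1 ∧ p 0 < 0 ∧ |p 2 / √3| < p 0 + 1 ∧ |p 2 / √3| < 1 - p 1}

/-- The interior of the outer prism, extended into the prism to which it is glued. -/
def outerCore : Set Space :=
  {p | -8 < p 1 ∧ -4 < p 0 ∧ |p 2 / √3| < -3 - p 0 ∧ |p 2 / √3| < 1 - p 1}

lemma innerCore_subset : innerCore ⊆ gluedPrisms := by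
  rintro p ⟨h1, h2, h3, h4⟩
  have h0 := abs_nonneg (p 2 / √3)
  rw [mem_gluedPrisms]
  rcases le_total (p 1) 0 with h | h
  · exact Or.inl (Or.inl ⟨h1.le, h, h2.le, h3.le⟩)
  · refine Or.inr (Or.inr (Or.inr (Or.inl ⟨?_, ?_, ?_, ?_⟩))) <;> linarith

lemma outerCore_subset : outerCore ⊆ gluedPrisms := by
  rintro p ⟨h1, h2, h3, h4⟩
  have h0 := abs_nonneg (p 2 / √3)
  rw [mem_gluedPrisms]
  rcases le_total (p 1) 0 with h | h
  · exact Or.inl (Or.inr ⟨h1.le, h, h2.le, h3.le⟩)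
  · refine Or.inr (Or.inr (Or.inr (Or.inl ⟨?_, ?_, ?_, ?_⟩))) <;> linarith

lemma isOpen_innerCore : IsOpen innerCore := by
  have h1 : IsOpen {p : Space | -8 < p 1} := isOpen_lt (by fun_prop) (by fun_prop)
  have h2 : IsOpen {p : Space | p 0 < 0} := isOpen_lt (by fun_prop) (by fun_prop)
  have h3 : IsOpen {p : Space | |p 2 / √3| < p 0 + 1} := isOpen_lt (by fun_prop) (by fun_prop)
  have h4 : IsOpen {p : Space | |p 2 / √3| < 1 - p 1} := isOpen_lt (by fun_prop) (by fun_prop)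
  exact h1.inter (h2.inter (h3.inter h4))

lemma isOpen_outerCore : IsOpen outerCore := by
  have h1 : IsOpen {p : Space | -8 < p 1} := isOpen_lt (by fun_prop) (by fun_prop)
  have h2 : IsOpen {p : Space | -4 < p 0} := isOpen_lt (by fun_prop) (by fun_prop)
  have h3 : IsOpen {p : Space | |p 2 / √3| < -3 - p 0} := isOpen_lt (by fun_prop) (by fun_prop)
  have h4 : IsOpen {p : Space | |p 2 / √3| < 1 - p 1} := isOpen_lt (by fun_prop) (by fun_prop)
  exact h1.inter (h2.inter (h3.inter h4))

lemma convex_affine_lt (a b c k : ℝ) :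
    Convex ℝ {p : Space | a * p 0 + b * p 1 + c * |p 2 / √3| < k} ∨ c < 0 := by
  by_cases hc : c < 0
  · exact Or.inr hc
  left
  intro p hp q hq s t hs ht hst
  simp only [mem_ofPred] at hp hq ⊢
  have h1 : |(s • p + t • q) 2 / √3| ≤ s * |p 2 / √3| + t * |q 2 / √3| := by
    have e : (s • p + t • q) 2 / √3 = s * (p 2 / √3) + t * (q 2 / √3) := by
      simp only [PiLp.add_apply, PiLp.smul_apply, smul_eq_mul]; ring
    rw [e]
    refine (abs_add_le _ _).trans ?_
    rw [abs_mul, abs_mul, abs_of_nonneg hs, abs_of_nonneg ht]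
  have h2 := mul_le_mul_of_nonneg_left h1 (not_lt.1 hc)
  have h3 : s * (a * p 0 + b * p 1 + c * |p 2 / √3|) + t * (a * q 0 + b * q 1 + c * |q 2 / √3|) < k := by
    rcases hs.eq_or_lt with rfl | hs0
    · have : t = 1 := by linarith
      rw [this]; linarith
    · have := mul_lt_mul_of_pos_left hp hs0
      have := mul_le_mul_of_nonneg_left hq.le ht
      have e : k = s * k + t * k := by rw [← add_mul, hst, one_mul]
      linarith
  simp only [PiLp.add_apply, PiLp.smul_apply, smul_eq_mul] at h2 ⊢
  linarith

lemma convex_innerCore : Convex ℝ innerCore := by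
  have h (a b c k : ℝ) (hc : 0 ≤ c) := (convex_affine_lt a b c k).resolve_right (not_lt.2 hc)
  have e : innerCore = {p : Space | 0 * p 0 + (-1) * p 1 + 0 * |p 2 / √3| < 8} ∩
      ({p : Space | 1 * p 0 + 0 * p 1 + 0 * |p 2 / √3| < 0} ∩
      ({p : Space | (-1) * p 0 + 0 * p 1 + 1 * |p 2 / √3| < 1} ∩
      {p : Space | 0 * p 0 + 1 * p 1 + 1 * |p 2 / √3| < 1})) := by
    ext p
    simp only [innerCore, mem_inter_iff, mem_ofPred]
    constructor <;> rintro ⟨h1, h2, h3, h4⟩ <;> refine ⟨?_, ?_, ?_, ?_⟩ <;> linarith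
  rw [e]
  exact (h _ _ _ _ le_rfl).inter ((h _ _ _ _ le_rfl).inter
    ((h _ _ _ _ zero_le_one).inter (h _ _ _ _ zero_le_one)))

lemma convex_outerCore : Convex ℝ outerCore := by
  have h (a b c k : ℝ) (hc : 0 ≤ c) := (convex_affine_lt a b c k).resolve_right (not_lt.2 hc)
  have e : outerCore = {p : Space | 0 * p 0 + (-1) * p 1 + 0 * |p 2 / √3| < 8} ∩
      ({p : Space | (-1) * p 0 + 0 * p 1 + 0 * |p 2 / √3| < 4} ∩
      ({p : Space | 1 * p 0 + 0 * p 1 + 1 * |p 2 / √3| < -3} ∩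
      {p : Space | 0 * p 0 + 1 * p 1 + 1 * |p 2 / √3| < 1})) := by
    ext p
    simp only [outerCore, mem_inter_iff, mem_ofPred]
    constructor <;> rintro ⟨h1, h2, h3, h4⟩ <;> refine ⟨?_, ?_, ?_, ?_⟩ <;> linarith
  rw [e]
  exact (h _ _ _ _ le_rfl).inter ((h _ _ _ _ le_rfl).inter
    ((h _ _ _ _ zero_le_one).inter (h _ _ _ _ zero_le_one)))

/-- Points of the prisms are limits of the points obtained by contracting towards a point of the
interior. -/
lemma tendsto_contract (p c : Space) :
    Tendsto (fun t : ℝ => (1 - t) • p + t • c) (𝓝[>] 0) (𝓝 p) := by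
  have hc : Continuous (fun t : ℝ => (1 - t) • p + t • c) := by fun_prop
  simpa using (hc.tendsto 0).mono_left nhdsWithin_le_nhds

lemma contract_apply (p : Space) (a b t : ℝ) :
    ((1 - t) • p + t • !₂[a, b, 0]) 0 = (1 - t) * p 0 + t * a ∧
    ((1 - t) • p + t • !₂[a, b, 0]) 1 = (1 - t) * p 1 + t * b ∧
    (t < 1 → |((1 - t) • p + t • !₂[a, b, 0]) 2 / √3| = (1 - t) * |p 2 / √3|) := by
  refine ⟨by simp, by simp, fun ht => ?_⟩
  rw [← abs_of_pos (by linarith : 0 < 1 - t), ← abs_mul, abs_of_pos (by linarith : 0 < 1 - t)]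
  simp [mul_div_assoc]

lemma mem_closure_core {p : Space} (hp : p ∈ pairPrism) :
    p ∈ closure innerCore ∨ p ∈ closure outerCore := by
  have hev : ∀ᶠ t : ℝ in 𝓝[>] 0, 0 < t ∧ t < 1 := by
    filter_upwards [self_mem_nhdsWithin,
      mem_nhdsWithin_of_mem_nhds (Iio_mem_nhds (zero_lt_one' ℝ))] with t h0 h1 using ⟨h0, h1⟩
  have h0 := abs_nonneg (p 2 / √3)
  rcases mem_pairPrism.1 hp with ⟨h1, h2, h3, h4⟩ | ⟨h1, h2, h3, h4⟩
  · left
    refine mem_closure_of_tendsto (tendsto_contract p !₂[-1 / 4, -4, 0]) ?_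
    filter_upwards [hev] with t ⟨ht0, ht1⟩
    obtain ⟨e0, e1, e2⟩ := contract_apply p (-1 / 4) (-4) t
    simp only [innerCore, mem_ofPred]
    rw [e0, e1, e2 ht1]
    refine ⟨?_, ?_, ?_, ?_⟩ <;> nlinarith
  · right
    refine mem_closure_of_tendsto (tendsto_contract p !₂[-15 / 4, -4, 0]) ?_
    filter_upwards [hev] with t ⟨ht0, ht1⟩
    obtain ⟨e0, e1, e2⟩ := contract_apply p (-15 / 4) (-4) t
    simp only [outerCore, mem_ofPred]
    rw [e0, e1, e2 ht1]
    refine ⟨?_, ?_, ?_, ?_⟩ <;> nlinarith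

/-- An open connected dense part of the glued prisms. -/
def gluedCore : Set Space := ⋃ n : ℕ, (turn ^ n) '' (innerCore ∪ turn '' outerCore)

lemma mem_innerCore_half (a : ℝ) (ha : -8 < a) (ha' : a < 1) :
    (!₂[-1 / 4, a, 0] : Space) ∈ innerCore := by
  refine ⟨?_, ?_, ?_, ?_⟩ <;> simp <;> linarith

lemma isConnected_gluedCore : IsConnected gluedCore := by
  have hi : IsConnected innerCore := convex_innerCore.isConnected ⟨_, mem_innerCore_half 0
    (by norm_num) (by norm_num)⟩
  have hm : (!₂[-7 / 2, 1 / 4, 0] : Space) ∈ outerCore := by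
    refine ⟨?_, ?_, ?_, ?_⟩ <;> simp <;> norm_num
  have ho : IsConnected outerCore := convex_outerCore.isConnected ⟨_, hm⟩
  have hD : IsConnected (innerCore ∪ turn '' outerCore) := by
    refine hi.union ?_ (ho.image _ turn.continuous.continuousOn)
    refine ⟨_, mem_innerCore_half (-7 / 2) (by norm_num) (by norm_num), _, hm, ?_⟩
    rw [turn_apply]
    ext i
    fin_cases i <;> simp
    norm_num
  refine IsConnected.iUnion_of_chain (fun n => hD.image _ (turn ^ n).continuous.continuousOn)
    fun n => ?_
  have hq : (!₂[-1 / 2, 1 / 4, 0] : Space) ∈ innerCore := by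
    refine ⟨?_, ?_, ?_, ?_⟩ <;> simp <;> norm_num
  refine ⟨(turn ^ n) !₂[-1 / 4, -1 / 2, 0],
    ⟨_, Or.inl (mem_innerCore_half _ (by norm_num) (by norm_num)), rfl⟩,
    ⟨_, Or.inl hq, ?_⟩⟩
  rw [Nat.succ_eq_succ, Nat.succ_eq_add_one, pow_succ, LinearIsometryEquiv.coe_mul,
    Function.comp_apply, turn_apply]
  congr 1
  ext i
  fin_cases i <;> simp
  norm_num

lemma isOpen_gluedCore : IsOpen gluedCore := by
  refine isOpen_iUnion fun n => (turn ^ n).toHomeomorph.isOpenMap _ ?_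
  exact isOpen_innerCore.union (turn.toHomeomorph.isOpenMap _ isOpen_outerCore)

lemma gluedCore_subset : gluedCore ⊆ gluedPrisms := by
  refine iUnion_subset fun n => ?_
  rw [← turn_pow_image_gluedPrisms n]
  refine image_mono (union_subset innerCore_subset ?_)
  have := turn_pow_image_gluedPrisms 1
  rw [pow_one] at this
  rw [← this]
  exact image_mono outerCore_subset

lemma gluedPrisms_subset_closure : gluedPrisms ⊆ closure gluedCore := by
  intro p hp
  obtain ⟨k, q, hq, rfl⟩ := mem_gluedPrisms_iff_exists.1 hp
  rcases mem_closure_core hq with h | h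
  · have h1 := image_closure_subset_closure_image (turn ^ (k : ℕ)).continuous (mem_image_of_mem _ h)
    refine closure_mono ?_ h1
    rintro _ ⟨r, hr, rfl⟩
    exact mem_iUnion.2 ⟨k, r, Or.inl hr, rfl⟩
  · have h1 := image_closure_subset_closure_image (turn ^ (k : ℕ)).continuous (mem_image_of_mem _ h)
    refine closure_mono ?_ h1
    rintro _ ⟨r, hr, rfl⟩
    refine mem_iUnion.2 ⟨k + 3, turn r, Or.inr ⟨r, hr, rfl⟩, ?_⟩
    rw [← Function.comp_apply (f := ⇑(turn ^ ((k : ℕ) + 3))), ← LinearIsometryEquiv.coe_mul,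
      ← pow_succ, add_assoc, pow_add]
    change (turn ^ (k : ℕ) * turn ^ 4) r = _
    rw [turn_pow_four, mul_one]

/-! ### The glued prisms: their boundary -/

lemma eventually_lt_of {f g : Space → ℝ} (hf : Continuous f) (hg : Continuous g) {p : Space}
    (h : f p < g p) : ∀ᶠ y in 𝓝 p, f y < g y :=
  hf.continuousAt.eventually_lt hg.continuousAt h

lemma exists_isOutwardNormal_of_affine {S : Set Space} {p : Space} (a b c k : ℝ)
    (hne : a ≠ 0 ∨ b ≠ 0 ∨ c ≠ 0) (h0 : a * p 0 + b * p 1 + c * (p 2 / √3) + k = 0)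
    (hS : ∀ᶠ y in 𝓝 p, (y ∈ S ↔ a * y 0 + b * y 1 + c * (y 2 / √3) + k ≤ 0)) :
    ∃ n, IsOutwardNormal S p n := by
  have hq : ∀ y : Space, quad 0 0 a b (c / √3) k y = a * y 0 + b * y 1 + c * (y 2 / √3) + k := by
    intro y
    simp only [quad]
    ring
  refine exists_isOutwardNormal_of_quad 0 0 a b (c / √3) k ?_ (by rw [hq, h0]) ?_
  · rcases hne with h | h | h
    · exact Or.inl (by simpa using h)
    · exact Or.inr (Or.inl (by simpa using h))
    · refine Or.inr (Or.inr ?_)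
      simp only [mul_zero, zero_mul, zero_add]
      exact div_ne_zero h sqrt_three_pos.ne'
  · simpa only [hq] using hS

lemma sgn_true : sgn true = 1 := rfl

lemma sgn_false : sgn false = -1 := rfl

lemma sgn_mul_eq_of_pos {b : Bool} {w : ℝ} (h : 0 < sgn b * w) : |w| = sgn b * w :=
  (sgn_mul_eq_abs h.le).symm

/-- Only the first prism pair lies over the open rectangle `(-4, 0) × (-8, 0)`. -/
lemma mem_gluedPrisms_iff_mem_triangle {p : Space} (h2 : p 0 < 0) (h3 : -8 < p 1)
    (h4 : p 1 < 0) : p ∈ gluedPrisms ↔ (|p 0 + 2|, p 2) ∈ triangle := by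
  have h0 := abs_nonneg (p 2 / √3)
  have e : (|p 0 + 2|, p 2) ∈ triangle ↔ p ∈ pairPrism :=
    ⟨fun h => ⟨h3.le, h4.le, h⟩, fun h => h.2.2⟩
  rw [e, mem_pairPrism, mem_gluedPrisms]
  refine ⟨?_, Or.inl⟩
  rintro (h | (⟨a1, a2, a3, a4⟩ | ⟨a1, a2, a3, a4⟩) | (⟨a1, a2, a3, a4⟩ | ⟨a1, a2, a3, a4⟩) |
    (⟨a1, a2, a3, a4⟩ | ⟨a1, a2, a3, a4⟩))
  · exact h
  all_goals linarith

/-- The normals of the slanted sides of the first prism pair. -/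
lemma isOutwardNormal_slope (b₁ b : Bool) {p : Space} (h1 : 1 < sgn b₁ * (p 0 + 2))
    (h2 : sgn b₁ * (p 0 + 2) < 2) (h3 : -8 < p 1) (h4 : p 1 < 0)
    (hw : sgn b * (p 2 / √3) = sgn b₁ * (p 0 + 2) - 1) :
    IsOutwardNormal gluedPrisms p !₂[-(√3 / 2) * sgn b₁, 0, sgn b / 2] := by
  have s3 := sqrt_three_pos
  have s33 := sqrt_three_mul_self
  have hs := sgn_mul_self b
  have hs₁ := sgn_mul_self b₁
  have hq : ∀ y : Space, quad 0 0 (-sgn b₁) 0 (sgn b / √3) (1 - 2 * sgn b₁) y =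
      sgn b * (y 2 / √3) - (sgn b₁ * (y 0 + 2) - 1) := by
    intro y
    simp only [quad]
    ring
  refine isOutwardNormal_of_quad (A := 0) (B := 0) (a := -sgn b₁) (b := 0) (c := sgn b / √3)
    (k := 1 - 2 * sgn b₁) (l := 2 / √3) ?_ (by positivity) ?_ (by rw [hq, hw, sub_self]) ?_
  · rw [EuclideanSpace.norm_eq, Real.sqrt_eq_one]
    simp [Fin.sum_univ_three]
    linear_combination (√3 * √3 / 4) * hs₁ + s33 / 4 + hs / 4
  · ext i
    fin_cases i
    · simp
      field_simp
    · simp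
    · simp
  have n1 : ∀ᶠ y : Space in 𝓝 p, 0 < sgn b * (y 2 / √3) :=
    eventually_lt_of (by fun_prop) (by fun_prop) (by linarith)
  have n2 : ∀ᶠ y : Space in 𝓝 p, sgn b₁ * (y 0 + 2) < 2 :=
    eventually_lt_of (by fun_prop) (by fun_prop) h2
  have n3 : ∀ᶠ y in 𝓝 p, -8 < y 1 := eventually_lt_of (by fun_prop) (by fun_prop) h3
  have n4 : ∀ᶠ y in 𝓝 p, y 1 < 0 := eventually_lt_of (by fun_prop) (by fun_prop) h4
  have n5 : ∀ᶠ y : Space in 𝓝 p, 0 < sgn b₁ * (y 0 + 2) :=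
    eventually_lt_of (by fun_prop) (by fun_prop) (by linarith)
  filter_upwards [n1, n2, n3, n4, n5] with y k1 k2 k3 k4 k5
  have k0 := sgn_mul_eq_of_pos k5
  have k6 : y 0 < 0 := by
    rcases sgn_cases b₁ with h | h <;> rw [h] at k2 k5 <;> linarith
  rw [mem_gluedPrisms_iff_mem_triangle k6 k3 k4, mem_triangle_iff, sgn_mul_eq_of_pos k1, k0,
    hq, sub_nonpos]
  exact ⟨fun h => h.1, fun h => ⟨h, k2.le⟩⟩

lemma exists_normal_innerSlope (b : Bool) {p : Space} (h1 : -1 < p 0) (h2 : p 0 < 0)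
    (h3 : -8 < p 1) (h4 : p 1 < 0) (hw : sgn b * (p 2 / √3) = p 0 + 1) :
    ∃ n, IsOutwardNormal gluedPrisms p n :=
  have e := sgn_true
  ⟨_, isOutwardNormal_slope true b (by rw [e]; linarith) (by rw [e]; linarith) h3 h4
    (by rw [e]; linarith)⟩

lemma exists_normal_outerSlope (b : Bool) {p : Space} (h1 : -4 < p 0) (h2 : p 0 < -3)
    (h3 : -8 < p 1) (h4 : p 1 < 0) (hw : sgn b * (p 2 / √3) = -3 - p 0) :
    ∃ n, IsOutwardNormal gluedPrisms p n :=
  have e := sgn_false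
  ⟨_, isOutwardNormal_slope false b (by rw [e]; linarith) (by rw [e]; linarith) h3 h4
    (by rw [e]; linarith)⟩

lemma exists_normal_outerWall {p : Space} (h0 : p 0 = -4) (h3 : -8 < p 1) (h4 : p 1 < 0)
    (hw : |p 2 / √3| < 1) : ∃ n, IsOutwardNormal gluedPrisms p n := by
  refine exists_isOutwardNormal_of_affine (-1) 0 0 (-4) (Or.inl (by norm_num)) (by linarith) ?_
  have n1 : ∀ᶠ y in 𝓝 p, |y 2 / √3| < -3 - y 0 :=
    eventually_lt_of (by fun_prop) (by fun_prop) (by linarith)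
  have n3 : ∀ᶠ y in 𝓝 p, -8 < y 1 := eventually_lt_of (by fun_prop) (by fun_prop) h3
  have n4 : ∀ᶠ y in 𝓝 p, y 1 < 0 := eventually_lt_of (by fun_prop) (by fun_prop) h4
  filter_upwards [n1, n3, n4] with y k1 k3 k4
  have k6 := abs_nonneg (y 2 / √3)
  rw [mem_gluedPrisms]
  constructor
  · rintro ((⟨a1, a2, a3, a4⟩ | ⟨a1, a2, a3, a4⟩) | (⟨a1, a2, a3, a4⟩ | ⟨a1, a2, a3, a4⟩) |
      (⟨a1, a2, a3, a4⟩ | ⟨a1, a2, a3, a4⟩) | (⟨a1, a2, a3, a4⟩ | ⟨a1, a2, a3, a4⟩)) <;> linarith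
  · intro h
    exact Or.inl (Or.inr ⟨k3.le, k4.le, by linarith, k1.le⟩)

/-- On the vertical face `p 0 = 0`, the points that are not glued to the next prism pair. -/
lemma exists_normal_innerWall {p : Space} (h0 : p 0 = 0) (h3 : -8 < p 1) (h4 : p 1 < 0)
    (hw : |p 2 / √3| < 1)
    (h : p 1 < -4 ∨ (p 1 + 1 < |p 2 / √3| ∧ -3 - p 1 < |p 2 / √3|)) :
    ∃ n, IsOutwardNormal gluedPrisms p n := by
  refine exists_isOutwardNormal_of_affine 1 0 0 0 (Or.inl (by norm_num)) (by linarith) ?_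
  have n1 : ∀ᶠ y in 𝓝 p, |y 2 / √3| < y 0 + 1 :=
    eventually_lt_of (by fun_prop) (by fun_prop) (by linarith)
  have n3 : ∀ᶠ y in 𝓝 p, -8 < y 1 := eventually_lt_of (by fun_prop) (by fun_prop) h3
  have n4 : ∀ᶠ y in 𝓝 p, y 1 < 0 := eventually_lt_of (by fun_prop) (by fun_prop) h4
  have n5 : ∀ᶠ y in 𝓝 p, y 1 < -4 ∨ (y 1 + 1 < |y 2 / √3| ∧ -3 - y 1 < |y 2 / √3|) := by
    rcases h with h | ⟨h, h'⟩
    · have n : ∀ᶠ y in 𝓝 p, y 1 < -4 := eventually_lt_of (by fun_prop) (by fun_prop) h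
      filter_upwards [n] with y hy using Or.inl hy
    · have n : ∀ᶠ y in 𝓝 p, y 1 + 1 < |y 2 / √3| :=
        eventually_lt_of (by fun_prop) (by fun_prop) h
      have n' : ∀ᶠ y in 𝓝 p, -3 - y 1 < |y 2 / √3| :=
        eventually_lt_of (by fun_prop) (by fun_prop) h'
      filter_upwards [n, n'] with y hy hy' using Or.inr ⟨hy, hy'⟩
  filter_upwards [n1, n3, n4, n5] with y k1 k3 k4 k5
  have k6 := abs_nonneg (y 2 / √3)
  rw [mem_gluedPrisms]
  constructor
  · rintro ((⟨a1, a2, a3, a4⟩ | ⟨a1, a2, a3, a4⟩) | (⟨a1, a2, a3, a4⟩ | ⟨a1, a2, a3, a4⟩) |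
      (⟨a1, a2, a3, a4⟩ | ⟨a1, a2, a3, a4⟩) | (⟨a1, a2, a3, a4⟩ | ⟨a1, a2, a3, a4⟩)) <;>
      rcases k5 with k5 | ⟨k5, k5'⟩ <;> linarith
  · intro h
    exact Or.inl (Or.inl ⟨k3.le, k4.le, by linarith, k1.le⟩)

lemma exists_normal_innerEnd {p : Space} (h0 : p 1 = -8) (h1 : p 0 < 0)
    (hw : |p 2 / √3| < p 0 + 1) : ∃ n, IsOutwardNormal gluedPrisms p n := by
  refine exists_isOutwardNormal_of_affine 0 (-1) 0 (-8) (Or.inr (Or.inl (by norm_num)))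
    (by linarith) ?_
  have n1 : ∀ᶠ y in 𝓝 p, |y 2 / √3| < y 0 + 1 :=
    eventually_lt_of (by fun_prop) (by fun_prop) hw
  have n2 : ∀ᶠ y in 𝓝 p, y 0 < 0 := eventually_lt_of (by fun_prop) (by fun_prop) h1
  have n3 : ∀ᶠ y in 𝓝 p, y 1 < -7 := eventually_lt_of (by fun_prop) (by fun_prop) (by linarith)
  filter_upwards [n1, n2, n3] with y k1 k2 k3
  have k6 := abs_nonneg (y 2 / √3)
  rw [mem_gluedPrisms]
  constructor
  · rintro ((⟨a1, a2, a3, a4⟩ | ⟨a1, a2, a3, a4⟩) | (⟨a1, a2, a3, a4⟩ | ⟨a1, a2, a3, a4⟩) |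
      (⟨a1, a2, a3, a4⟩ | ⟨a1, a2, a3, a4⟩) | (⟨a1, a2, a3, a4⟩ | ⟨a1, a2, a3, a4⟩)) <;> linarith
  · intro h
    exact Or.inl (Or.inl ⟨by linarith, by linarith, k2.le, k1.le⟩)

lemma exists_normal_outerEnd {p : Space} (h0 : p 1 = -8) (h1 : -4 < p 0)
    (hw : |p 2 / √3| < -3 - p 0) : ∃ n, IsOutwardNormal gluedPrisms p n := by
  refine exists_isOutwardNormal_of_affine 0 (-1) 0 (-8) (Or.inr (Or.inl (by norm_num)))
    (by linarith) ?_
  have n1 : ∀ᶠ y in 𝓝 p, |y 2 / √3| < -3 - y 0 :=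
    eventually_lt_of (by fun_prop) (by fun_prop) hw
  have n2 : ∀ᶠ y in 𝓝 p, -4 < y 0 := eventually_lt_of (by fun_prop) (by fun_prop) h1
  have n3 : ∀ᶠ y in 𝓝 p, y 1 < -7 := eventually_lt_of (by fun_prop) (by fun_prop) (by linarith)
  filter_upwards [n1, n2, n3] with y k1 k2 k3
  have k6 := abs_nonneg (y 2 / √3)
  rw [mem_gluedPrisms]
  constructor
  · rintro ((⟨a1, a2, a3, a4⟩ | ⟨a1, a2, a3, a4⟩) | (⟨a1, a2, a3, a4⟩ | ⟨a1, a2, a3, a4⟩) |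
      (⟨a1, a2, a3, a4⟩ | ⟨a1, a2, a3, a4⟩) | (⟨a1, a2, a3, a4⟩ | ⟨a1, a2, a3, a4⟩)) <;> linarith
  · intro h
    exact Or.inl (Or.inr ⟨by linarith, by linarith, k2.le, k1.le⟩)

/-- A planar patch: the image of a polygon under an affine map. -/
def flatPatch (p₀ a b : Space) (L : List (ℝ × ℝ × ℝ)) : Set Space :=
  (fun u : EuclideanSpace ℝ (Fin 2) => p₀ + u 0 • a + u 1 • b) '' polygon L

/-- The rectangle `[a, b] × [c, d]`. -/
def box (a b c d : ℝ) : List (ℝ × ℝ × ℝ) := [(-1, 0, -a), (1, 0, b), (0, -1, -c), (0, 1, d)]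

lemma mem_polygon_four {q₁ q₂ q₃ q₄ : ℝ × ℝ × ℝ} {u : EuclideanSpace ℝ (Fin 2)} :
    u ∈ polygon [q₁, q₂, q₃, q₄] ↔ q₁.1 * u 0 + q₁.2.1 * u 1 ≤ q₁.2.2 ∧
      q₂.1 * u 0 + q₂.2.1 * u 1 ≤ q₂.2.2 ∧ q₃.1 * u 0 + q₃.2.1 * u 1 ≤ q₃.2.2 ∧
      q₄.1 * u 0 + q₄.2.1 * u 1 ≤ q₄.2.2 := by
  simp [polygon]

lemma mem_polygon_three {q₁ q₂ q₃ : ℝ × ℝ × ℝ} {u : EuclideanSpace ℝ (Fin 2)} :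
    u ∈ polygon [q₁, q₂, q₃] ↔ q₁.1 * u 0 + q₁.2.1 * u 1 ≤ q₁.2.2 ∧
      q₂.1 * u 0 + q₂.2.1 * u 1 ≤ q₂.2.2 ∧ q₃.1 * u 0 + q₃.2.1 * u 1 ≤ q₃.2.2 := by
  simp [polygon]

/-- The boundary faces of the prism pair that belong to the boundary of the glued prisms: the upper
and lower sides of the two prisms, the upper and lower trapezoids left over on the vertical face
`p 0 = 0`, the vertical face `p 0 = -4`, the remaining rectangle of the face `p 0 = 0`, and the two
triangles at the end `p 1 = -8`. -/
noncomputable def pairFace : (Bool × Fin 3) ⊕ Fin 4 → Set Space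
  | .inl (b, i) =>
    ![flatPatch !₂[0, 0, sgn b * √3] !₂[1, 0, sgn b * √3] !₂[0, 1, 0] (box (-1) 0 (-8) 0),
      flatPatch !₂[0, 0, -3 * sgn b * √3] !₂[1, 0, -sgn b * √3] !₂[0, 1, 0] (box (-4) (-3) (-8) 0),
      flatPatch !₂[0, 0, 0] !₂[0, 1, 0] !₂[0, 0, sgn b * √3]
        [(0, 1, 1), (0, -1, 0), (1, -1, -1), (-1, -1, 3)]] i
  | .inr i =>
    ![flatPatch !₂[-4, 0, 0] !₂[0, 1, 0] !₂[0, 0, √3] (box (-8) 0 (-1) 1),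
      flatPatch !₂[0, 0, 0] !₂[0, 1, 0] !₂[0, 0, √3] (box (-8) (-4) (-1) 1),
      flatPatch !₂[0, -8, 0] !₂[1, 0, 0] !₂[0, 0, √3] [(-1, 1, 1), (-1, -1, 1), (1, 0, 0)],
      flatPatch !₂[0, -8, 0] !₂[1, 0, 0] !₂[0, 0, √3] [(1, 1, -3), (1, -1, -3), (-1, 0, 4)]] i

lemma isSmoothFace_innerSlope (b : Bool) : IsSmoothFace gluedPrisms (pairFace (.inl (b, 0))) := by
  have h3 := sqrt_three_pos
  have hs := sgn_mul_self b
  refine isSmoothFace_flat (box (-1) 0 (-8) 0) _ _ _ ?_ (by simp [box]) 8 ?_ !₂[-1 / 2, -1] ?_ ?_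
  · intro s t h
    have e0 := congrArg (fun p : Space => p 0) h
    have e1 := congrArg (fun p : Space => p 1) h
    simp at e0 e1
    exact ⟨e0, e1⟩
  · intro u hu
    obtain ⟨k1, k2, k3, k4⟩ := mem_polygon_four.1 hu
    simp only at k1 k2 k3 k4
    constructor <;> rw [abs_le] <;> constructor <;> linarith
  · simp [box]; norm_num
  · intro u hu
    simp [box] at hu
    obtain ⟨k1, k2, k3, k4⟩ := hu
    refine exists_normal_innerSlope b ?_ ?_ ?_ ?_ ?_ <;> simp
    · linarith
    · linarith
    · linarith
    · linarith
    · field_simp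
      linear_combination (u 0 + 1) * hs

lemma isSmoothFace_outerSlope (b : Bool) : IsSmoothFace gluedPrisms (pairFace (.inl (b, 1))) := by
  have h3 := sqrt_three_pos
  have hs := sgn_mul_self b
  refine isSmoothFace_flat (box (-4) (-3) (-8) 0) _ _ _ ?_ (by simp [box]) 8 ?_ !₂[-7 / 2, -1] ?_ ?_
  · intro s t h
    have e0 := congrArg (fun p : Space => p 0) h
    have e1 := congrArg (fun p : Space => p 1) h
    simp at e0 e1
    exact ⟨e0, e1⟩
  · intro u hu
    obtain ⟨k1, k2, k3, k4⟩ := mem_polygon_four.1 hu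
    simp only at k1 k2 k3 k4
    constructor <;> rw [abs_le] <;> constructor <;> linarith
  · simp [box]; norm_num
  · intro u hu
    simp [box] at hu
    obtain ⟨k1, k2, k3, k4⟩ := hu
    refine exists_normal_outerSlope b ?_ ?_ ?_ ?_ ?_ <;> simp
    · linarith
    · linarith
    · linarith
    · linarith
    · field_simp
      linear_combination (-3 - u 0) * hs

lemma isSmoothFace_trapezoid (b : Bool) : IsSmoothFace gluedPrisms (pairFace (.inl (b, 2))) := by
  have h3 := sqrt_three_pos
  have hs := sgn_mul_self b
  have hs0 : sgn b ≠ 0 := left_ne_zero_of_mul_eq_one hs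
  refine isSmoothFace_flat [(0, 1, 1), (0, -1, 0), (1, -1, -1), (-1, -1, 3)] _ _ _ ?_ (by simp) 8
    ?_ !₂[-2, 1 / 2] ?_ ?_
  · intro s t h
    have e1 := congrArg (fun p : Space => p 1) h
    have e2 := congrArg (fun p : Space => p 2) h
    simp [hs0] at e1 e2
    exact ⟨e1, e2⟩
  · intro u hu
    obtain ⟨k1, k2, k3, k4⟩ := mem_polygon_four.1 hu
    simp only at k1 k2 k3 k4
    constructor <;> rw [abs_le] <;> constructor <;> linarith
  · simp; norm_num
  · intro u hu
    simp at hu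
    obtain ⟨k1, k2, k3, k4⟩ := hu
    set p : Space := !₂[0, 0, 0] + u 0 • !₂[0, 1, 0] + u 1 • !₂[0, 0, sgn b * √3] with hp
    have e1 : p 1 = u 0 := by simp [hp]
    have e2 : |p 2 / √3| = u 1 := by
      have e : sgn b * (p 2 / √3) = u 1 := by
        simp [hp]
        field_simp
        linear_combination hs
      rw [← sgn_mul_eq_abs (b := b) (by rw [e]; exact k2.le), e]
    refine exists_normal_innerWall (by simp [hp]) ?_ ?_ ?_ (Or.inr ⟨?_, ?_⟩) <;>
      simp only [e1, e2] <;> linarith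

lemma isSmoothFace_walls (i : Fin 4) : IsSmoothFace gluedPrisms (pairFace (.inr i)) := by
  have h3 := sqrt_three_pos
  have habs : ∀ x : ℝ, x * √3 / √3 = x := fun x => by field_simp
  fin_cases i
  · refine isSmoothFace_flat (box (-8) 0 (-1) 1) _ _ _ ?_ (by simp [box]) 8 ?_ !₂[-1, 0] ?_ ?_
    · intro s t h
      have e1 := congrArg (fun p : Space => p 1) h
      have e2 := congrArg (fun p : Space => p 2) h
      simp at e1 e2
      exact ⟨e1, e2⟩
    · intro u hu
      obtain ⟨k1, k2, k3, k4⟩ := mem_polygon_four.1 hu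
      simp only at k1 k2 k3 k4
      constructor <;> rw [abs_le] <;> constructor <;> linarith
    · simp [box]
    · intro u hu
      simp [box] at hu
      obtain ⟨k1, k2, k3, k4⟩ := hu
      refine exists_normal_outerWall ?_ ?_ ?_ ?_ <;> simp
      · linarith
      · linarith
      · rw [abs_lt]; constructor <;> linarith
  · refine isSmoothFace_flat (box (-8) (-4) (-1) 1) _ _ _ ?_ (by simp [box]) 8 ?_ !₂[-5, 0] ?_ ?_
    · intro s t h
      have e1 := congrArg (fun p : Space => p 1) h
      have e2 := congrArg (fun p : Space => p 2) h
      simp at e1 e2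
      exact ⟨e1, e2⟩
    · intro u hu
      obtain ⟨k1, k2, k3, k4⟩ := mem_polygon_four.1 hu
      simp only at k1 k2 k3 k4
      constructor <;> rw [abs_le] <;> constructor <;> linarith
    · simp [box]; norm_num
    · intro u hu
      simp [box] at hu
      obtain ⟨k1, k2, k3, k4⟩ := hu
      refine exists_normal_innerWall ?_ ?_ ?_ ?_ (Or.inl ?_) <;> simp
      · linarith
      · linarith
      · rw [abs_lt]; constructor <;> linarith
      · linarith
  · refine isSmoothFace_flat [(-1, 1, 1), (-1, -1, 1), (1, 0, 0)] _ _ _ ?_ (by simp) 8 ?_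
      !₂[-1 / 2, 0] ?_ ?_
    · intro s t h
      have e1 := congrArg (fun p : Space => p 0) h
      have e2 := congrArg (fun p : Space => p 2) h
      simp at e1 e2
      exact ⟨e1, e2⟩
    · intro u hu
      obtain ⟨k1, k2, k3⟩ := mem_polygon_three.1 hu
      simp only at k1 k2 k3
      constructor <;> rw [abs_le] <;> constructor <;> linarith
    · simp; norm_num
    · intro u hu
      simp at hu
      obtain ⟨k1, k2, k3⟩ := hu
      refine exists_normal_innerEnd ?_ ?_ ?_ <;> simp
      · linarith
      · rw [abs_lt]; constructor <;> linarith
  · refine isSmoothFace_flat [(1, 1, -3), (1, -1, -3), (-1, 0, 4)] _ _ _ ?_ (by simp) 8 ?_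
      !₂[-7 / 2, 0] ?_ ?_
    · intro s t h
      have e1 := congrArg (fun p : Space => p 0) h
      have e2 := congrArg (fun p : Space => p 2) h
      simp at e1 e2
      exact ⟨e1, e2⟩
    · intro u hu
      obtain ⟨k1, k2, k3⟩ := mem_polygon_three.1 hu
      simp only at k1 k2 k3
      constructor <;> rw [abs_le] <;> constructor <;> linarith
    · simp; norm_num
    · intro u hu
      simp at hu
      obtain ⟨k1, k2, k3⟩ := hu
      refine exists_normal_outerEnd ?_ ?_ ?_ <;> simp
      · linarith
      · rw [abs_lt]; constructor <;> linarith

lemma isSmoothFace_pairFace (i) : IsSmoothFace gluedPrisms (pairFace i) := by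
  rcases i with ⟨b, i⟩ | i
  · fin_cases i
    · exact isSmoothFace_innerSlope b
    · exact isSmoothFace_outerSlope b
    · exact isSmoothFace_trapezoid b
  · exact isSmoothFace_walls i

lemma innerPrism_cover {p : Space} (hp : InnerPrism (p 0) (p 1) (p 2 / √3)) :
    (∃ i, p ∈ pairFace i) ∨ gluedPrisms ∈ 𝓝 p := by
  have h3 := sqrt_three_pos
  have h0 := abs_nonneg (p 2 / √3)
  obtain ⟨b, hb⟩ := exists_sgn_mul_nonneg (p 2 / √3)
  have hb' := sgn_mul_eq_abs hb
  have hs := sgn_mul_self b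
  have hz : p 2 = sgn b * |p 2 / √3| * √3 := by
    rw [← hb', ← mul_assoc, hs, one_mul]
    field_simp
  have hz' : p 2 = p 2 / √3 * √3 := by field_simp
  obtain ⟨h1, h2, h4, h5⟩ := hp
  have habs := abs_le.1 (le_refl |p 2 / √3|)
  rcases h5.eq_or_lt with heq | hlt
  · refine Or.inl ⟨.inl (b, 0), !₂[p 0, p 1], mem_polygon_four.2 ?_, ?_⟩
    · refine ⟨?_, ?_, ?_, ?_⟩ <;> simp <;> linarith
    · ext i
      fin_cases i <;> simp
      rw [hz, heq]; ring
  rcases h1.eq_or_lt with heq | h1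
  · refine Or.inl ⟨.inr 2, !₂[p 0, p 2 / √3], mem_polygon_three.2 ?_, ?_⟩
    · refine ⟨?_, ?_, ?_⟩ <;> simp <;> linarith
    · ext i
      fin_cases i <;> simp
      · exact heq
  have n1 : ∀ᶠ y in 𝓝 p, |y 2 / √3| < y 0 + 1 :=
    eventually_lt_of (by fun_prop) (by fun_prop) hlt
  have n2 : ∀ᶠ y in 𝓝 p, -8 < y 1 := eventually_lt_of (by fun_prop) (by fun_prop) h1
  rcases h4.eq_or_lt with h4 | h4
  · -- the vertical face, partly glued to the next prism pair
    by_cases h6 : p 1 ≤ -4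
    · refine Or.inl ⟨.inr 1, !₂[p 1, p 2 / √3], mem_polygon_four.2 ?_, ?_⟩
      · refine ⟨?_, ?_, ?_, ?_⟩ <;> simp <;> linarith
      · ext i
        fin_cases i <;> simp
        · exact h4.symm
    rw [not_le] at h6
    by_cases h7 : p 1 + 1 ≤ |p 2 / √3| ∧ -3 - p 1 ≤ |p 2 / √3|
    · obtain ⟨h7, h8⟩ := h7
      refine Or.inl ⟨.inl (b, 2), !₂[p 1, |p 2 / √3|], mem_polygon_four.2 ?_, ?_⟩
      · refine ⟨?_, ?_, ?_, ?_⟩ <;> simp only [Matrix.cons_val_zero, Matrix.cons_val_one] <;> linarith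
      · ext i
        fin_cases i
        · simp [h4]
        · simp
        · simp only [PiLp.add_apply, PiLp.smul_apply, smul_eq_mul]
          simp only [Matrix.cons_val_zero, Matrix.cons_val_one]
          conv_rhs => rw [show p (Fin.mk 2 _) = p 2 from rfl, hz]
          simp; ring
    right
    rcases h2.eq_or_lt with h2 | h2
    · -- near the vertical axis the four inner prisms surround the point
      have n3 : ∀ᶠ y in 𝓝 p, |y 2 / √3| < 1 - |y 0| - |y 1| :=
        eventually_lt_of (by fun_prop) (by fun_prop) (by rw [h4, h2]; simpa [h4] using hlt)
      filter_upwards [n3] with y k3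
      have k0 := abs_nonneg (y 2 / √3)
      have k1 := neg_abs_le (y 0)
      have k2 := le_abs_self (y 0)
      have k4 := neg_abs_le (y 1)
      have k5 := le_abs_self (y 1)
      rw [mem_gluedPrisms]
      rcases le_total (y 0) 0 with g | g <;> rcases le_total (y 1) 0 with g' | g'
      · refine Or.inl (Or.inl ⟨?_, ?_, ?_, ?_⟩) <;> linarith
      · refine Or.inr (Or.inr (Or.inr (Or.inl ⟨?_, ?_, ?_, ?_⟩))) <;> linarith
      · refine Or.inr (Or.inl (Or.inl ⟨?_, ?_, ?_, ?_⟩)) <;> linarith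
      · refine Or.inr (Or.inr (Or.inl (Or.inl ⟨?_, ?_, ?_, ?_⟩))) <;> linarith
    · have n3 : ∀ᶠ y in 𝓝 p, y 1 < 0 := eventually_lt_of (by fun_prop) (by fun_prop) h2
      have n4 : ∀ᶠ y in 𝓝 p, -4 < y 1 := eventually_lt_of (by fun_prop) (by fun_prop) h6
      have n5 : ∀ᶠ y in 𝓝 p, y 0 < 8 :=
        eventually_lt_of (by fun_prop) (by fun_prop) (by linarith)
      have n6 : ∀ᶠ y in 𝓝 p, |y 2 / √3| < y 1 + 1 ∨ |y 2 / √3| < -3 - y 1 := by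
        rw [not_and_or, not_le, not_le] at h7
        rcases h7 with h7 | h7
        · have n : ∀ᶠ y in 𝓝 p, |y 2 / √3| < y 1 + 1 :=
            eventually_lt_of (by fun_prop) (by fun_prop) h7
          filter_upwards [n] with y hy using Or.inl hy
        · have n : ∀ᶠ y in 𝓝 p, |y 2 / √3| < -3 - y 1 :=
            eventually_lt_of (by fun_prop) (by fun_prop) h7
          filter_upwards [n] with y hy using Or.inr hy
      filter_upwards [n1, n2, n3, n4, n5, n6] with y k1 k2 k3 k4 k5 k6
      rw [mem_gluedPrisms]
      rcases le_total (y 0) 0 with g | g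
      · exact Or.inl (Or.inl ⟨k2.le, k3.le, g, k1.le⟩)
      · rcases k6 with k6 | k6
        · refine Or.inr (Or.inl (Or.inl ⟨?_, ?_, ?_, ?_⟩)) <;> linarith
        · refine Or.inr (Or.inl (Or.inr ⟨?_, ?_, ?_, ?_⟩)) <;> linarith
  · right
    have hc : p ∈ innerCore := ⟨h1, h4, hlt, by linarith⟩
    exact mem_of_superset (isOpen_innerCore.mem_nhds hc) innerCore_subset

lemma outerPrism_cover {p : Space} (hp : OuterPrism (p 0) (p 1) (p 2 / √3)) :
    (∃ i, p ∈ pairFace i) ∨ gluedPrisms ∈ 𝓝 p := by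
  have h3 := sqrt_three_pos
  have h0 := abs_nonneg (p 2 / √3)
  obtain ⟨b, hb⟩ := exists_sgn_mul_nonneg (p 2 / √3)
  have hb' := sgn_mul_eq_abs hb
  have hs := sgn_mul_self b
  have hz : p 2 = sgn b * |p 2 / √3| * √3 := by
    rw [← hb', ← mul_assoc, hs, one_mul]
    field_simp
  have hz' : p 2 = p 2 / √3 * √3 := by field_simp
  obtain ⟨h1, h2, h4, h5⟩ := hp
  have habs := abs_le.1 (le_refl |p 2 / √3|)
  rcases h5.eq_or_lt with heq | hlt
  · refine Or.inl ⟨.inl (b, 1), !₂[p 0, p 1], mem_polygon_four.2 ?_, ?_⟩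
    · refine ⟨?_, ?_, ?_, ?_⟩ <;> simp <;> linarith
    · ext i
      fin_cases i <;> simp
      rw [hz, heq]; ring
  rcases h1.eq_or_lt with heq | h1
  · refine Or.inl ⟨.inr 3, !₂[p 0, p 2 / √3], mem_polygon_three.2 ?_, ?_⟩
    · refine ⟨?_, ?_, ?_⟩ <;> simp <;> linarith
    · ext i
      fin_cases i <;> simp
      · exact heq
  rcases h4.eq_or_lt with h4 | h4
  · refine Or.inl ⟨.inr 0, !₂[p 1, p 2 / √3], mem_polygon_four.2 ?_, ?_⟩
    · refine ⟨?_, ?_, ?_, ?_⟩ <;> simp <;> linarith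
    · ext i
      fin_cases i <;> simp
      · exact h4
  · right
    have hc : p ∈ outerCore := ⟨h1, h4, hlt, by linarith⟩
    exact mem_of_superset (isOpen_outerCore.mem_nhds hc) outerCore_subset

lemma isBody_gluedPrisms : IsBody gluedPrisms := by
  refine isBody_of_faces (C := gluedCore) (fun i : Fin 4 × _ => (turn ^ (i.1 : ℕ)) '' pairFace i.2)
    isClosed_gluedPrisms isBounded_gluedPrisms isOpen_gluedCore isConnected_gluedCore
    gluedCore_subset gluedPrisms_subset_closure ?_ ?_
  · rintro ⟨k, i⟩
    have := (isSmoothFace_pairFace i).map (turn ^ (k : ℕ))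
    rwa [turn_pow_image_gluedPrisms] at this
  · intro p hp
    obtain ⟨k, q, hq, rfl⟩ := mem_gluedPrisms_iff_exists.1 hp
    rcases (mem_pairPrism.1 hq).elim innerPrism_cover outerPrism_cover with ⟨i, hi⟩ | h
    · exact Or.inl ⟨(k, i), q, hi, rfl⟩
    · right
      have := (turn ^ (k : ℕ)).toHomeomorph.isOpenMap.image_mem_nhds h
      change (turn ^ (k : ℕ)) '' gluedPrisms ∈ 𝓝 ((turn ^ (k : ℕ)) q) at this
      rwa [turn_pow_image_gluedPrisms] at this

/-! ### The glued prisms: their trajectories -/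

/-- The rectangle over which the first prism pair lies. -/
def footprint : Set Space := {p | (-4 < p 0 ∧ p 0 < 0) ∧ -8 < p 1 ∧ p 1 < 0}

/-- The part of the rectangle over which the inner prism of the first pair lies. -/
def innerStrip : Set Space := {p | (-1 < p 0 ∧ p 0 < 0) ∧ -8 < p 1 ∧ p 1 < 0}

lemma footprint_of_swapBy {q : Space} (hq : q ∈ footprint) :
    swapBy innerStrip !₂[-3, 0, 0] q ∈ footprint := by
  obtain ⟨⟨h1, h2⟩, h3, h4⟩ := hq
  unfold swapBy
  split_ifs with g g'
  · obtain ⟨⟨g1, g2⟩, g3, g4⟩ := g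
    refine ⟨⟨?_, ?_⟩, ?_, ?_⟩ <;> simp <;> linarith
  · obtain ⟨⟨g1, g2⟩, g3, g4⟩ := g'
    simp at g1 g2 g3 g4
    refine ⟨⟨?_, ?_⟩, ?_, ?_⟩ <;> simp <;> linarith
  · exact ⟨⟨h1, h2⟩, h3, h4⟩

lemma swapBy_of_notMem_footprint {q : Space} (hq : q ∉ footprint) :
    swapBy innerStrip !₂[-3, 0, 0] q = q := by
  unfold swapBy
  split_ifs with g g'
  · obtain ⟨⟨g1, g2⟩, g3, g4⟩ := g
    exact absurd ⟨⟨by linarith, g2⟩, g3, g4⟩ hq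
  · obtain ⟨⟨g1, g2⟩, g3, g4⟩ := g'
    simp at g1 g2 g3 g4
    exact absurd ⟨⟨by linarith, by linarith⟩, g3, g4⟩ hq
  · rfl

/-- In the plane `p 1 = y`, the two prisms act like the two triangles of the basic mechanism, with
the vertical axis `p 0 = -2`. -/
lemma scatters_gluedPrisms_axial (b : Bool) {y r : ℝ} (hy : -8 < y) (hy' : y < 0) (hr : 1 < r)
    (hr' : r < 2) : ∃ z, Scatters gluedPrisms (axial !₂[-2, y, 0] (sgn b) 0 r 0) down
      (axial !₂[-2, y, 0] (sgn b) 0 (r - 3) z) down := by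
  have s3 := sqrt_three_pos
  have hs := sgn_mul_self b
  have hmem : ∀ s z : ℝ, |s| < 2 →
      (axial !₂[-2, y, 0] (sgn b) 0 s z ∈ gluedPrisms ↔ (|s|, z) ∈ triangle) := by
    intro s z h
    obtain ⟨h1, h2⟩ := abs_lt.1 h
    have h4 : -2 + s * sgn b < 0 := by
      rcases sgn_cases b with h | h <;> rw [h] <;> linarith
    rw [mem_gluedPrisms_iff_mem_triangle (by simpa [axial] using h4) (by simpa [axial] using hy)
      (by simpa [axial] using hy')]
    have e : |s * sgn b| = |s| := by rcases sgn_cases b with h | h <;> simp [h]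
    simp [axial, e]
  have a1 : |r| = r := abs_of_pos (by linarith)
  have a2 : |r - 3| = 3 - r := by rw [abs_of_neg (by linarith)]; ring
  have harr : Arrives gluedPrisms (axial !₂[-2, y, 0] (sgn b) 0 r 0) down
      (axial !₂[-2, y, 0] (sgn b) 0 r (√3 * (r - 1))) down := by
    have := arrives_of_line (B := gluedPrisms) (axial !₂[-2, y, 0] (sgn b) 0 r 0) down
      (-(√3 * (r - 1))) (fun t ht => by
        rw [axial_add_smul_down, hmem _ _ (by rwa [a1])]
        apply notMem_triangle_of_lt
        rw [a1]
        exact lt_of_lt_of_le (by linarith) (le_abs_self _))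
    rw [axial_add_smul_down] at this
    simpa using this
  have h1 := harr.cross (by
    have := isOutwardNormal_slope b true (p := axial !₂[-2, y, 0] (sgn b) 0 r (√3 * (r - 1)))
      (by simp [axial]; nlinarith) (by simp [axial]; nlinarith) (by simpa [axial] using hy)
      (by simpa [axial] using hy') (by
        simp [axial, sgn_true]
        field_simp
        linear_combination -hs)
    simpa [sgn_true] using this) (fun s hs hs' => by
      rw [hmem _ _ (by rw [abs_lt]; constructor <;> linarith)]
      exact crossing_notMem_triangle hs hs')
  have h2 : IsOutwardNormal gluedPrisms
      (axial !₂[-2, y, 0] (sgn b) 0 (r - 3) (√3 * (r - 2)))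
      !₂[√3 / 2 * sgn b, √3 / 2 * 0, -(1 / 2)] := by
    have hn : sgn (!b) = -sgn b := by cases b <;> simp [sgn]
    have := isOutwardNormal_slope (!b) false
      (p := axial !₂[-2, y, 0] (sgn b) 0 (r - 3) (√3 * (r - 2)))
      (by simp [axial, hn]; nlinarith) (by simp [axial, hn]; nlinarith) (by simpa [axial] using hy)
      (by simpa [axial] using hy') (by
        simp [axial, hn, sgn_false]
        field_simp
        linear_combination (r - 3) * hs)
    rw [hn] at this
    convert this using 3
    · ring
    · simp [sgn_false]; norm_num
  obtain ⟨e1, e2⟩ := reflect_velocity (a := sgn b) (b := 0) (by linear_combination hs)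
  obtain ⟨s, h⟩ := h1.scatters h2 (by rw [e1]; norm_num) e2 (fun t ht => by
    rw [axial_add_smul_down, hmem _ _ (by rw [a2]; linarith)]
    apply notMem_triangle_of_lt
    rw [a2]
    exact lt_of_lt_of_le (by nlinarith) (neg_le_abs _))
  rw [axial_add_smul_down] at h
  exact ⟨_, h⟩

lemma scatters_gluedPrisms_of_mem_footprint {x : Space} (hx : x 2 = 0) (hf : x ∈ footprint)
    (h1 : x 0 ≠ -1) (h3 : x 0 ≠ -3) : ∃ x', Scatters gluedPrisms x down x' down ∧
      x' - ⟪x', down⟫ • down = swapBy innerStrip !₂[-3, 0, 0] x := by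
  obtain ⟨⟨f1, f2⟩, f3, f4⟩ := hf
  rcases lt_or_gt_of_ne h1 with g | g
  · have hn : x ∉ innerStrip := fun h => by linarith [h.1.1]
    rcases lt_or_gt_of_ne h3 with g' | g'
    · have hi : x - !₂[-3, 0, 0] ∈ innerStrip := by
        refine ⟨⟨?_, ?_⟩, ?_, ?_⟩ <;> simp <;> linarith
      obtain ⟨z, hz⟩ := scatters_gluedPrisms_axial false f3 f4 (r := -(x 0 + 2)) (by linarith)
        (by linarith)
      have e : x = axial !₂[-2, x 1, 0] (sgn false) 0 (-(x 0 + 2)) 0 := by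
        ext i
        fin_cases i <;> simp [axial, sgn_false, hx]
      rw [← e] at hz
      refine ⟨_, hz, ?_⟩
      rw [sub_inner_smul_down, swapBy, if_neg hn, if_pos hi]
      ext i
      fin_cases i <;> simp [axial, sgn_false, hx]
      ring
    · have hi : x - !₂[-3, 0, 0] ∉ innerStrip := fun h => by
        have := h.1.2
        simp at this
        linarith
      refine ⟨x, scatters_of_line _ _ fun t ht => ?_, ?_⟩
      · rw [mem_gluedPrisms_iff_mem_triangle (by simpa [down] using f2)
          (by simpa [down] using f3) (by simpa [down] using f4)] at ht
        have := triangle_one_le ht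
        have h : |x 0 + 2| < 1 := by rw [abs_lt]; constructor <;> linarith
        simp [down] at this
        linarith
      · rw [sub_inner_smul_down, swapBy, if_neg hn, if_neg hi]
        ext i
        fin_cases i <;> simp [hx]
  · have hi : x ∈ innerStrip := ⟨⟨g, f2⟩, f3, f4⟩
    obtain ⟨z, hz⟩ := scatters_gluedPrisms_axial true f3 f4 (r := x 0 + 2) (by linarith)
      (by linarith)
    have e : x = axial !₂[-2, x 1, 0] (sgn true) 0 (x 0 + 2) 0 := by
      ext i
      fin_cases i <;> simp [axial, sgn_true, hx]
    rw [← e] at hz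
    refine ⟨_, hz, ?_⟩
    rw [sub_inner_smul_down, swapBy, if_pos hi]
    ext i
    fin_cases i <;> simp [axial, sgn_true, hx]
    ring

lemma turn_pow_apply_two (n : ℕ) (p : Space) : (turn ^ n) p 2 = p 2 := by
  induction n with
  | zero => rfl
  | succ n ih =>
    rw [pow_succ', LinearIsometryEquiv.coe_mul, Function.comp_apply, turn_apply, ← ih]
    simp

lemma turn_pow_down (n : ℕ) : (turn ^ n) down = down := by
  induction n with
  | zero => rfl
  | succ n ih =>
    rw [pow_succ', LinearIsometryEquiv.coe_mul, Function.comp_apply, ih, turn_apply]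
    ext i
    fin_cases i <;> simp [down]

lemma turn_pow_symm_apply_two (n : ℕ) (p : Space) : (turn ^ n).symm p 2 = p 2 := by
  rw [← turn_pow_apply_two n, LinearIsometryEquiv.apply_symm_apply]

/-- The four rectangles over which the prism pairs lie do not overlap. -/
lemma footprint_injective {j k : Fin 4} {q q' : Space} (hq : q ∈ footprint) (hq' : q' ∈ footprint)
    (h : (turn ^ (j : ℕ)) q = (turn ^ (k : ℕ)) q') : j = k := by
  have e : ∀ (k : Fin 4) (q : Space), (turn ^ (k : ℕ)) q =
      ![!₂[q 0, q 1, q 2], !₂[-q 1, q 0, q 2], !₂[-q 0, -q 1, q 2], !₂[q 1, -q 0, q 2]] k := by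
    intro k q
    fin_cases k
    · ext i; fin_cases i <;> simp
    · simp [turn_apply]
    · simp [turn_pow_two_apply]
    · simp [turn_pow_three_apply]
  rw [e, e] at h
  have h0 := congrArg (fun p : Space => p 0) h
  have h1 := congrArg (fun p : Space => p 1) h
  obtain ⟨⟨a1, a2⟩, a3, a4⟩ := hq
  obtain ⟨⟨b1, b2⟩, b3, b4⟩ := hq'
  fin_cases j <;> fin_cases k <;> first | rfl | (exfalso; simp at h0 h1; linarith)

/-- The action of the `k`-th prism pair on the plane of initial positions: it exchanges the strips
below its two prisms by a translation. -/
noncomputable def pairSwap (k : Fin 4) : perp down → perp down :=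
  swapBy {x | (turn ^ (k : ℕ)).symm x ∈ innerStrip}
    ⟨(turn ^ (k : ℕ)) !₂[-3, 0, 0], mem_perp_down.2 (by rw [turn_pow_apply_two]; simp)⟩

lemma coe_pairSwap (k : Fin 4) (x : perp down) : (pairSwap k x : Space) =
    (turn ^ (k : ℕ)) (swapBy innerStrip !₂[-3, 0, 0] ((turn ^ (k : ℕ)).symm x)) := by
  set d : perp down := ⟨(turn ^ (k : ℕ)) !₂[-3, 0, 0],
    mem_perp_down.2 (by rw [turn_pow_apply_two]; simp)⟩
  have h : x - d ∈ {x : perp down | (turn ^ (k : ℕ)).symm (x : Space) ∈ innerStrip} ↔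
      (turn ^ (k : ℕ)).symm (x : Space) - !₂[-3, 0, 0] ∈ innerStrip := by
    change (turn ^ (k : ℕ)).symm ((x : Space) - (turn ^ (k : ℕ)) !₂[-3, 0, 0]) ∈ innerStrip ↔ _
    rw [map_sub, LinearIsometryEquiv.symm_apply_apply]
  have h' : x ∈ {x : perp down | (turn ^ (k : ℕ)).symm (x : Space) ∈ innerStrip} ↔
      (turn ^ (k : ℕ)).symm (x : Space) ∈ innerStrip := Iff.rfl
  change ((swapBy _ d x : perp down) : Space) = _
  by_cases h1 : (turn ^ (k : ℕ)).symm (x : Space) ∈ innerStrip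
  · rw [swapBy, swapBy, if_pos (h'.2 h1), if_pos h1, map_add, LinearIsometryEquiv.apply_symm_apply]
    rfl
  · by_cases h2 : (turn ^ (k : ℕ)).symm (x : Space) - !₂[-3, 0, 0] ∈ innerStrip
    · rw [swapBy, swapBy, if_neg (mt h'.1 h1), if_neg h1, if_pos (h.2 h2), if_pos h2, map_sub,
        LinearIsometryEquiv.apply_symm_apply]
      rfl
    · rw [swapBy, swapBy, if_neg (mt h'.1 h1), if_neg h1, if_neg (mt h.1 h2), if_neg h2,
        LinearIsometryEquiv.apply_symm_apply]

lemma measurePreserving_pairSwap (k : Fin 4) :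
    MeasurePreserving (pairSwap k) (planeMeasure down) (planeMeasure down) := by
  have hc : Continuous fun x : perp down => (turn ^ (k : ℕ)).symm (x : Space) :=
    (turn ^ (k : ℕ)).symm.continuous.comp continuous_subtype_val
  have ho : IsOpen innerStrip := by
    have h1 : IsOpen {p : Space | -1 < p 0} := isOpen_lt (by fun_prop) (by fun_prop)
    have h2 : IsOpen {p : Space | p 0 < 0} := isOpen_lt (by fun_prop) (by fun_prop)
    have h3 : IsOpen {p : Space | -8 < p 1} := isOpen_lt (by fun_prop) (by fun_prop)
    have h4 : IsOpen {p : Space | p 1 < 0} := isOpen_lt (by fun_prop) (by fun_prop)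
    exact (h1.inter h2).inter (h3.inter h4)
  refine measurePreserving_swapBy _ (ho.preimage hc).measurableSet fun x hx hx' => ?_
  have h1 := hx.1.1
  have h2 := hx'.1.2
  simp at h2
  linarith

lemma pairSwap_of_notMem {k : Fin 4} {x : perp down}
    (h : (turn ^ (k : ℕ)).symm (x : Space) ∉ footprint) : pairSwap k x = x := by
  ext1
  rw [coe_pairSwap, swapBy_of_notMem_footprint h, LinearIsometryEquiv.apply_symm_apply]

/-- The map `x ↦ x̃⁺ (x, v)` for the glued prisms. -/
noncomputable def gluedSwap : perp down → perp down :=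
  pairSwap 0 ∘ pairSwap 1 ∘ pairSwap 2 ∘ pairSwap 3

lemma measurePreserving_gluedSwap :
    MeasurePreserving gluedSwap (planeMeasure down) (planeMeasure down) :=
  (measurePreserving_pairSwap 0).comp <| (measurePreserving_pairSwap 1).comp <|
    (measurePreserving_pairSwap 2).comp (measurePreserving_pairSwap 3)

lemma gluedSwap_of_mem {k : Fin 4} {x : perp down}
    (h : (turn ^ (k : ℕ)).symm (x : Space) ∈ footprint) : gluedSwap x = pairSwap k x := by
  have h' : (turn ^ (k : ℕ)).symm (pairSwap k x : Space) ∈ footprint := by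
    rw [coe_pairSwap, LinearIsometryEquiv.symm_apply_apply]
    exact footprint_of_swapBy h
  have key : ∀ y : perp down, (turn ^ (k : ℕ)).symm (y : Space) ∈ footprint → ∀ j, j ≠ k →
      pairSwap j y = y := fun y hy j hj => pairSwap_of_notMem fun hc =>
    hj (footprint_injective hc hy (by simp))
  have e := key x h
  have e' := key _ h'
  fin_cases k <;> simp at e e' <;> simp [gluedSwap, e, e']

lemma gluedSwap_of_notMem {x : perp down}
    (h : ∀ k : Fin 4, (turn ^ (k : ℕ)).symm (x : Space) ∉ footprint) : gluedSwap x = x := by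
  simp only [gluedSwap, Function.comp_apply, pairSwap_of_notMem (h _)]

/-- In the plane of initial positions, the lines parallel to the sides of a rectangle are null. -/
lemma ae_perp_down_turn_ne (k : Fin 4) (i : Fin 3) (hi : i ≠ 2) (c : ℝ) :
    ∀ᵐ x : perp down ∂(planeMeasure down), (turn ^ (k : ℕ)).symm (x : Space) i ≠ c := by
  refine ae_linearMap_ne (planeMeasure down)
    (l := ((EuclideanSpace.proj i : Space →L[ℝ] ℝ) : Space →ₗ[ℝ] ℝ) ∘ₗ
      ((turn ^ (k : ℕ)).symm.toLinearEquiv : Space →ₗ[ℝ] Space) ∘ₗ (perp down).subtype) ?_ c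
  intro h
  have h1 := LinearMap.congr_fun h ⟨(turn ^ (k : ℕ)) (EuclideanSpace.single i (1 : ℝ)),
    mem_perp_down.2 (by rw [turn_pow_apply_two]; simp [hi.symm])⟩
  simp at h1

lemma ae_scatters_gluedPrisms : ∀ᵐ x : perp down ∂(planeMeasure down),
    ∃ x', Scatters gluedPrisms x down x' down ∧ x' - ⟪x', down⟫ • down = (gluedSwap x : Space) := by
  have hne : ∀ c : ℝ, ∀ᵐ x : perp down ∂(planeMeasure down), ∀ k : Fin 4,
      (turn ^ (k : ℕ)).symm (x : Space) 0 ≠ c ∧ (turn ^ (k : ℕ)).symm (x : Space) 1 ≠ c :=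
    fun c => ae_all_iff.2 fun k =>
      (ae_perp_down_turn_ne k 0 (by decide) c).and (ae_perp_down_turn_ne k 1 (by decide) c)
  -- the edges of the prisms are excluded, also those hidden in the glued faces
  filter_upwards [hne 0, hne (-1), hne (-3), hne (-4), hne (-8)] with x g0 g1 g3 g4 g8
  have hx := mem_perp_down.1 x.2
  by_cases h : ∃ k : Fin 4, (turn ^ (k : ℕ)).symm (x : Space) ∈ footprint
  · obtain ⟨k, hk⟩ := h
    obtain ⟨x', hx', e⟩ := scatters_gluedPrisms_of_mem_footprint
      (by rw [turn_pow_symm_apply_two, hx]) hk (g1 k).1 (g3 k).1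
    have hm := hx'.map (turn ^ (k : ℕ))
    rw [turn_pow_image_gluedPrisms, turn_pow_down, LinearIsometryEquiv.apply_symm_apply] at hm
    refine ⟨_, hm, ?_⟩
    have hi : ⟪(turn ^ (k : ℕ)) x', down⟫ = ⟪x', down⟫ := by
      rw [← LinearIsometryEquiv.inner_map_map (turn ^ (k : ℕ)) x' down, turn_pow_down]
    rw [gluedSwap_of_mem hk, coe_pairSwap, ← e, map_sub, map_smul, turn_pow_down, hi]
  · rw [not_exists] at h
    refine ⟨x, scatters_of_line _ _ fun t ht => ?_, ?_⟩
    · obtain ⟨k, q, hq, e⟩ := mem_gluedPrisms_iff_exists.1 ht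
      have hq' : q = (turn ^ (k : ℕ)).symm (x : Space) + t • down := by
        apply (turn ^ (k : ℕ)).injective
        rw [e, map_add, map_smul, turn_pow_down, LinearIsometryEquiv.apply_symm_apply]
      have q0 : q 0 = (turn ^ (k : ℕ)).symm (x : Space) 0 := by rw [hq']; simp [down]
      have q1 : q 1 = (turn ^ (k : ℕ)).symm (x : Space) 1 := by rw [hq']; simp [down]
      obtain ⟨a1, a2, -, a3⟩ := hq
      obtain ⟨a4, a5⟩ := abs_le.1 a3
      simp only at a4 a5
      have b0 := g0 k
      rw [← q0, ← q1] at b0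
      have b4 := (g4 k).1
      rw [← q0] at b4
      have b8 := (g8 k).2
      rw [← q1] at b8
      refine h k ⟨⟨q0 ▸ ?_, q0 ▸ ?_⟩, q1 ▸ ?_, q1 ▸ ?_⟩
      · exact lt_of_le_of_ne (by linarith) b4.symm
      · exact lt_of_le_of_ne (by linarith) b0.1
      · exact lt_of_le_of_ne a1 b8.symm
      · exact lt_of_le_of_ne a2 b0.2
    · rw [gluedSwap_of_notMem h, sub_inner_smul_down]
      ext i
      fin_cases i <;> simp [hx]

lemma leavesNoTrace_gluedPrisms : LeavesNoTrace gluedPrisms down := by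
  refine ⟨zeroResistance_of_ae_perp norm_down ?_, gluedSwap, measurePreserving_gluedSwap,
    ae_scatters_gluedPrisms⟩
  filter_upwards [ae_scatters_gluedPrisms] with x ⟨x', hx', _⟩ using ⟨x', hx'⟩

/-- The particles over the inner prism of the first pair are displaced. -/
lemma not_invisible_gluedPrisms : ¬ Invisible gluedPrisms down := by
  rintro ⟨-, h⟩
  have ho : IsOpen {x : perp down | ((-1 < (x : Space) 0 ∧ (x : Space) 0 < 0) ∧
      -8 < (x : Space) 1 ∧ (x : Space) 1 < 0)} := by
    have hc : ∀ i, Continuous fun x : perp down => (x : Space) i := fun i => by fun_prop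
    exact ((isOpen_lt continuous_const (hc 0)).inter (isOpen_lt (hc 0) continuous_const)).inter
      ((isOpen_lt continuous_const (hc 1)).inter (isOpen_lt (hc 1) continuous_const))
  have hne : {x : perp down | ((-1 < (x : Space) 0 ∧ (x : Space) 0 < 0) ∧
      -8 < (x : Space) 1 ∧ (x : Space) 1 < 0)}.Nonempty := by
    refine ⟨⟨!₂[-1 / 2, -1, 0], mem_perp_down.2 (by simp)⟩, ⟨?_, ?_⟩, ?_, ?_⟩ <;> norm_num
  obtain ⟨x, hx, x', hx', e⟩ :=
    ((frequently_ae_mem_iff.2 (ho.measure_pos _ hne).ne').and_eventually h).exists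
  obtain ⟨⟨h1, h2⟩, h3, h4⟩ := hx
  obtain ⟨x'', hx'', e'⟩ := scatters_gluedPrisms_of_mem_footprint (mem_perp_down.1 x.2)
    ⟨⟨by linarith, h2⟩, h3, h4⟩ (by linarith) (by linarith)
  rw [← (hx'.unique hx'').1, e, swapBy, if_pos ⟨⟨h1, h2⟩, h3, h4⟩] at e'
  have := congrArg (fun p : Space => p 0) e'
  simp at this

theorem theorem1 (v₀ : Space) (hv₀ : ‖v₀‖ = 1) :
    (∃ B : Set Space, IsPlacement v₀ rotatedTriangle B ∧ IsBody B ∧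
      ZeroResistance B v₀ ∧ ¬ LeavesNoTrace B v₀) ∧
    (∃ B : Set Space, IsPlacement v₀ gluedPrisms B ∧ IsBody B ∧
      LeavesNoTrace B v₀ ∧ ¬ Invisible B v₀) ∧
    (∃ B : Set Space, (∃ ε > 0, IsPlacement v₀ (shiftedDoubled ε) B) ∧ IsBody B ∧
      Invisible B v₀) := by
  obtain ⟨e, rfl⟩ := exists_linearIsometryEquiv_map_eq (norm_down.trans hv₀.symm)
  refine ⟨⟨e '' rotatedTriangle, ⟨e, rfl, rfl⟩, isBody_rotatedTriangle.map e,
      zeroResistance_rotatedTriangle.map e, ?_⟩,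
    ⟨e '' gluedPrisms, ⟨e, rfl, rfl⟩, isBody_gluedPrisms.map e, leavesNoTrace_gluedPrisms.map e, ?_⟩,
    ⟨e '' stack, ⟨2 / √3, by positivity, e, rfl, ?_⟩, isBody_stack.map e, invisible_stack.map e⟩⟩
  · rw [leavesNoTrace_image_iff]
    exact not_leavesNoTrace_rotatedTriangle
  · rw [invisible_image_iff]
    exact not_invisible_gluedPrisms
  · rw [shiftedDoubled_eq_stack]
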